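/- **Conventions.** Let $k$ be a commutative ring. A weak bialgebra is a $k$-module $H$ with a unital associative algebra structure and a counital coassociative coalgebra structure such that $\Delta(hl)=\Delta(h)\Delta(l)$, $$\Delta^2(1)=1_{(1)}\otimes 1_{(2)}1_{(1')}\otimes 1_{(2')}=1_{(1)}\otimes 1_{(1')}1_{(2)}\otimes 1_{(2')},\qquad \varepsilon(hxl)=\varepsilon(hx_{(1)})\varepsilon(x_{(2)}l)=\varepsilon(hx_{(2)})\varepsilon(x_{(1)}l).$$ Put $\varepsilon_t(h)=\varepsilon(1_{(1)}h)1_{(2)}$, $\varepsilon_s(h)=1_{(1)}\varepsilon(h1_{(2)})$, $H_t=\operatorname{Im}\varepsilon_t$, $H_s=\operatorname{Im}\varepsilon_s$. A weak Hopf algebra is a weak bialgebra with a $k$-linear antipode $S$ such that $S*\mathrm{id}=\varepsilon_s$, $\mathrm{id}*S=\varepsilon_t$ and $S*\mathrm{id}*S=S$, where $*$ is convolution. Let $H$ be a weak Hopf algebra with bijective antipode, finitely generated and projective as a $k$-module, and $H^*=\operatorname{Hom}_k(H,k)$ with the convolution product $*$, the comultiplication determined by $\langle h^*_{(1)},x\rangle\langle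 h^*_{(2)},y\rangle=\langle h^*,xy\rangle$, and $S^{\pm1}(h^*)=h^*\circ S^{\pm1}$. Write $\langle x\rightharpoonup h^*\leftharpoonup y,\,l\rangle=\langle h^*,ylx\rangle$. *The double $D(H)$.* Let $H\bowtie H^*$ be the module $H\otimes H^*$ with the multiplication $$(h\bowtie h^*)(l\bowtie l^*)=hl_{(2)}\bowtie\bigl(S^{-1}(l_{(1)})\rightharpoonup h^*\leftharpoonup l_{(3)}\bigr)*l^*,$$ let $p(x)=(1\bowtie\varepsilon)x$, and let $D(H)=(H\bowtie H^*)/\operatorname{Ker}p$. *The Nikshych–Turaev–Vainerman double $D'(H)$.* On $H^*\otimes H$ consider the multiplication $$(h^*\otimes h)(l^*\otimes l)=\bigl(h_{(3)}\rightharpoonup l^*\leftharpoonup S(h_{(1)})\bigr)*h^*\otimes h_{(2)}l,$$ let $I$ be the $k$-span of all $h^*\otimes zh-(\varepsilon\leftharpoonup z)*h^*\otimes h$ with $z\in H_t$ and all $h^*\otimes yh-(y\rightharpoonup\varepsilon)*h^*\otimes h$ with $y\in H_s$, and let $D'(H)=(H^*\otimes H)/I$. **Proposition.** (1) The multiplication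 of $H\bowtie H^*$ induces one on $D(H)$, and $D(H)$ is a weak Hopf algebra with unit $[1\bowtie\varepsilon]$, with comultiplication $$\Delta[h\bowtie h^*]=[h_{(2)}\bowtie h^*_{(1)}]\otimes[h_{(1)}\bowtie h^*_{(2)}],$$ with counit $$\varepsilon[h\bowtie h^*]=\langle h^*,\varepsilon_t(S^{-1}(h))\rangle=\langle h^*,1_{(2)}\rangle\,\varepsilon(h1_{(1)}),$$ and with a bijective antipode given, together with its inverse, by $$S[h\bowtie h^*]=\langle h^*_{(1)},S^{-1}(h_{(3)})\rangle\langle h^*_{(3)},h_{(1)}\rangle\,[S^{-1}(h_{(2)})\bowtie S(h^*_{(2)})],$$ $$S^{-1}[h\bowtie h^*]=\langle h^*_{(1)},S^{-1}(h_{(3)})\rangle\langle h^*_{(3)},h_{(1)}\rangle\,[S(h_{(2)})\bowtie S^{-1}(h^*_{(2)})].$$ (2) The multiplication of $H^*\otimes H$ induces one on $D'(H)$, and $D'(H)$ is a weak Hopf algebra with unit $[\varepsilon\otimes1]$, comultiplication $\Delta[h^*\otimes h]=[h^*_{(1)}\otimes h_{(1)}]\otimes[h^*_{(2)}\otimes h_{(2)}]$,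 counit $\varepsilon[h^*\otimes h]=\langle h^*,\varepsilon_t(h)\rangle$, and bijective antipode $$S[h^*\otimes h]=\langle h^*_{(1)},h_{(1)}\rangle\langle h^*_{(3)},S(h_{(3)})\rangle\,[S^{-1}(h^*_{(2)})\otimes S(h_{(2)})].$$ The opposite $D'(H)^{\rm op}$ (opposite multiplication, same coalgebra structure, inverse antipode) is a weak Hopf algebra. (3) The map $[h\bowtie h^*]\mapsto[h^*\otimes S^{-1}(h)]$ is a well-defined isomorphism of weak Hopf algebras $D(H)\to D'(H)^{\rm op}$ (an isomorphism of algebras and of coalgebras that commutes with the antipodes). -/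

import Mathlib

open scoped TensorProduct

noncomputable section

namespace WeakHopf

open Module (Dual)
open TensorProduct (map comm assoc lid rid leftComm)
open Coalgebra (comul counit)

/-! ### Weak bialgebras and weak Hopf algebras over a commutative ring -/

section Axioms

variable (k A : Type*) [CommRing k] [Ring A] [Algebra k A] [Coalgebra k A]

/-- The target map `h ↦ ε(1₍₁₎ h) 1₍₂₎`. -/
def targetMap : A →ₗ[k] A :=
  (lid k A).toLinearMap ∘ₗ (counit : A →ₗ[k] k).rTensor A ∘ₗ
    LinearMap.mulLeft k (comul (R := k) (1 : A)) ∘ₗ (TensorProduct.mk k A A).flip 1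

/-- The source map `h ↦ 1₍₁₎ ε(h 1₍₂₎)`. -/
def sourceMap : A →ₗ[k] A :=
  (rid k A).toLinearMap ∘ₗ (counit : A →ₗ[k] k).lTensor A ∘ₗ
    LinearMap.mulRight k (comul (R := k) (1 : A)) ∘ₗ TensorProduct.mk k A A 1

/-- The target map of the opposite algebra, `h ↦ ε(h 1₍₁₎) 1₍₂₎`. -/
def targetMapOp : A →ₗ[k] A :=
  (lid k A).toLinearMap ∘ₗ (counit : A →ₗ[k] k).rTensor A ∘ₗ
    LinearMap.mulRight k (comul (R := k) (1 : A)) ∘ₗ (TensorProduct.mk k A A).flip 1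

/-- The target space `H_t`. -/
def targetSpace : Submodule k A := LinearMap.range (targetMap k A)

/-- The source space `H_s`. -/
def sourceSpace : Submodule k A := LinearMap.range (sourceMap k A)

variable {k A} in
/-- The convolution product `f * g = (h ↦ f(h₍₁₎) g(h₍₂₎))` of linear endomorphisms. -/
def conv (f g : A →ₗ[k] A) : A →ₗ[k] A :=
  LinearMap.mul' k A ∘ₗ map f g ∘ₗ comul

/-- The functional `ε ⊗ ε` on `A ⊗ A`. -/
def counit₂ : A ⊗[k] A →ₗ[k] k :=
  LinearMap.mul' k k ∘ₗ map counit counit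

/-- The iterated comultiplication `h ↦ h₍₁₎ ⊗ (h₍₂₎ ⊗ h₍₃₎)`. -/
def comul₂ : A →ₗ[k] A ⊗[k] (A ⊗[k] A) :=
  (comul : A →ₗ[k] A ⊗[k] A).lTensor A ∘ₗ comul

/-- The axioms of a weak bialgebra, for a `k`-module which is both an algebra and a coalgebra. -/
structure IsWeakBialgebra : Prop where
  /-- `Δ(hl) = Δ(h) Δ(l)` -/
  comul_mul : ∀ h l : A, comul (R := k) (h * l) = comul h * comul l
  /-- `Δ²(1) = 1₍₁₎ ⊗ 1₍₂₎ 1₍₁'₎ ⊗ 1₍₂'₎` -/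
  comul_one : comul₂ k A 1 =
    assoc k A A A (comul (R := k) (1 : A) ⊗ₜ[k] (1 : A)) * ((1 : A) ⊗ₜ[k] comul (R := k) (1 : A))
  /-- `Δ²(1) = 1₍₁₎ ⊗ 1₍₁'₎ 1₍₂₎ ⊗ 1₍₂'₎` -/
  comul_one' : comul₂ k A 1 =
    ((1 : A) ⊗ₜ[k] comul (R := k) (1 : A)) * assoc k A A A (comul (R := k) (1 : A) ⊗ₜ[k] (1 : A))
  /-- `ε(hxl) = ε(h x₍₁₎) ε(x₍₂₎ l)` -/
  counit_mul : ∀ h x l : A, counit (R := k) (h * x * l) =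
    counit₂ k A ((h ⊗ₜ[k] (1 : A)) * comul (R := k) x * ((1 : A) ⊗ₜ[k] l))
  /-- `ε(hxl) = ε(h x₍₂₎) ε(x₍₁₎ l)` -/
  counit_mul' : ∀ h x l : A, counit (R := k) (h * x * l) =
    counit₂ k A (((1 : A) ⊗ₜ[k] h) * comul (R := k) x * (l ⊗ₜ[k] (1 : A)))

/-- The axioms of a weak Hopf algebra with antipode `S`. -/
structure IsWeakHopfAlgebra (S : A →ₗ[k] A) : Prop extends IsWeakBialgebra k A where
  /-- `S * id = ε_s` -/
  antipode_conv_id : conv S LinearMap.id = sourceMap k A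
  /-- `id * S = ε_t` -/
  id_conv_antipode : conv LinearMap.id S = targetMap k A
  /-- `S * id * S = S` -/
  antipode_conv_id_conv_antipode : conv (conv S LinearMap.id) S = S

variable {k A} in
/-- The inverse of a bijective antipode `S`, regarded as a map on the opposite algebra. This is
the antipode of `Aᵐᵒᵖ` (with the opposite multiplication and the same comultiplication). -/
def opAntipode (S : A ≃ₗ[k] A) : Aᵐᵒᵖ ≃ₗ[k] Aᵐᵒᵖ :=
  (MulOpposite.opLinearEquiv k).symm ≪≫ₗ S.symm ≪≫ₗ MulOpposite.opLinearEquiv k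

end Axioms

/-! ### The dual `H* = Dual k H` of an algebra and coalgebra `H` -/

section DualStructure

variable (k H : Type*) [CommRing k] [Ring H] [Algebra k H]

/-- The multiplication of `H*`: `⟨φ * ψ, h⟩ = ⟨φ, h₍₁₎⟩ ⟨ψ, h₍₂₎⟩`. Its unit is `ε`. -/
def dualMul [Coalgebra k H] : Dual k H ⊗[k] Dual k H →ₗ[k] Dual k H :=
  (comul : H →ₗ[k] H ⊗[k] H).dualMap ∘ₗ TensorProduct.dualDistrib k H H

/-- For `H` finitely generated projective, the comultiplication `φ ↦ φ₍₁₎ ⊗ φ₍₂₎` of `H*`,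
determined by `⟨φ₍₁₎, x⟩ ⟨φ₍₂₎, y⟩ = ⟨φ, xy⟩`. It is the composite of
`φ ↦ (x ↦ (y ↦ φ(xy)))` and the inverse of the isomorphism `H* ⊗ H* ≃ Hom(H, H*)`. -/
def dualComul [Module.Finite k H] [Module.Projective k H] :
    Dual k H →ₗ[k] Dual k H ⊗[k] Dual k H :=
  (LinearEquiv.ofBijective (dualTensorHom k H (Dual k H))
      dualTensorHom_bijective).symm.toLinearMap ∘ₗ
    LinearMap.mk₂ k (fun φ x => φ ∘ₗ LinearMap.mulLeft k x)
      (fun _ _ _ => rfl) (fun _ _ _ => rfl)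
      (fun φ x y => by ext z; simp [add_mul]) (fun c φ x => by ext z; simp)

/-- The defining property of the comultiplication of `H*`. -/
theorem dualDistrib_dualComul [Module.Finite k H] [Module.Projective k H]
    (φ : Dual k H) (x y : H) :
    TensorProduct.dualDistrib k H H (dualComul k H φ) (x ⊗ₜ[k] y) = φ (x * y) := by
  have key : ∀ t : Dual k H ⊗[k] Dual k H,
      TensorProduct.dualDistrib k H H t (x ⊗ₜ[k] y) = dualTensorHom k H (Dual k H) t x y := by
    intro t
    induction t with
    | zero => simp
    | add a b ha hb => simp [ha, hb]
    | tmul a b => simp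
  rw [key]
  have := (LinearEquiv.ofBijective (dualTensorHom k H (Dual k H))
      dualTensorHom_bijective).apply_symm_apply
      (LinearMap.mk₂ k (fun φ x => φ ∘ₗ LinearMap.mulLeft k x)
      (fun _ _ _ => rfl) (fun _ _ _ => rfl)
      (fun φ x y => by ext z; simp [add_mul]) (fun c φ x => by ext z; simp) φ)
  exact congrArg (fun f : H →ₗ[k] Dual k H => f x y) this

/-- The iterated comultiplication `φ ↦ φ₍₁₎ ⊗ (φ₍₂₎ ⊗ φ₍₃₎)` of `H*`. -/
def dualComul₂ [Module.Finite k H] [Module.Projective k H] :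
    Dual k H →ₗ[k] Dual k H ⊗[k] (Dual k H ⊗[k] Dual k H) :=
  (dualComul k H).lTensor (Dual k H) ∘ₗ dualComul k H

/-- The bimodule action of `H` on `H*`: `dualAct k H x y φ` is `x ⇀ φ ↼ y`, the functional
`l ↦ φ(y l x)`. -/
def dualAct : H →ₗ[k] H →ₗ[k] Dual k H →ₗ[k] Dual k H :=
  LinearMap.mk₂ k (fun x y => (LinearMap.mulLeftRight k (y, x)).dualMap)
    (fun x x' y => by ext φ l; simp [mul_add])
    (fun c x y => by ext φ l; simp)
    (fun x y y' => by ext φ l; simp [add_mul])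
    (fun c x y => by ext φ l; simp)

end DualStructure

/-! ### The Drinfeld double `D(H)` -/

section Double

variable {k H : Type*} [CommRing k] [Ring H] [Algebra k H] [Coalgebra k H] (S : H ≃ₗ[k] H)

/-- The map `R : H* ⊗ H → H ⊗ H*`, `R(φ ⊗ h) = h₍₂₎ ⊗ (S⁻¹(h₍₁₎) ⇀ φ ↼ h₍₃₎)`. -/
def smashMap : Dual k H ⊗[k] H →ₗ[k] H ⊗[k] Dual k H :=
  TensorProduct.lift <| LinearMap.mk₂ k
    (fun φ h =>
      (LinearMap.applyₗ φ ∘ₗ TensorProduct.lift (dualAct k H ∘ₗ S.symm.toLinearMap)).lTensor H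
        (leftComm k H H H (comul₂ k H h)))
    (fun φ ψ h => by rw [map_add, LinearMap.add_comp, LinearMap.lTensor_add, LinearMap.add_apply])
    (fun c φ h => by
      rw [map_smul, LinearMap.smul_comp, LinearMap.lTensor_smul, LinearMap.smul_apply])
    (fun φ h l => by simp only [map_add])
    (fun c φ h => by simp only [map_smul])

/-- The multiplication of the weak smash product `H ⋈ H* = H #_R H*`, on the module `H ⊗ H*`:
`(h ⋈ φ)(l ⋈ ψ) = h l_R ⋈ φ_R * ψ`, where `R(φ ⊗ l) = l_R ⊗ φ_R`; that is,
`(h ⋈ φ)(l ⋈ ψ) = h l₍₂₎ ⋈ (S⁻¹(l₍₁₎) ⇀ φ ↼ l₍₃₎) * ψ`. -/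
def bowtieMul : H ⊗[k] Dual k H →ₗ[k] H ⊗[k] Dual k H →ₗ[k] H ⊗[k] Dual k H :=
  TensorProduct.curry <|
    map (LinearMap.mul' k H) (dualMul k H) ∘ₗ
    (TensorProduct.tensorTensorTensorAssoc k H H (Dual k H) (Dual k H)).symm.toLinearMap ∘ₗ
    ((smashMap S).lTensor H).rTensor (Dual k H) ∘ₗ
    (TensorProduct.tensorTensorTensorAssoc k H (Dual k H) H (Dual k H)).toLinearMap

/-- The projection `p(x) = (1 ⋈ ε) x` of `H ⋈ H*`. -/
def bowtieProj : H ⊗[k] Dual k H →ₗ[k] H ⊗[k] Dual k H :=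
  bowtieMul S ((1 : H) ⊗ₜ[k] (counit : H →ₗ[k] k))

/-- The Drinfeld double `D(H) = (H ⋈ H*) / Ker p`, as a bare type. -/
def DrinfeldDouble : Type _ := (H ⊗[k] Dual k H) ⧸ LinearMap.ker (bowtieProj S)

/-- The class in `D(H)` of an element of `H ⋈ H*`. -/
def DrinfeldDouble.mk (x : H ⊗[k] Dual k H) : DrinfeldDouble S :=
  (LinearMap.ker (bowtieProj S)).mkQ x

/-! ### The double `D'(H)` of Nikshych, Turaev and Vainerman -/

/-- The map `H ⊗ H* → H* ⊗ H`, `h ⊗ ψ ↦ (h₍₃₎ ⇀ ψ ↼ S(h₍₁₎)) ⊗ h₍₂₎`. -/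
def ntvSmashMap : H ⊗[k] Dual k H →ₗ[k] Dual k H ⊗[k] H :=
  TensorProduct.lift <| LinearMap.mk₂ k
    (fun h ψ =>
      (LinearMap.applyₗ ψ ∘ₗ TensorProduct.lift ((dualAct k H).flip ∘ₗ S.toLinearMap)).rTensor H
        (comm k H (H ⊗[k] H) (leftComm k H H H (comul₂ k H h))))
    (fun h l ψ => by simp only [map_add])
    (fun c h ψ => by simp only [map_smul])
    (fun h φ ψ => by rw [map_add, LinearMap.add_comp, LinearMap.rTensor_add, LinearMap.add_apply])
    (fun c h ψ => by
      rw [map_smul, LinearMap.smul_comp, LinearMap.rTensor_smul, LinearMap.smul_apply])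

/-- The multiplication `(φ ⊗ h)(ψ ⊗ l) = (h₍₃₎ ⇀ ψ ↼ S(h₍₁₎)) * φ ⊗ h₍₂₎ l` on `H* ⊗ H`. -/
def ntvMul : Dual k H ⊗[k] H →ₗ[k] Dual k H ⊗[k] H →ₗ[k] Dual k H ⊗[k] H :=
  TensorProduct.curry <|
    map (dualMul k H ∘ₗ (comm k (Dual k H) (Dual k H)).toLinearMap) (LinearMap.mul' k H) ∘ₗ
    (TensorProduct.tensorTensorTensorAssoc k (Dual k H) (Dual k H) H H).symm.toLinearMap ∘ₗ
    ((ntvSmashMap S).lTensor (Dual k H)).rTensor H ∘ₗ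
    (TensorProduct.tensorTensorTensorAssoc k (Dual k H) H (Dual k H) H).toLinearMap

/-- A shortcut for the additive group structure of `H* ⊗ H`. -/
instance dualTensorAddCommGroup : AddCommGroup (Dual k H ⊗[k] H) := TensorProduct.addCommGroup

variable (k H) in
/-- The submodule `I` of `H* ⊗ H` spanned by the elements
`φ ⊗ z h - (ε ↼ z) * φ ⊗ h` for `z ∈ H_t`, and `φ ⊗ y h - (y ⇀ ε) * φ ⊗ h` for `y ∈ H_s`. -/
def ntvIdeal : Submodule k (Dual k H ⊗[k] H) :=
  Submodule.span k
    ({t | ∃ z ∈ targetSpace k H, ∃ (φ : Dual k H) (h : H),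
        t = φ ⊗ₜ[k] (z * h) - dualMul k H (dualAct k H 1 z counit ⊗ₜ[k] φ) ⊗ₜ[k] h} ∪
     {t | ∃ y ∈ sourceSpace k H, ∃ (φ : Dual k H) (h : H),
        t = φ ⊗ₜ[k] (y * h) - dualMul k H (dualAct k H y 1 counit ⊗ₜ[k] φ) ⊗ₜ[k] h})

variable (k H) in
/-- The double `D'(H) = (H* ⊗ H) / I`, as a bare type. -/
def NTVDouble : Type _ := (Dual k H ⊗[k] H) ⧸ ntvIdeal k H

variable (k H) in
/-- The class in `D'(H)` of an element of `H* ⊗ H`. -/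
def NTVDouble.mk (x : Dual k H ⊗[k] H) : NTVDouble k H := (ntvIdeal k H).mkQ x

end Double

/-! ### Contractions that occur in the antipode formulas -/

section Contractions

variable (k H : Type*) [CommRing k] [Ring H] [Algebra k H]

/-- The flip `a ⊗ (b ⊗ c) ↦ c ⊗ (b ⊗ a)`. -/
def rev₃ : H ⊗[k] (H ⊗[k] H) →ₗ[k] H ⊗[k] (H ⊗[k] H) :=
  (comm k (H ⊗[k] H) H).toLinearMap ∘ₗ (comm k H H).toLinearMap.rTensor H ∘ₗ
    (assoc k H H H).symm.toLinearMap

/-- `(a ⊗ (b ⊗ c)) ⊗ (α ⊗ (β ⊗ γ)) ↦ ⟨α, a⟩ ⟨γ, c⟩ (b ⊗ β)`. -/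
def pairOuter : (H ⊗[k] (H ⊗[k] H)) ⊗[k] (Dual k H ⊗[k] (Dual k H ⊗[k] Dual k H)) →ₗ[k]
    H ⊗[k] Dual k H :=
  (lid k (H ⊗[k] Dual k H)).toLinearMap ∘ₗ
  map (contractRight k H)
    ((rid k (H ⊗[k] Dual k H)).toLinearMap ∘ₗ (contractRight k H).lTensor (H ⊗[k] Dual k H) ∘ₗ
      (TensorProduct.tensorTensorTensorComm k H H (Dual k H) (Dual k H)).toLinearMap) ∘ₗ
  (TensorProduct.tensorTensorTensorComm k H (H ⊗[k] H) (Dual k H)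
    (Dual k H ⊗[k] Dual k H)).toLinearMap

end Contractions

/-! ### The explicit coalgebra structures and antipodes -/

section Formulas

variable {k H : Type*} [CommRing k] [Ring H] [Algebra k H] [Coalgebra k H]
  [Module.Finite k H] [Module.Projective k H] (S : H ≃ₗ[k] H)

variable (k H) in
/-- `h ⋈ φ ↦ (h₍₂₎ ⋈ φ₍₁₎) ⊗ (h₍₁₎ ⋈ φ₍₂₎)` -/
def doubleComul : H ⊗[k] Dual k H →ₗ[k] (H ⊗[k] Dual k H) ⊗[k] (H ⊗[k] Dual k H) :=
  (TensorProduct.tensorTensorTensorComm k H H (Dual k H) (Dual k H)).toLinearMap ∘ₗ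
    map ((comm k H H).toLinearMap ∘ₗ comul) (dualComul k H)

/-- `h ⋈ φ ↦ ⟨φ₍₁₎, S⁻¹(h₍₃₎)⟩ ⟨φ₍₃₎, h₍₁₎⟩ (S⁻¹(h₍₂₎) ⋈ S(φ₍₂₎))`, where `S(φ) = φ ∘ S`. -/
def doubleAntipode : H ⊗[k] Dual k H →ₗ[k] H ⊗[k] Dual k H :=
  map S.symm.toLinearMap S.toLinearMap.dualMap ∘ₗ pairOuter k H ∘ₗ
    map (S.symm.toLinearMap.rTensor (H ⊗[k] H) ∘ₗ rev₃ k H ∘ₗ comul₂ k H) (dualComul₂ k H)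

/-- `h ⋈ φ ↦ ⟨φ₍₁₎, S⁻¹(h₍₃₎)⟩ ⟨φ₍₃₎, h₍₁₎⟩ (S(h₍₂₎) ⋈ S⁻¹(φ₍₂₎))`, where `S⁻¹(φ) = φ ∘ S⁻¹`. -/
def doubleAntipodeInv : H ⊗[k] Dual k H →ₗ[k] H ⊗[k] Dual k H :=
  map S.toLinearMap S.symm.toLinearMap.dualMap ∘ₗ pairOuter k H ∘ₗ
    map (S.symm.toLinearMap.rTensor (H ⊗[k] H) ∘ₗ rev₃ k H ∘ₗ comul₂ k H) (dualComul₂ k H)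

variable (k H) in
/-- `φ ⊗ h ↦ (φ₍₁₎ ⊗ h₍₁₎) ⊗ (φ₍₂₎ ⊗ h₍₂₎)` -/
def ntvComul : Dual k H ⊗[k] H →ₗ[k] (Dual k H ⊗[k] H) ⊗[k] (Dual k H ⊗[k] H) :=
  (TensorProduct.tensorTensorTensorComm k (Dual k H) (Dual k H) H H).toLinearMap ∘ₗ
    map (dualComul k H) comul

/-- `φ ⊗ h ↦ ⟨φ₍₁₎, h₍₁₎⟩ ⟨φ₍₃₎, S(h₍₃₎)⟩ (S⁻¹(φ₍₂₎) ⊗ S(h₍₂₎))` -/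
def ntvAntipode : Dual k H ⊗[k] H →ₗ[k] Dual k H ⊗[k] H :=
  (comm k H (Dual k H)).toLinearMap ∘ₗ
  map S.toLinearMap S.symm.toLinearMap.dualMap ∘ₗ pairOuter k H ∘ₗ
    map ((S.toLinearMap.lTensor H).lTensor H ∘ₗ comul₂ k H) (dualComul₂ k H) ∘ₗ
  (comm k (Dual k H) H).toLinearMap

end Formulas

end WeakHopf

end

open scoped TensorProduct

set_option linter.unusedSectionVars false

noncomputable section

namespace WeakHopf

open Module (Dual)
open TensorProduct (map comm assoc lid rid leftComm)
open Coalgebra (comul counit)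

/-! ### Linearity of unbundled functions and Sweedler sums -/

section Sweedler

variable {k : Type*} [CommRing k]
variable {M N P Q : Type*} [AddCommMonoid M] [Module k M] [AddCommMonoid N] [Module k N]
  [AddCommMonoid P] [Module k P] [AddCommMonoid Q] [Module k Q]

/-! The product of `H ⋈ H*` is associative, and `1 ⋈ ε` is a central preunit: left and right
multiplication by it coincide, and the resulting map `p` is idempotent (`bowtieProj_tmul`,
`bowtieProj_bowtieProj`). Hence `Ker p` is a two-sided ideal, and the class of `1 ⋈ ε` is a unit of
the quotient.

The same quotient is a balanced tensor product. A linear map `f` factors through `D(H)` as soon as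
`f(hy ⋈ φ) = f(h ⋈ (φ ↼ S⁻¹(y)))` for `y ∈ H_s` and `f(hz ⋈ φ) = f(h ⋈ (z ⇀ φ))` for `z ∈ H_t`
(`balanced_bowtieProj`). The comultiplication, the counit, the antipode, its inverse and the
comparison with `D'(H)` are all obtained from this universal property.

The weak Hopf axioms are checked in any algebra and coalgebra `D` spanned by products `i(h)j(φ)`
that satisfy the relations of the double (`IsDouble`). Multiplicativity of `Δ` reduces to its
compatibility with the exchange of `j(φ)` and `i(l)` (`deltaInr_mul_deltaInl`). For the counit,
`ε(i(h)j(ψ)i(g))` depends on `g` only through `1₍₁₎ε(1₍₂₎g)`, so that under `ε` every right factor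
can be replaced by the image of an element of `H_s` or of `H_t`, and such a factor slides into one
leg of a coproduct (`isWeakBialgebra`). The antipode is `i(h)j(φ) ↦ j(φ ∘ S)i(S⁻¹(h))`, and its
axioms reduce to antipode identities in `H`.

For `D'(H)`, the relations spanning `I` are the balancing relations again, and `h ⊗ φ ↦ φ ⊗ S⁻¹(h)`
reverses products and preserves coproducts. So `D'(H)` is `D(H)` with the opposite product and the
inverse antipode, and it is a weak Hopf algebra because opposites are.

Underneath lies the general theory of weak Hopf algebras: `H_s` and `H_t` commute, `S` reverses
products and coproducts (`map_mul`, `comul_antipode`), and `S` exchanges `H_s` and `H_t`. -/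

variable (k) in
/-- `IsLinearMap`, as a predicate for `fun_prop`. -/
@[fun_prop]
def Lin (f : M → N) : Prop := IsLinearMap k f

@[fun_prop]
theorem lin_id : Lin k (fun x : M => x) := ⟨fun _ _ => rfl, fun _ _ => rfl⟩

@[fun_prop]
theorem lin_comp {f : N → P} {g : M → N} (hf : Lin k f) (hg : Lin k g) :
    Lin k (fun x => f (g x)) :=
  ⟨fun x y => by rw [hg.map_add, hf.map_add], fun c x => by rw [hg.map_smul, hf.map_smul]⟩

@[fun_prop]
theorem lin_linearMap (f : M →ₗ[k] N) : Lin k f := ⟨f.map_add, f.map_smul⟩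

@[fun_prop]
theorem lin_linearEquiv (f : M ≃ₗ[k] N) : Lin k f := ⟨f.map_add, f.map_smul⟩

@[fun_prop]
theorem lin_algEquiv {A B : Type*} [Ring A] [Algebra k A] [Ring B] [Algebra k B] (f : A ≃ₐ[k] B) :
    Lin k f := ⟨map_add f, map_smul f⟩

@[fun_prop]
theorem lin_apply {f : M → N →ₗ[k] P} (hf : Lin k f) (y : N) : Lin k (fun x => f x y) :=
  ⟨fun x z => by rw [hf.map_add]; rfl, fun c x => by rw [hf.map_smul]; rfl⟩

@[fun_prop]
theorem lin_tmul_left {f : M → N} (hf : Lin k f) (y : P) : Lin k (fun x => f x ⊗ₜ[k] y) :=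
  ⟨fun x z => by rw [hf.map_add, TensorProduct.add_tmul],
    fun c x => by rw [hf.map_smul, TensorProduct.smul_tmul']⟩

@[fun_prop]
theorem lin_tmul_right {f : M → N} (hf : Lin k f) (y : P) : Lin k (fun x => y ⊗ₜ[k] f x) :=
  ⟨fun x z => by rw [hf.map_add, TensorProduct.tmul_add],
    fun c x => by rw [hf.map_smul, TensorProduct.tmul_smul]⟩

@[fun_prop]
theorem lin_mul_left {A : Type*} [Ring A] [Algebra k A] {f : M → A} (hf : Lin k f) (y : A) :
    Lin k (fun x => f x * y) :=
  ⟨fun x z => by rw [hf.map_add, add_mul], fun c x => by rw [hf.map_smul, smul_mul_assoc]⟩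

@[fun_prop]
theorem lin_mul_right {A : Type*} [Ring A] [Algebra k A] {f : M → A} (hf : Lin k f) (y : A) :
    Lin k (fun x => y * f x) :=
  ⟨fun x z => by rw [hf.map_add, mul_add], fun c x => by rw [hf.map_smul, mul_smul_comm]⟩

@[fun_prop]
theorem lin_smul_left {f : M → k} (hf : Lin k f) (y : P) : Lin k (fun x => f x • y) :=
  ⟨fun x z => by rw [hf.map_add, add_smul], fun c x => by rw [hf.map_smul, smul_assoc]⟩

@[fun_prop]
theorem lin_smul_right {f : M → N} (hf : Lin k f) (c : k) : Lin k (fun x => c • f x) :=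
  ⟨fun x z => by rw [hf.map_add, smul_add], fun d x => by rw [hf.map_smul, smul_comm]⟩

/-- The sum `∑ F a b` over a chosen representation `t = ∑ a ⊗ b`. -/
def tsw (t : M ⊗[k] N) (F : M → N → P) : P :=
  ∑ i ∈ (TensorProduct.exists_finset t).choose, F i.1 i.2

/-- For bilinear `F` the sum is the value at `t` of the induced linear map, hence independent of the
chosen representation. Bilinearity is a default argument left to `fun_prop`, so `F` can be a bare
lambda. -/
theorem tsw_eq_lift (t : M ⊗[k] N) (F : M → N → P)
    (h₁ : ∀ b, Lin k fun a => F a b := by intros; fun_prop)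
    (h₂ : ∀ a, Lin k fun b => F a b := by intros; fun_prop) :
    tsw t F = TensorProduct.lift (LinearMap.mk₂ k F (fun a a' b => (h₁ b).map_add a a')
      (fun c a b => (h₁ b).map_smul c a) (fun a b b' => (h₂ a).map_add b b')
      (fun c a b => (h₂ a).map_smul c b)) t := by
  conv_rhs => rw [(TensorProduct.exists_finset t).choose_spec]
  simp [tsw]

theorem tsw_tmul (a : M) (b : N) (F : M → N → P)
    (h₁ : ∀ b, Lin k fun a => F a b := by intros; fun_prop)
    (h₂ : ∀ a, Lin k fun b => F a b := by intros; fun_prop) : tsw (a ⊗ₜ[k] b) F = F a b := by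
  simp [tsw_eq_lift _ F h₁ h₂]

@[fun_prop]
theorem lin_tsw {f : Q → M ⊗[k] N} (hf : Lin k f) {F : M → N → P}
    (h₁ : ∀ b, Lin k fun a => F a b) (h₂ : ∀ a, Lin k fun b => F a b) :
    Lin k (fun x => tsw (f x) F) :=
  ⟨fun x y => by simp [tsw_eq_lift _ F h₁ h₂, hf.map_add],
    fun c x => by simp [tsw_eq_lift _ F h₁ h₂, hf.map_smul]⟩

@[fun_prop]
theorem lin_tsw_fun (t : M ⊗[k] N) {F : Q → M → N → P} (hF : ∀ a b, Lin k fun x => F x a b) :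
    Lin k (fun x => tsw t (F x)) :=
  ⟨fun x y => by simp only [tsw, (hF _ _).map_add, Finset.sum_add_distrib],
    fun c x => by simp only [tsw, (hF _ _).map_smul, Finset.smul_sum]⟩

theorem lin_map_tsw {g : P → Q} (hg : Lin k g) (t : M ⊗[k] N) (F : M → N → P) :
    g (tsw t F) = tsw t fun a b => g (F a b) := by
  exact map_sum (IsLinearMap.mk' g hg) (fun i : M × N => F i.1 i.2)
    (TensorProduct.exists_finset t).choose

theorem tsw_congr (t : M ⊗[k] N) {F G : M → N → P} (h : ∀ a b, F a b = G a b) :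
    tsw t F = tsw t G := by
  congr 1; ext a b; exact h a b

/-- No linearity is needed, since both sides are finite sums over fixed representations. -/
theorem tsw_comm {M' N' : Type*} [AddCommMonoid M'] [Module k M'] [AddCommMonoid N'] [Module k N']
    (t : M ⊗[k] N) (t' : M' ⊗[k] N') (F : M → N → M' → N' → P) :
    (tsw t fun a b => tsw t' fun c d => F a b c d) =
      tsw t' fun c d => tsw t fun a b => F a b c d :=
  Finset.sum_comm

theorem tsw_mk (t : M ⊗[k] N) : (tsw t fun a b => a ⊗ₜ[k] b) = t :=
  (TensorProduct.exists_finset t).choose_spec.symm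

theorem tsw_tsw {M' N' : Type*} [AddCommMonoid M'] [Module k M'] [AddCommMonoid N'] [Module k N']
    (t : M ⊗[k] N) (G : M → N → M' ⊗[k] N') (F : M' → N' → P)
    (h₁ : ∀ b, Lin k fun a => F a b := by intros; fun_prop)
    (h₂ : ∀ a, Lin k fun b => F a b := by intros; fun_prop) :
    tsw (tsw t G) F = tsw t fun a b => tsw (G a b) F :=
  lin_map_tsw (g := fun x => tsw x F) (by fun_prop) t G

end Sweedler

/-! ### Sweedler sums in a coalgebra -/

section Coalgebra

variable (k : Type*) [CommRing k]
variable {C M N : Type*} [AddCommMonoid C] [Module k C] [Coalgebra k C]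
  [AddCommMonoid M] [Module k M] [AddCommMonoid N] [Module k N]

/-- The Sweedler sum `∑ F h₍₁₎ h₍₂₎`. -/
def sw (h : C) (F : C → C → M) : M := tsw (comul (R := k) h) F

variable {k}

theorem sw_congr (h : C) {F G : C → C → M} (H : ∀ a b, F a b = G a b) : sw k h F = sw k h G :=
  tsw_congr _ H

@[fun_prop]
theorem lin_sw {f : N → C} (hf : Lin k f) {F : C → C → M}
    (h₁ : ∀ b, Lin k fun a => F a b) (h₂ : ∀ a, Lin k fun b => F a b) :
    Lin k (fun x => sw k (f x) F) := by unfold sw; fun_prop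

@[fun_prop]
theorem lin_sw_fun (h : C) {F : N → C → C → M} (hF : ∀ a b, Lin k fun x => F x a b) :
    Lin k (fun x => sw k h (F x)) := by unfold sw; fun_prop

theorem lin_map_sw {g : M → N} (hg : Lin k g) (h : C) (F : C → C → M) :
    g (sw k h F) = sw k h fun a b => g (F a b) := lin_map_tsw hg _ _

theorem comul_eq_sw (h : C) : comul (R := k) h = sw k h fun a b => a ⊗ₜ[k] b := (tsw_mk _).symm

theorem sw_comm {C' : Type*} [AddCommMonoid C'] [Module k C'] [Coalgebra k C']
    (h : C) (h' : C') (F : C → C → C' → C' → M) :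
    (sw k h fun a b => sw k h' fun c d => F a b c d) =
      sw k h' fun c d => sw k h fun a b => F a b c d :=
  tsw_comm _ _ _

theorem map_sw (g : M →ₗ[k] N) (h : C) (F : C → C → M) :
    g (sw k h F) = sw k h fun a b => g (F a b) := lin_map_sw (lin_linearMap g) _ _

theorem equiv_map_sw (g : M ≃ₗ[k] N) (h : C) (F : C → C → M) :
    g (sw k h F) = sw k h fun a b => g (F a b) := lin_map_sw (lin_linearEquiv g) _ _

theorem sw_apply (h : C) (F : C → C → M →ₗ[k] N) (x : M) :
    (sw k h F) x = sw k h fun a b => F a b x := lin_map_sw (g := fun f : M →ₗ[k] N => f x)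
      (by fun_prop) _ _

theorem sw_mul {A : Type*} [Ring A] [Algebra k A] (h : C) (F : C → C → A) (x : A) :
    sw k h F * x = sw k h fun a b => F a b * x := lin_map_sw (g := fun y => y * x) (by fun_prop) _ _

theorem mul_sw {A : Type*} [Ring A] [Algebra k A] (h : C) (F : C → C → A) (x : A) :
    x * sw k h F = sw k h fun a b => x * F a b := lin_map_sw (g := fun y => x * y) (by fun_prop) _ _

theorem sw_tmul (h : C) (F : C → C → M) (x : N) :
    sw k h F ⊗ₜ[k] x = sw k h fun a b => F a b ⊗ₜ[k] x :=
  lin_map_sw (g := fun y => y ⊗ₜ[k] x) (by fun_prop) _ _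

theorem tmul_sw (h : C) (F : C → C → M) (x : N) :
    x ⊗ₜ[k] sw k h F = sw k h fun a b => x ⊗ₜ[k] F a b :=
  lin_map_sw (g := fun y => x ⊗ₜ[k] y) (by fun_prop) _ _

theorem sw_smul (h : C) (F : C → C → k) (x : M) :
    sw k h F • x = sw k h fun a b => F a b • x :=
  lin_map_sw (g := fun y => y • x) (by fun_prop) _ _

theorem smul_sw (h : C) (F : C → C → M) (x : k) :
    x • sw k h F = sw k h fun a b => x • F a b :=
  lin_map_sw (g := fun y => x • y) (by fun_prop) _ _

theorem sw_tsw {M' : Type*} [AddCommMonoid M'] [Module k M'] (h : C) (G : C → C → M ⊗[k] M')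
    (F : M → M' → N)
    (h₁ : ∀ b, Lin k fun a => F a b := by intros; fun_prop)
    (h₂ : ∀ a, Lin k fun b => F a b := by intros; fun_prop) :
    tsw (sw k h G) F = sw k h fun a b => tsw (G a b) F :=
  tsw_tsw _ _ _ h₁ h₂

/-- Coassociativity. -/
theorem sw_assoc (h : C) (F : C → C → C → M)
    (h₁ : ∀ b c, Lin k fun a => F a b c := by intros; fun_prop)
    (h₂ : ∀ a c, Lin k fun b => F a b c := by intros; fun_prop)
    (h₃ : ∀ a b, Lin k fun c => F a b c := by intros; fun_prop) :
    (sw k h fun a b => sw k a fun c d => F c d b) =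
      sw k h fun a b => sw k b fun c d => F a c d := by
  -- The trilinear map induced by `F` is applied to the coassociativity identity in the triple
  -- tensor product.
  have key := congrArg (fun t => tsw t fun a s => tsw s fun b c => F a b c)
    (Coalgebra.coassoc_apply (R := k) h)
  rw [comul_eq_sw h] at key
  simp only [map_sw, LinearMap.rTensor_tmul, LinearMap.lTensor_tmul] at key
  simp only [comul_eq_sw (k := k) (_ : C), sw_tmul, tmul_sw, equiv_map_sw,
    TensorProduct.assoc_tmul] at key
  simp (disch := first | (intro; fun_prop) | fun_prop) only [sw_tsw, tsw_tmul] at key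
  exact key

theorem sw_counit_left (h : C) (F : C → M) (hF : Lin k F := by intros; fun_prop) :
    (sw k h fun a b => counit (R := k) a • F b) = F h := by
  have key := congrArg (fun t => tsw t fun a b => a • F b)
    (Coalgebra.rTensor_counit_comul (R := k) h)
  rw [comul_eq_sw h] at key
  simp only [map_sw, LinearMap.rTensor_tmul] at key
  simp (disch := first | (intro; fun_prop) | fun_prop) only [sw_tsw, tsw_tmul, one_smul] at key
  exact key

theorem sw_counit_right (h : C) (F : C → M) (hF : Lin k F := by intros; fun_prop) :
    (sw k h fun a b => counit (R := k) b • F a) = F h := by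
  have key := congrArg (fun t => tsw t fun a b => b • F a)
    (Coalgebra.lTensor_counit_comul (R := k) h)
  rw [comul_eq_sw h] at key
  simp only [map_sw, LinearMap.lTensor_tmul] at key
  simp (disch := first | (intro; fun_prop) | fun_prop) only [sw_tsw, tsw_tmul, one_smul] at key
  exact key

end Coalgebra

/-! ### Weak bialgebras -/

section WeakBialgebra

variable {k A M : Type*} [CommRing k] [Ring A] [Algebra k A] [Coalgebra k A]
  [AddCommMonoid M] [Module k M]

local notation "ε" => counit (R := k)

variable (k A) in
/-- The source map of the opposite algebra, `h ↦ 1₍₁₎ ε(1₍₂₎ h)`. -/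
def sourceMapOp : A →ₗ[k] A :=
  (rid k A).toLinearMap ∘ₗ (counit : A →ₗ[k] k).lTensor A ∘ₗ
    LinearMap.mulLeft k (comul (R := k) (1 : A)) ∘ₗ TensorProduct.mk k A A 1

theorem targetMap_apply (h : A) :
    targetMap k A h = sw k 1 fun a b => ε (a * h) • b := by
  simp [targetMap, comul_eq_sw, map_sw, equiv_map_sw, sw_mul]

theorem sourceMap_apply (h : A) :
    sourceMap k A h = sw k 1 fun a b => ε (h * b) • a := by
  simp [sourceMap, comul_eq_sw, map_sw, equiv_map_sw, mul_sw]

theorem targetMapOp_apply (h : A) :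
    targetMapOp k A h = sw k 1 fun a b => ε (h * a) • b := by
  simp [targetMapOp, comul_eq_sw, map_sw, equiv_map_sw, mul_sw]

theorem sourceMapOp_apply (h : A) :
    sourceMapOp k A h = sw k 1 fun a b => ε (b * h) • a := by
  simp [sourceMapOp, comul_eq_sw, map_sw, equiv_map_sw, sw_mul]

theorem conv_apply (f g : A →ₗ[k] A) (h : A) : conv f g h = sw k h fun a b => f a * g b := by
  simp [conv, comul_eq_sw, map_sw]

variable (k) in
/-- `Δ(z) = z 1₍₁₎ ⊗ 1₍₂₎ = 1₍₁₎ z ⊗ 1₍₂₎`, which characterizes the elements of `H_t`. -/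
def IsTarget (z : A) : Prop :=
  comul (R := k) z = (z ⊗ₜ[k] 1) * comul (R := k) 1 ∧
    comul (R := k) z = comul (R := k) 1 * (z ⊗ₜ[k] 1)

variable (k) in
/-- `Δ(y) = 1₍₁₎ ⊗ y 1₍₂₎ = 1₍₁₎ ⊗ 1₍₂₎ y`, which characterizes the elements of `H_s`. -/
def IsSource (y : A) : Prop :=
  comul (R := k) y = (1 ⊗ₜ[k] y) * comul (R := k) 1 ∧
    comul (R := k) y = comul (R := k) 1 * (1 ⊗ₜ[k] y)

namespace IsWeakBialgebra

variable (hA : IsWeakBialgebra k A)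
include hA

theorem sw_mul_arg (h l : A) (F : A → A → M)
    (h₁ : ∀ b, Lin k fun a => F a b := by intros; fun_prop)
    (h₂ : ∀ a, Lin k fun b => F a b := by intros; fun_prop) :
    sw k (h * l) F = sw k h fun a b => sw k l fun c d => F (a * c) (b * d) := by
  rw [sw, hA.comul_mul, comul_eq_sw h, comul_eq_sw l]
  simp only [sw_mul, mul_sw, Algebra.TensorProduct.tmul_mul_tmul]
  simp (disch := first | (intro; fun_prop) | fun_prop) only [sw_tsw, tsw_tmul]
  rw [sw_comm]

theorem sw_one (F : A → A → A → M)
    (h₁ : ∀ b c, Lin k fun a => F a b c := by intros; fun_prop)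
    (h₂ : ∀ a c, Lin k fun b => F a b c := by intros; fun_prop)
    (h₃ : ∀ a b, Lin k fun c => F a b c := by intros; fun_prop) :
    (sw k (1 : A) fun a b => sw k b fun c d => F a c d) =
      sw k (1 : A) fun a b => sw k (1 : A) fun c d => F a (b * c) d := by
  have key := congrArg (fun t => tsw t fun a s => tsw s fun b c => F a b c) hA.comul_one
  rw [comul₂] at key
  simp only [LinearMap.comp_apply, comul_eq_sw (k := k) (_ : A), map_sw, LinearMap.lTensor_tmul,
    tmul_sw, sw_tmul, equiv_map_sw, mul_sw, sw_mul, TensorProduct.assoc_tmul,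
    Algebra.TensorProduct.tmul_mul_tmul, one_mul, mul_one] at key
  simp (disch := first | (intro; fun_prop) | fun_prop) only [sw_tsw, tsw_tmul] at key
  rw [key, sw_comm]

theorem sw_one' (F : A → A → A → M)
    (h₁ : ∀ b c, Lin k fun a => F a b c := by intros; fun_prop)
    (h₂ : ∀ a c, Lin k fun b => F a b c := by intros; fun_prop)
    (h₃ : ∀ a b, Lin k fun c => F a b c := by intros; fun_prop) :
    (sw k (1 : A) fun a b => sw k b fun c d => F a c d) =
      sw k (1 : A) fun a b => sw k (1 : A) fun c d => F a (c * b) d := by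
  have key := congrArg (fun t => tsw t fun a s => tsw s fun b c => F a b c) hA.comul_one'
  rw [comul₂] at key
  simp only [LinearMap.comp_apply, comul_eq_sw (k := k) (_ : A), map_sw, LinearMap.lTensor_tmul,
    tmul_sw, sw_tmul, equiv_map_sw, mul_sw, sw_mul, TensorProduct.assoc_tmul,
    Algebra.TensorProduct.tmul_mul_tmul, one_mul, mul_one] at key
  simp (disch := first | (intro; fun_prop) | fun_prop) only [sw_tsw, tsw_tmul] at key
  rw [key]

theorem counit_sw (h x l : A) :
    ε (h * x * l) = sw k x fun a b => ε (h * a) * ε (b * l) := by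
  rw [hA.counit_mul, comul_eq_sw x]
  simp [counit₂, mul_sw, sw_mul, map_sw]

theorem counit_sw' (h x l : A) :
    ε (h * x * l) = sw k x fun a b => ε (h * b) * ε (a * l) := by
  rw [hA.counit_mul', comul_eq_sw x]
  simp [counit₂, mul_sw, sw_mul, map_sw, mul_comm]

/-- Weak multiplicativity of `ε` with middle factor `1`, here `ε(hl) = ε(h1₍₁₎)ε(1₍₂₎l)`. The next
three lemmas are the variants for the other one-sided maps. -/
theorem counit_mul_sourceMapOp (h l : A) : ε (h * sourceMapOp k A l) = ε (h * l) := by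
  rw [← mul_one h, hA.counit_sw h 1 l]
  simp [sourceMapOp_apply, mul_sw, map_sw, mul_comm]

theorem counit_targetMapOp_mul (h l : A) : ε (targetMapOp k A h * l) = ε (h * l) := by
  rw [← mul_one h, hA.counit_sw h 1 l]
  simp [targetMapOp_apply, sw_mul, map_sw]

theorem counit_mul_targetMap (h l : A) : ε (h * targetMap k A l) = ε (h * l) := by
  rw [← mul_one h, hA.counit_sw' h 1 l]
  simp [targetMap_apply, mul_sw, map_sw, mul_comm]

theorem counit_sourceMap_mul (h l : A) : ε (sourceMap k A h * l) = ε (h * l) := by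
  rw [← mul_one h, hA.counit_sw' h 1 l]
  simp [sourceMap_apply, sw_mul, map_sw]

/-- The coproduct is `f(1₍₁₎)1₍₂₎ ⊗ 1₍₃₎`, and the two expansions of `Δ²(1)` put the element on the
left or on the right of `1₍₁'₎`. An arbitrary functional covers `targetMap` and `targetMapOp` at
once. -/
theorem isTarget_sw (f : A →ₗ[k] k) : IsTarget k (sw k (1 : A) fun a b => f a • b) := by
  constructor
  · simp only [map_sw, map_smul]
    simp only [comul_eq_sw (k := k) (_ : A), smul_sw, sw_tmul, sw_mul, mul_sw]
    rw [hA.sw_one (fun a b c => f a • b ⊗ₜ[k] c), sw_comm]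
    simp [TensorProduct.smul_tmul']
  · simp only [map_sw, map_smul]
    simp only [comul_eq_sw (k := k) (_ : A), smul_sw, sw_tmul, sw_mul, mul_sw]
    rw [hA.sw_one' (fun a b c => f a • b ⊗ₜ[k] c)]
    simp [TensorProduct.smul_tmul']

theorem isSource_sw (f : A →ₗ[k] k) : IsSource k (sw k (1 : A) fun a b => f b • a) := by
  constructor
  · simp only [map_sw, map_smul]
    simp only [comul_eq_sw (k := k) (_ : A), smul_sw, tmul_sw, sw_mul, mul_sw]
    rw [sw_assoc _ (fun a b c => f c • a ⊗ₜ[k] b), hA.sw_one' (fun a b c => f c • a ⊗ₜ[k] b)]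
    simp [TensorProduct.smul_tmul']
  · simp only [map_sw, map_smul]
    simp only [comul_eq_sw (k := k) (_ : A), smul_sw, tmul_sw, sw_mul, mul_sw]
    rw [sw_assoc _ (fun a b c => f c • a ⊗ₜ[k] b), hA.sw_one (fun a b c => f c • a ⊗ₜ[k] b),
      sw_comm]
    simp [TensorProduct.smul_tmul']

theorem isTarget_targetMap (h : A) : IsTarget k (targetMap k A h) := by
  rw [targetMap_apply]
  exact hA.isTarget_sw (counit ∘ₗ LinearMap.mulRight k h)

theorem isTarget_targetMapOp (h : A) : IsTarget k (targetMapOp k A h) := by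
  rw [targetMapOp_apply]
  exact hA.isTarget_sw (counit ∘ₗ LinearMap.mulLeft k h)

theorem isSource_sourceMap (h : A) : IsSource k (sourceMap k A h) := by
  rw [sourceMap_apply]
  exact hA.isSource_sw (counit ∘ₗ LinearMap.mulLeft k h)

theorem isSource_sourceMapOp (h : A) : IsSource k (sourceMapOp k A h) := by
  rw [sourceMapOp_apply]
  exact hA.isSource_sw (counit ∘ₗ LinearMap.mulRight k h)

omit hA in
theorem _root_.WeakHopf.IsTarget.sw_left {z : A} (hz : IsTarget k z) (F : A → A → M)
    (h₁ : ∀ b, Lin k fun a => F a b := by intros; fun_prop)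
    (h₂ : ∀ a, Lin k fun b => F a b := by intros; fun_prop) :
    sw k z F = sw k (1 : A) fun a b => F (z * a) b := by
  rw [sw, hz.1, comul_eq_sw]
  simp only [mul_sw, Algebra.TensorProduct.tmul_mul_tmul, one_mul]
  simp (disch := first | (intro; fun_prop) | fun_prop) only [sw_tsw, tsw_tmul]

omit hA in
theorem _root_.WeakHopf.IsTarget.sw_right {z : A} (hz : IsTarget k z) (F : A → A → M)
    (h₁ : ∀ b, Lin k fun a => F a b := by intros; fun_prop)
    (h₂ : ∀ a, Lin k fun b => F a b := by intros; fun_prop) :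
    sw k z F = sw k (1 : A) fun a b => F (a * z) b := by
  rw [sw, hz.2, comul_eq_sw]
  simp only [sw_mul, Algebra.TensorProduct.tmul_mul_tmul, mul_one]
  simp (disch := first | (intro; fun_prop) | fun_prop) only [sw_tsw, tsw_tmul]

omit hA in
theorem _root_.WeakHopf.IsSource.sw_left {y : A} (hy : IsSource k y) (F : A → A → M)
    (h₁ : ∀ b, Lin k fun a => F a b := by intros; fun_prop)
    (h₂ : ∀ a, Lin k fun b => F a b := by intros; fun_prop) :
    sw k y F = sw k (1 : A) fun a b => F a (y * b) := by
  rw [sw, hy.1, comul_eq_sw]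
  simp only [mul_sw, Algebra.TensorProduct.tmul_mul_tmul, one_mul]
  simp (disch := first | (intro; fun_prop) | fun_prop) only [sw_tsw, tsw_tmul]

omit hA in
theorem _root_.WeakHopf.IsSource.sw_right {y : A} (hy : IsSource k y) (F : A → A → M)
    (h₁ : ∀ b, Lin k fun a => F a b := by intros; fun_prop)
    (h₂ : ∀ a, Lin k fun b => F a b := by intros; fun_prop) :
    sw k y F = sw k (1 : A) fun a b => F a (b * y) := by
  rw [sw, hy.2, comul_eq_sw]
  simp only [sw_mul, Algebra.TensorProduct.tmul_mul_tmul, mul_one]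
  simp (disch := first | (intro; fun_prop) | fun_prop) only [sw_tsw, tsw_tmul]

omit hA in
theorem _root_.WeakHopf.IsTarget.targetMap_eq {z : A} (hz : IsTarget k z) :
    targetMap k A z = z := by
  rw [targetMap_apply, ← hz.sw_right (fun a b => ε a • b), sw_counit_left z (fun x => x)]

omit hA in
theorem _root_.WeakHopf.IsTarget.targetMapOp_eq {z : A} (hz : IsTarget k z) :
    targetMapOp k A z = z := by
  rw [targetMapOp_apply, ← hz.sw_left (fun a b => ε a • b), sw_counit_left z (fun x => x)]

omit hA in
theorem _root_.WeakHopf.IsSource.sourceMap_eq {y : A} (hy : IsSource k y) :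
    sourceMap k A y = y := by
  rw [sourceMap_apply, ← hy.sw_left (fun a b => ε b • a), sw_counit_right y (fun x => x)]

omit hA in
theorem _root_.WeakHopf.IsSource.sourceMapOp_eq {y : A} (hy : IsSource k y) :
    sourceMapOp k A y = y := by
  rw [sourceMapOp_apply, ← hy.sw_right (fun a b => ε b • a), sw_counit_right y (fun x => x)]

/-- Elements of `H_s` and `H_t` commute. -/
theorem commute {y z : A} (hy : IsSource k y) (hz : IsTarget k z) : y * z = z * y := by
  rw [← hy.sourceMap_eq, ← hz.targetMap_eq, sourceMap_apply, targetMap_apply]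
  simp only [sw_mul, mul_sw, smul_mul_smul_comm]
  -- With `y = 1₍₁₎ε(y1₍₂₎)` and `z = ε(1₍₁₎z)1₍₂₎`, the products `zy` and `yz` are the two
  -- expansions of `Δ²(1)` contracted in their outer legs.
  have h1 := hA.sw_one (fun a b c => (ε (a * z) * ε (y * c)) • b)
  have h2 := hA.sw_one' (fun a b c => (ε (a * z) * ε (y * c)) • b)
  rw [h1] at h2
  refine Eq.trans ?_ (h2.symm.trans ?_)
  · exact sw_congr _ fun a b => sw_congr _ fun c d => by rw [mul_comm]
  · rw [sw_comm]

/-- In `Δ(h)Δ(1)(z ⊗ 1)` the factor `Δ(1)` is absorbed by `Δ(h)`. So elements of `H_t` pass entirely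
into the first leg, and in the same way elements of `H_s` pass into the second. -/
theorem sw_mul_target (h : A) {z : A} (hz : IsTarget k z) (F : A → A → M)
    (h₁ : ∀ b, Lin k fun a => F a b := by intros; fun_prop)
    (h₂ : ∀ a, Lin k fun b => F a b := by intros; fun_prop) :
    sw k (h * z) F = sw k h fun a b => F (a * z) b := by
  conv_rhs => rw [← mul_one h, hA.sw_mul_arg h 1 (fun a b => F (a * z) b)]
  rw [hA.sw_mul_arg _ _ F]
  refine sw_congr _ fun a b => ?_
  rw [hz.sw_right (fun c d => F (a * c) (b * d))]
  simp only [mul_assoc]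

theorem sw_target_mul (h : A) {z : A} (hz : IsTarget k z) (F : A → A → M)
    (h₁ : ∀ b, Lin k fun a => F a b := by intros; fun_prop)
    (h₂ : ∀ a, Lin k fun b => F a b := by intros; fun_prop) :
    sw k (z * h) F = sw k h fun a b => F (z * a) b := by
  conv_rhs => rw [← one_mul h, hA.sw_mul_arg 1 h (fun a b => F (z * a) b)]
  rw [hA.sw_mul_arg _ _ F, hz.sw_left (fun a b => sw k h fun c d => F (a * c) (b * d))]
  simp only [mul_assoc]

theorem sw_mul_source (h : A) {y : A} (hy : IsSource k y) (F : A → A → M)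
    (h₁ : ∀ b, Lin k fun a => F a b := by intros; fun_prop)
    (h₂ : ∀ a, Lin k fun b => F a b := by intros; fun_prop) :
    sw k (h * y) F = sw k h fun a b => F a (b * y) := by
  conv_rhs => rw [← mul_one h, hA.sw_mul_arg h 1 (fun a b => F a (b * y))]
  rw [hA.sw_mul_arg _ _ F]
  refine sw_congr _ fun a b => ?_
  rw [hy.sw_right (fun c d => F (a * c) (b * d))]
  simp only [mul_assoc]

theorem sw_source_mul (h : A) {y : A} (hy : IsSource k y) (F : A → A → M)
    (h₁ : ∀ b, Lin k fun a => F a b := by intros; fun_prop)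
    (h₂ : ∀ a, Lin k fun b => F a b := by intros; fun_prop) :
    sw k (y * h) F = sw k h fun a b => F a (y * b) := by
  conv_rhs => rw [← one_mul h, hA.sw_mul_arg 1 h (fun a b => F a (y * b))]
  rw [hA.sw_mul_arg _ _ F, hy.sw_left (fun a b => sw k h fun c d => F (a * c) (b * d))]
  simp only [mul_assoc]

/-- Under `ε` the factor `x` may be replaced by an element of `H_s`, which is part of the second leg
of a coproduct; counitality then removes that leg. The next three lemmas are mirror images. -/
theorem sw_counit_right_mul (h x : A) (F : A → M) (hF : Lin k F := by intros; fun_prop) :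
    (sw k h fun a b => ε (b * x) • F a) = F (h * sourceMapOp k A x) := by
  rw [← sw_counit_right (k := k) (h * _) F,
    hA.sw_mul_source h (hA.isSource_sourceMapOp x) (fun a b => ε b • F a)]
  simp only [hA.counit_mul_sourceMapOp]

theorem sw_counit_left_mul (h x : A) (F : A → M) (hF : Lin k F := by intros; fun_prop) :
    (sw k h fun a b => ε (a * x) • F b) = F (h * targetMap k A x) := by
  rw [← sw_counit_left (k := k) (h * _) F,
    hA.sw_mul_target h (hA.isTarget_targetMap x) (fun a b => ε a • F b)]
  simp only [hA.counit_mul_targetMap]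

theorem sw_counit_mul_right (h x : A) (F : A → M) (hF : Lin k F := by intros; fun_prop) :
    (sw k h fun a b => ε (x * b) • F a) = F (sourceMap k A x * h) := by
  rw [← sw_counit_right (k := k) (_ * h) F,
    hA.sw_source_mul h (hA.isSource_sourceMap x) (fun a b => ε b • F a)]
  simp only [hA.counit_sourceMap_mul]

theorem sw_counit_mul_left (h x : A) (F : A → M) (hF : Lin k F := by intros; fun_prop) :
    (sw k h fun a b => ε (x * a) • F b) = F (targetMapOp k A x * h) := by
  rw [← sw_counit_left (k := k) (_ * h) F,
    hA.sw_target_mul h (hA.isTarget_targetMapOp x) (fun a b => ε a • F b)]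
  simp only [hA.counit_targetMapOp_mul]

section OneMaps

variable (h : A) (F : A → A → M) (h₁ : ∀ b, Lin k fun a => F a b := by intros; fun_prop)
    (h₂ : ∀ a, Lin k fun b => F a b := by intros; fun_prop)
include h₁ h₂

/-- Applying `ε` to the middle leg of `Δ²(1)`, expanded as a product, returns `Δ(1)`. These four
lemmas are the device by which the legs of `Δ(1)` are assumed to lie in `H_s` and `H_t` whenever a
relation is available only there. -/
theorem sw_one_sourceMapOp_left :
    (sw k (1 : A) fun a b => F (sourceMapOp k A a) b) = sw k (1 : A) F := by
  simp only [sourceMapOp_apply, lin_map_sw (h₁ _), (h₁ _).map_smul]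
  rw [sw_comm, ← hA.sw_one (fun a b c => ε b • F a c)]
  exact sw_congr _ fun a b => sw_counit_left b _

theorem sw_one_sourceMap_left :
    (sw k (1 : A) fun a b => F (sourceMap k A a) b) = sw k (1 : A) F := by
  simp only [sourceMap_apply, lin_map_sw (h₁ _), (h₁ _).map_smul]
  rw [sw_comm, ← hA.sw_one' (fun a b c => ε b • F a c)]
  exact sw_congr _ fun a b => sw_counit_left b _

theorem sw_one_targetMapOp_right :
    (sw k (1 : A) fun a b => F a (targetMapOp k A b)) = sw k (1 : A) F := by
  simp only [targetMapOp_apply, lin_map_sw (h₂ _), (h₂ _).map_smul]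
  rw [← hA.sw_one (fun a b c => ε b • F a c)]
  exact sw_congr _ fun a b => sw_counit_left b _

theorem sw_one_targetMap_right :
    (sw k (1 : A) fun a b => F a (targetMap k A b)) = sw k (1 : A) F := by
  simp only [targetMap_apply, lin_map_sw (h₂ _), (h₂ _).map_smul]
  rw [← hA.sw_one' (fun a b c => ε b • F a c)]
  exact sw_congr _ fun a b => sw_counit_left b _

/-- `h₍₁₎ ⊗ ε(h₍₂₎ 1₍₁₎) 1₍₂₎ = h 1₍₁₎ ⊗ 1₍₂₎` -/
theorem sw_targetMapOp_right :
    (sw k h fun a b => F a (targetMapOp k A b)) = sw k (1 : A) fun a b => F (h * a) b := by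
  simp only [targetMapOp_apply, lin_map_sw (h₂ _), (h₂ _).map_smul]
  rw [sw_comm]
  simp only [hA.sw_counit_right_mul h _ (fun x => F x _) (h₁ _)]
  exact hA.sw_one_sourceMapOp_left (fun a b => F (h * a) b)

/-- `ε(1₍₂₎ h₍₁₎) 1₍₁₎ ⊗ h₍₂₎ = 1₍₁₎ ⊗ 1₍₂₎ h` -/
theorem sw_sourceMapOp_left :
    (sw k h fun a b => F (sourceMapOp k A a) b) = sw k (1 : A) fun a b => F a (b * h) := by
  simp only [sourceMapOp_apply, lin_map_sw (h₁ _), (h₁ _).map_smul]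
  rw [sw_comm]
  simp only [hA.sw_counit_mul_left h _ (fun x => F _ x) (h₂ _)]
  exact hA.sw_one_targetMapOp_right (fun a b => F a (b * h))

/-- `ε_s(h₍₁₎) ⊗ h₍₂₎ = 1₍₁₎ ⊗ h 1₍₂₎` -/
theorem sw_sourceMap_left :
    (sw k h fun a b => F (sourceMap k A a) b) = sw k (1 : A) fun a b => F a (h * b) := by
  simp only [sourceMap_apply, lin_map_sw (h₁ _), (h₁ _).map_smul]
  rw [sw_comm]
  simp only [hA.sw_counit_left_mul h _ (fun x => F _ x) (h₂ _)]
  exact hA.sw_one_targetMap_right (fun a b => F a (h * b))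

/-- `h₍₁₎ ⊗ ε_t(h₍₂₎) = 1₍₁₎ h ⊗ 1₍₂₎` -/
theorem sw_targetMap_right :
    (sw k h fun a b => F a (targetMap k A b)) = sw k (1 : A) fun a b => F (a * h) b := by
  simp only [targetMap_apply, lin_map_sw (h₂ _), (h₂ _).map_smul]
  rw [sw_comm]
  simp only [hA.sw_counit_mul_right h _ (fun x => F x _) (h₁ _)]
  exact hA.sw_one_sourceMap_left (fun a b => F (a * h) b)

end OneMaps

end IsWeakBialgebra

end WeakBialgebra

/-! ### The antipode of a weak Hopf algebra -/

theorem sw_assoc_four {k C M : Type*} [CommRing k] [AddCommMonoid C] [Module k C] [Coalgebra k C]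
    [AddCommMonoid M] [Module k M] (h : C) (G : C → C → C → C → M)
    (h₁ : ∀ b c d, Lin k fun a => G a b c d := by intros; fun_prop)
    (h₂ : ∀ a c d, Lin k fun b => G a b c d := by intros; fun_prop)
    (h₃ : ∀ a b d, Lin k fun c => G a b c d := by intros; fun_prop)
    (h₄ : ∀ a b c, Lin k fun d => G a b c d := by intros; fun_prop) :
    (sw k h fun a b => sw k a fun p q => sw k b fun r s => G p q r s) =
      sw k h fun a b => sw k b fun c d => sw k c fun e f => G a e f d := by
  rw [sw_assoc h fun p q b => sw k b fun r s => G p q r s]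
  exact sw_congr _ fun a b => (sw_assoc b fun p r s => G a p r s).symm

theorem sw_conv_assoc {k C B : Type*} [CommRing k] [AddCommMonoid C] [Module k C] [Coalgebra k C]
    [Ring B] [Algebra k B] (f g l : C →ₗ[k] B) (h : C) :
    (sw k h fun a b => (sw k a fun p q => f p * g q) * l b) =
      sw k h fun a b => f a * sw k b fun p q => g p * l q := by
  simp only [sw_mul, mul_sw, mul_assoc]
  exact sw_assoc h fun a b c => f a * (g b * l c)

section Antipode

variable {k A M : Type*} [CommRing k] [Ring A] [Algebra k A] [Coalgebra k A]
  [AddCommMonoid M] [Module k M]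

local notation "ε" => counit (R := k)

theorem targetMap_one : targetMap k A 1 = 1 := by
  rw [targetMap_apply]; simpa using sw_counit_left (k := k) (1 : A) (fun x => x)

theorem sourceMap_one : sourceMap k A 1 = 1 := by
  rw [sourceMap_apply]; simpa using sw_counit_right (k := k) (1 : A) (fun x => x)

theorem IsWeakBialgebra.sourceMap_targetMapOp (hA : IsWeakBialgebra k A) (h : A) :
    sourceMap k A (targetMapOp k A h) = sourceMap k A h := by
  simp only [sourceMap_apply, hA.counit_targetMapOp_mul]

theorem IsWeakBialgebra.targetMap_sourceMapOp (hA : IsWeakBialgebra k A) (h : A) :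
    targetMap k A (sourceMapOp k A h) = targetMap k A h := by
  simp only [targetMap_apply, hA.counit_mul_sourceMapOp]

theorem IsWeakBialgebra.sourceMap_mul_source (hA : IsWeakBialgebra k A) (x : A) {y : A}
    (hy : IsSource k y) : sourceMap k A (x * y) = sourceMap k A x * y := by
  rw [← hA.sw_counit_mul_right y x (fun a => a), hy.sw_left (fun a b => ε (x * b) • a),
    sourceMap_apply]
  simp only [mul_assoc]

theorem IsWeakBialgebra.sourceMapOp_source_mul (hA : IsWeakBialgebra k A) (x : A) {y : A}
    (hy : IsSource k y) : sourceMapOp k A (y * x) = y * sourceMapOp k A x := by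
  rw [← hA.sw_counit_right_mul y x (fun a => a), hy.sw_right (fun a b => ε (b * x) • a),
    sourceMapOp_apply]
  simp only [mul_assoc]

/-- `ε_s(h₍₁₎) ⊗ ε_t(h₍₂₎) = ε_s(h₍₂₎) ⊗ ε_t(h₍₁₎)` -/
theorem IsWeakBialgebra.sw_sourceMap_targetMap (hA : IsWeakBialgebra k A) (h : A) (F : A → A → M)
    (h₁ : ∀ b, Lin k fun a => F a b := by intros; fun_prop)
    (h₂ : ∀ a, Lin k fun b => F a b := by intros; fun_prop) :
    (sw k h fun a b => F (sourceMap k A a) (targetMap k A b)) =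
      sw k h fun a b => F (sourceMap k A b) (targetMap k A a) := by
  simp only [sourceMap_apply, targetMap_apply, lin_map_sw (h₁ _), lin_map_sw (h₂ _),
    (h₁ _).map_smul, (h₂ _).map_smul]
  rw [sw_comm, sw_comm (k := k) h]
  refine sw_congr _ fun p q => ?_
  rw [sw_comm, sw_comm (k := k) h]
  refine sw_congr _ fun r s => ?_
  simp only [← mul_smul, ← sw_smul, mul_comm (counit (R := k) (_ * q))]
  -- Both `ε(ph₍₁₎)ε(h₍₂₎s)` and `ε(ph₍₂₎)ε(h₍₁₎s)` equal `ε(phs)`.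
  rw [← hA.counit_sw, hA.counit_sw']

/-- The map `h ↦ S(h₍₂₎) ⊗ S(h₍₁₎)`. -/
def flipAntipode (S : A →ₗ[k] A) : A →ₗ[k] A ⊗[k] A :=
  map S S ∘ₗ (comm k A A).toLinearMap ∘ₗ comul

theorem flipAntipode_apply (S : A →ₗ[k] A) (h : A) :
    flipAntipode S h = sw k h fun a b => S b ⊗ₜ[k] S a := by
  simp [flipAntipode, comul_eq_sw, map_sw, equiv_map_sw]

namespace IsWeakHopfAlgebra

variable {S : A →ₗ[k] A} (hA : IsWeakHopfAlgebra k A S)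
include hA

theorem sw_antipode_left (h : A) : (sw k h fun a b => S a * b) = sourceMap k A h := by
  rw [← hA.antipode_conv_id, conv_apply]; rfl

theorem sw_antipode_right (h : A) : (sw k h fun a b => a * S b) = targetMap k A h := by
  rw [← hA.id_conv_antipode, conv_apply]; rfl

theorem sw_sourceMap_antipode (h : A) : (sw k h fun a b => sourceMap k A a * S b) = S h := by
  conv_rhs => rw [← hA.antipode_conv_id_conv_antipode, conv_apply, hA.antipode_conv_id]

theorem sw_antipode_targetMap (h : A) : (sw k h fun a b => S a * targetMap k A b) = S h := by
  rw [← hA.sw_sourceMap_antipode]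
  simp only [← hA.sw_antipode_left, ← hA.sw_antipode_right, sw_mul, mul_sw]
  rw [sw_assoc h fun a b c => S a * b * S c]
  simp only [mul_assoc]

theorem map_one : S 1 = 1 := by
  rw [← hA.sw_antipode_targetMap, hA.sw_one_targetMap_right (fun a b => S a * b),
    hA.sw_antipode_left, sourceMap_one]

/-- Since `ε(ε_s(x)l) = ε(xl)`, also `ε_s(xy) = ε_s(ε_s(x)y)`, and `ε_s(x) = S(x₍₁₎)x₍₂₎` enters
only the second leg of `Δ(y)`. Together with `targetMap_mul`, this gives `S(y)S(x)` the same
one-sided convolutions with the product as `S(xy)`. -/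
theorem sourceMap_mul (x y : A) :
    sourceMap k A (x * y) = sw k x fun a b => sw k y fun c d => S c * S a * (b * d) := by
  have : sourceMap k A (x * y) = sourceMap k A (sourceMap k A x * y) := by
    rw [sourceMap_apply (x * y), sourceMap_apply (sourceMap k A x * y)]
    simp only [mul_assoc, hA.counit_sourceMap_mul]
  rw [this, ← hA.sw_antipode_left,
    hA.sw_source_mul y (hA.isSource_sourceMap x) (fun a b => S a * b), sw_comm]
  refine sw_congr _ fun a b => ?_
  simp only [← hA.sw_antipode_left x, sw_mul, mul_sw, mul_assoc]

theorem targetMap_mul (x y : A) :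
    targetMap k A (x * y) = sw k x fun a b => sw k y fun c d => a * c * (S d * S b) := by
  have : targetMap k A (x * y) = targetMap k A (x * targetMap k A y) := by
    rw [targetMap_apply (x * y), targetMap_apply (x * targetMap k A y)]
    simp only [← mul_assoc, hA.counit_mul_targetMap]
  rw [this, ← hA.sw_antipode_right,
    hA.sw_mul_target x (hA.isTarget_targetMap y) (fun a b => a * S b)]
  refine sw_congr _ fun a b => ?_
  simp only [← hA.sw_antipode_right y, sw_mul, mul_sw, mul_assoc]

-- Associativity of convolution for bilinear maps on `A × A`, that is, over the coalgebra `A ⊗ A`,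
-- without constructing that coalgebra.
omit hA in
theorem _root_.WeakHopf.sw_sw_mul_assoc (f g l : A → A → A) (x y : A)
    (hf : ∀ b, Lin k fun a => f a b := by intros; fun_prop)
    (hf' : ∀ a, Lin k fun b => f a b := by intros; fun_prop)
    (hg : ∀ b, Lin k fun a => g a b := by intros; fun_prop)
    (hg' : ∀ a, Lin k fun b => g a b := by intros; fun_prop)
    (hl : ∀ b, Lin k fun a => l a b := by intros; fun_prop)
    (hl' : ∀ a, Lin k fun b => l a b := by intros; fun_prop) :
    (sw k x fun a b => sw k y fun c d =>
      (sw k a fun p q => sw k c fun r s => f p r * g q s) * l b d) =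
    sw k x fun a b => sw k y fun c d =>
      f a c * (sw k b fun p q => sw k d fun r s => g p r * l q s) := by
  simp only [sw_mul, mul_sw, mul_assoc]
  calc _ = sw k x fun a b => sw k a fun p q => sw k y fun c d => sw k c fun r s =>
        f p r * (g q s * l b d) := sw_congr _ fun a b => sw_comm _ _ _
    _ = sw k x fun a b => sw k a fun p q => sw k y fun c d => sw k d fun r s =>
        f p c * (g q r * l b s) := sw_congr _ fun a b => sw_congr _ fun p q =>
          sw_assoc y fun r s d => f p r * (g q s * l b d)
    _ = sw k x fun a b => sw k b fun p q => sw k y fun c d => sw k d fun r s =>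
        f a c * (g p r * l q s) := sw_assoc x fun p q b => sw k y fun c d => sw k d fun r s =>
          f p c * (g q r * l b s)
    _ = _ := sw_congr _ fun a b => sw_comm _ _ _

/-- Uniqueness of a weak convolution inverse. The expression `S(x₍₁₎y₍₁₎)x₍₂₎y₍₂₎S(y₍₃₎)S(x₍₃₎)` is
`S(xy)` in one grouping and `S(y₍₁₎)ε_s(x₍₁₎)ε_t(y₍₂₎)S(x₍₂₎)` in the other. Since `H_s` and `H_t`
commute, the latter collapses to `S(y)S(x)`. -/
theorem map_mul (x y : A) : S (x * y) = S y * S x := by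
  calc S (x * y) = sw k x fun a b => sw k y fun c d =>
        S (a * c) * (sw k b fun p q => sw k d fun r s => p * r * (S s * S q)) := by
        simp only [← hA.targetMap_mul]
        rw [← hA.sw_mul_arg x y (fun u v => S u * targetMap k A v), hA.sw_antipode_targetMap]
    _ = sw k x fun a b => sw k y fun c d =>
        (sw k a fun p q => sw k c fun r s => S (p * r) * (q * s)) * (S d * S b) :=
        (sw_sw_mul_assoc (fun a c => S (a * c)) (fun b d => b * d) (fun b d => S d * S b) x y).symm
    _ = sw k x fun a b => sw k y fun c d =>
        (sw k a fun p q => sw k c fun r s => S r * S p * (q * s)) * (S d * S b) := by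
        refine sw_congr _ fun a b => sw_congr _ fun c d => ?_
        rw [← hA.sw_mul_arg a c (fun u v => S u * v), hA.sw_antipode_left, hA.sourceMap_mul]
    _ = sw k y fun c d => sw k x fun a b => S c * sourceMap k A a * targetMap k A d * S b := by
        rw [sw_sw_mul_assoc (fun a c => S c * S a) (fun b d => b * d) (fun b d => S d * S b) x y]
        simp only [mul_sw]
        calc _ = sw k x fun a b => sw k b fun p q => sw k y fun c d => sw k d fun r s =>
              S c * S a * (p * r * (S s * S q)) := sw_congr _ fun a b => sw_comm _ _ _
          _ = sw k x fun a b => sw k a fun p q => sw k y fun c d => sw k d fun r s =>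
              S c * S p * (q * r * (S s * S b)) := (sw_assoc x fun a p q => sw k y fun c d =>
                sw k d fun r s => S c * S a * (p * r * (S s * S q))).symm
          _ = _ := by
            rw [sw_comm]
            refine sw_congr _ fun a b => ?_
            simp only [← hA.sw_antipode_left, ← hA.sw_antipode_right, mul_sw, sw_mul, mul_assoc]
            rw [sw_comm]
            exact sw_congr _ fun c d => sw_comm _ _ _
    _ = sw k y fun c d => sw k x fun a b =>
          S c * targetMap k A d * (sourceMap k A a * S b) := by
        refine sw_congr _ fun a b => sw_congr _ fun c d => ?_
        rw [mul_assoc (S a), hA.commute (hA.isSource_sourceMap _) (hA.isTarget_targetMap _)]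
        simp only [mul_assoc]
    _ = S y * S x := by
        simp only [← mul_sw, ← sw_mul, hA.sw_sourceMap_antipode, hA.sw_antipode_targetMap]

/-- Here `y₍₁₎S(y₍₂₎) = 1₍₁₎S(y1₍₂₎) = 1₍₁₎S(1₍₂₎)S(y)`, and `ε_t(1) = 1`. This is why `S` maps
`H_s` into `H_t`; the next lemma is the mirror image. -/
theorem targetMap_source {y : A} (hy : IsSource k y) : targetMap k A y = S y := by
  rw [← hA.sw_antipode_right, hy.sw_left (fun a b => a * S b)]
  simp only [hA.map_mul, ← mul_assoc]
  rw [← sw_mul, hA.sw_antipode_right, targetMap_one, one_mul]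

theorem sourceMap_target {z : A} (hz : IsTarget k z) : sourceMap k A z = S z := by
  rw [← hA.sw_antipode_left, hz.sw_right (fun a b => S a * b)]
  simp only [hA.map_mul, mul_assoc]
  rw [← mul_sw, hA.sw_antipode_left, sourceMap_one, mul_one]

theorem isTarget_antipode {y : A} (hy : IsSource k y) : IsTarget k (S y) := by
  rw [← hA.targetMap_source hy]; exact hA.isTarget_targetMap y

theorem isSource_antipode {z : A} (hz : IsTarget k z) : IsSource k (S z) := by
  rw [← hA.sourceMap_target hz]; exact hA.isSource_sourceMap z

theorem antipode_sourceMapOp (h : A) : S (sourceMapOp k A h) = targetMap k A h := by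
  rw [← hA.targetMap_source (hA.isSource_sourceMapOp h), hA.targetMap_sourceMapOp]

theorem antipode_targetMapOp (h : A) : S (targetMapOp k A h) = sourceMap k A h := by
  rw [← hA.sourceMap_target (hA.isTarget_targetMapOp h), hA.sourceMap_targetMapOp]

/-- From `S(h) = S(h₍₁₎)ε_t(h₍₂₎)`: the counit does not see `ε_t` on a right factor, which leaves
`ε(S(h₍₁₎)h₍₂₎) = ε(ε_s(h)) = ε(h)`. -/
theorem counit_antipode (h : A) : ε (S h) = ε h := by
  rw [← hA.sw_antipode_targetMap, map_sw]
  simp only [hA.counit_mul_targetMap]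
  rw [← map_sw, hA.sw_antipode_left]
  simpa using hA.counit_sourceMap_mul h 1

/-- `Δ(z) = 1₍₁₎ z ⊗ 1₍₂₎` for `z = ε_t(h)`, written as `h₍₁₎ S(h₍₄₎) ⊗ h₍₂₎ S(h₍₃₎)`. -/
theorem comul_targetMap (h : A) : comul (R := k) (targetMap k A h) =
    sw k h fun a b => comul (R := k) a * flipAntipode S b := by
  symm
  calc _ = sw k h fun a b => sw k a fun p q => sw k b fun r s => (p * S s) ⊗ₜ[k] (q * S r) := by
        simp only [flipAntipode_apply, comul_eq_sw (k := k) (_ : A), sw_mul, mul_sw,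
          Algebra.TensorProduct.tmul_mul_tmul]
        exact sw_congr _ fun a b => sw_comm _ _ _
    _ = sw k h fun a b => sw k b fun c d => (a * S d) ⊗ₜ[k] targetMap k A c := by
        rw [sw_assoc_four h fun p q r s => (p * S s) ⊗ₜ[k] (q * S r)]
        simp only [← hA.sw_antipode_right, tmul_sw]
    _ = sw k h fun a b => sw k a fun c d => (c * S b) ⊗ₜ[k] targetMap k A d :=
        (sw_assoc h fun a c d => (a * S d) ⊗ₜ[k] targetMap k A c).symm
    _ = sw k h fun a b => sw k (1 : A) fun c d => (c * a * S b) ⊗ₜ[k] d :=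
        sw_congr _ fun a b => hA.sw_targetMap_right a fun c d => (c * S b) ⊗ₜ[k] d
    _ = _ := by
        rw [sw_comm, (hA.isTarget_targetMap h).2, comul_eq_sw (1 : A), sw_mul]
        simp only [Algebra.TensorProduct.tmul_mul_tmul, mul_one, mul_assoc, ← sw_tmul, ← mul_sw,
          hA.sw_antipode_right]

theorem sw_flip_antipode_mul_comul (h : A) :
    (sw k h fun a b => flipAntipode S a * comul (R := k) b) =
    sw k h fun a b => sw k b fun c d => sourceMap k A c ⊗ₜ[k] (S a * d) := by
  calc _ = sw k h fun a b => sw k a fun p q => sw k b fun r s => (S q * r) ⊗ₜ[k] (S p * s) := by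
        simp only [flipAntipode_apply, comul_eq_sw (k := k) (_ : A), sw_mul, mul_sw,
          Algebra.TensorProduct.tmul_mul_tmul]
        exact sw_congr _ fun a b => sw_comm _ _ _
    _ = _ := by
        rw [sw_assoc_four h fun p q r s => (S q * r) ⊗ₜ[k] (S p * s)]
        simp only [← hA.sw_antipode_left, sw_tmul]

theorem comul_sourceMap (h : A) : comul (R := k) (sourceMap k A h) =
    sw k h fun a b => flipAntipode S a * comul (R := k) b := by
  symm
  calc _ = sw k h fun a b => sw k b fun c d => sourceMap k A c ⊗ₜ[k] (S a * d) :=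
        hA.sw_flip_antipode_mul_comul h
    _ = sw k h fun a b => sw k (1 : A) fun c d => c ⊗ₜ[k] (S a * (b * d)) :=
        sw_congr _ fun a b => hA.sw_sourceMap_left b fun c d => c ⊗ₜ[k] (S a * d)
    _ = _ := by
        rw [sw_comm, (hA.isSource_sourceMap h).1, comul_eq_sw (1 : A), mul_sw]
        simp only [Algebra.TensorProduct.tmul_mul_tmul, one_mul, ← mul_assoc, ← tmul_sw, ← sw_mul,
          hA.sw_antipode_left]

/-- Regrouping gives `ε_s(h₍₂₎)S(h₍₄₎) ⊗ S(h₍₁₎)ε_t(h₍₃₎)`. Exchanging the arguments of `ε_s` and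
`ε_t` by `sw_sourceMap_targetMap` makes the legs adjacent, and each antipode then absorbs its
neighbour. -/
theorem sw_flipAntipode_mul_comul_targetMap (h : A) :
    (sw k h fun a b => flipAntipode S a * comul (R := k) (targetMap k A b)) =
    flipAntipode S h := by
  calc _ = sw k h fun a b => (sw k a fun c d => flipAntipode S c *
          comul (R := k) d) * flipAntipode S b := by
        simp only [hA.comul_targetMap]
        exact (sw_conv_assoc (flipAntipode S) comul (flipAntipode S) h).symm
    _ = sw k h fun a b => sw k a fun p q => sw k q fun c d => sw k b fun r s =>
          (sourceMap k A c * S s) ⊗ₜ[k] (S p * d * S r) := by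
        simp only [hA.sw_flip_antipode_mul_comul]
        simp only [flipAntipode_apply, sw_mul, mul_sw, Algebra.TensorProduct.tmul_mul_tmul]
        refine sw_congr _ fun a b => ?_
        rw [sw_comm]
        refine sw_congr _ fun c d => sw_comm _ _ _
    _ = sw k h fun p b => sw k b fun q d => sw k d fun r s =>
          (sourceMap k A q * S s) ⊗ₜ[k] (S p * targetMap k A r) := by
        rw [sw_assoc h fun p q b => sw k q fun c d => sw k b fun r s =>
          (sourceMap k A c * S s) ⊗ₜ[k] (S p * d * S r)]
        refine sw_congr _ fun p b => ?_
        rw [sw_assoc_four b fun c d r s => (sourceMap k A c * S s) ⊗ₜ[k] (S p * d * S r)]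
        simp only [mul_assoc, ← hA.sw_antipode_right, mul_sw, tmul_sw]
    _ = sw k h fun p b => sw k b fun q d => sw k d fun r s =>
          (sourceMap k A r * S s) ⊗ₜ[k] (S p * targetMap k A q) := by
        refine sw_congr _ fun p b => ?_
        rw [← sw_assoc b fun q r s => (sourceMap k A q * S s) ⊗ₜ[k] (S p * targetMap k A r),
          ← sw_assoc b fun q r s => (sourceMap k A r * S s) ⊗ₜ[k] (S p * targetMap k A q)]
        exact sw_congr _ fun u s => hA.sw_sourceMap_targetMap u
          fun x y => (x * S s) ⊗ₜ[k] (S p * y)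
    _ = _ := by
        simp only [← sw_tmul, hA.sw_sourceMap_antipode]
        rw [← sw_assoc h fun p q d => S d ⊗ₜ[k] (S p * targetMap k A q)]
        simp only [← tmul_sw, hA.sw_antipode_targetMap, flipAntipode_apply]

/-- Uniqueness of a weak convolution inverse once more, now for `Δ` among maps from `A` to `A ⊗ A`:
both sides have the left and right convolutions `Δ ∘ ε_s` and `Δ ∘ ε_t` with `Δ`. -/
theorem comul_antipode (h : A) : comul (R := k) (S h) = flipAntipode S h := by
  calc _ = sw k h fun a b => (comul ∘ₗ S) a * (sw k b fun p q =>
          comul (R := k) p * flipAntipode S q) := by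
        simp only [← hA.comul_targetMap, LinearMap.comp_apply, ← hA.comul_mul]
        rw [← map_sw, hA.sw_antipode_targetMap]
    _ = sw k h fun a b => (sw k a fun p q => (comul ∘ₗ S) p * comul (R := k) q) *
          flipAntipode S b := (sw_conv_assoc _ _ _ _).symm
    _ = sw k h fun a b => (sw k a fun p q => flipAntipode S p * comul (R := k) q) *
          flipAntipode S b := by
        simp only [← hA.comul_sourceMap, LinearMap.comp_apply, ← hA.comul_mul]
        simp only [← map_sw, hA.sw_antipode_left]
    _ = sw k h fun a b => flipAntipode S a * (sw k b fun p q =>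
          comul (R := k) p * flipAntipode S q) := sw_conv_assoc _ _ _ _
    _ = _ := by
        simp only [← hA.comul_targetMap]
        exact hA.sw_flipAntipode_mul_comul_targetMap h

theorem sw_antipode (h : A) (F : A → A → M)
    (h₁ : ∀ b, Lin k fun a => F a b := by intros; fun_prop)
    (h₂ : ∀ a, Lin k fun b => F a b := by intros; fun_prop) :
    sw k (S h) F = sw k h fun a b => F (S b) (S a) := by
  rw [sw, hA.comul_antipode, flipAntipode_apply]
  simp (disch := first | (intro; fun_prop) | fun_prop) only [sw_tsw, tsw_tmul]

theorem sw_one_flip (F : A → A → M)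
    (h₁ : ∀ b, Lin k fun a => F a b := by intros; fun_prop)
    (h₂ : ∀ a, Lin k fun b => F a b := by intros; fun_prop) :
    (sw k (1 : A) fun a b => F (S b) (S a)) = sw k (1 : A) F := by
  rw [← hA.sw_antipode 1 F, hA.map_one]

/-- Replacing `1₍₁₎ ⊗ 1₍₂₎` by `S(1₍₂₎) ⊗ S(1₍₁₎)` turns `ε(S(h)1₍₁₎)1₍₂₎` into `S(1₍₁₎ε(1₍₂₎h))`.
For bijective `S` this identifies the two expressions for the counit of `D(H)`. -/
theorem targetMapOp_antipode (h : A) : targetMapOp k A (S h) = targetMap k A h := by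
  rw [← hA.antipode_sourceMapOp, targetMapOp_apply,
    ← hA.sw_one_flip fun a b => ε (S h * a) • b, sourceMapOp_apply, map_sw]
  simp only [← hA.map_mul, hA.counit_antipode, map_smul]

/-- `1₍₁₎ ⊗ z 1₍₂₎ = S(z) 1₍₁₎ ⊗ 1₍₂₎` for `z ∈ H_t` -/
theorem sw_one_target_mul {z : A} (hz : IsTarget k z) (F : A → A → M)
    (h₁ : ∀ b, Lin k fun a => F a b := by intros; fun_prop)
    (h₂ : ∀ a, Lin k fun b => F a b := by intros; fun_prop) :
    (sw k (1 : A) fun a b => F a (z * b)) = sw k (1 : A) fun a b => F (S z * a) b := by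
  rw [← hA.sw_sourceMap_left z F, hz.sw_left fun a b => F (sourceMap k A a) b,
    ← hA.sw_one_sourceMap_left fun a b => F (sourceMap k A (z * a)) b,
    ← hA.sw_one_sourceMap_left fun a b => F (S z * a) b]
  simp only [hA.sourceMap_mul_source _ (hA.isSource_sourceMap _), hA.sourceMap_target hz]

end IsWeakHopfAlgebra

namespace IsWeakHopfAlgebra

variable {S : A ≃ₗ[k] A} (hA : IsWeakHopfAlgebra k A S.toLinearMap)
include hA

theorem symm_one : S.symm 1 = 1 := by
  rw [LinearEquiv.symm_apply_eq]; exact hA.map_one.symm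

theorem symm_mul (x y : A) : S.symm (x * y) = S.symm y * S.symm x := by
  rw [LinearEquiv.symm_apply_eq]
  simpa using (hA.map_mul (S.symm y) (S.symm x)).symm

theorem equiv_mul (x y : A) : S (x * y) = S y * S x := hA.map_mul x y

theorem sw_equiv (h : A) (F : A → A → M)
    (h₁ : ∀ b, Lin k fun a => F a b := by intros; fun_prop)
    (h₂ : ∀ a, Lin k fun b => F a b := by intros; fun_prop) :
    sw k (S h) F = sw k h fun a b => F (S b) (S a) := hA.sw_antipode h F

theorem sw_symm (h : A) (F : A → A → M)
    (h₁ : ∀ b, Lin k fun a => F a b := by intros; fun_prop)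
    (h₂ : ∀ a, Lin k fun b => F a b := by intros; fun_prop) :
    sw k (S.symm h) F = sw k h fun a b => F (S.symm b) (S.symm a) := by
  have := hA.sw_equiv (S.symm h) fun a b => F (S.symm b) (S.symm a)
  simpa using this.symm

theorem sw_one_flip_symm (F : A → A → M)
    (h₁ : ∀ b, Lin k fun a => F a b := by intros; fun_prop)
    (h₂ : ∀ a, Lin k fun b => F a b := by intros; fun_prop) :
    (sw k (1 : A) fun a b => F (S.symm b) (S.symm a)) = sw k (1 : A) F := by
  rw [← hA.sw_symm 1 F, hA.symm_one]

theorem targetMapOp_eq (h : A) : targetMapOp k A h = targetMap k A (S.symm h) := by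
  simpa using hA.targetMapOp_antipode (S.symm h)

theorem symm_source {y : A} (hy : IsSource k y) : S.symm y = targetMapOp k A y := by
  rw [LinearEquiv.symm_apply_eq]
  exact (hy.sourceMap_eq.symm.trans (hA.antipode_targetMapOp y).symm)

theorem symm_target {z : A} (hz : IsTarget k z) : S.symm z = sourceMapOp k A z := by
  rw [LinearEquiv.symm_apply_eq]
  exact (hz.targetMap_eq.symm.trans (hA.antipode_sourceMapOp z).symm)

theorem isTarget_symm {y : A} (hy : IsSource k y) : IsTarget k (S.symm y) := by
  rw [hA.symm_source hy]; exact hA.isTarget_targetMapOp y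

theorem isSource_symm {z : A} (hz : IsTarget k z) : IsSource k (S.symm z) := by
  rw [hA.symm_target hz]; exact hA.isSource_sourceMapOp z

theorem isTarget_equiv {y : A} (hy : IsSource k y) : IsTarget k (S y) := hA.isTarget_antipode hy

theorem isSource_equiv {z : A} (hz : IsTarget k z) : IsSource k (S z) := hA.isSource_antipode hz

/-- `y 1₍₁₎ ⊗ 1₍₂₎ = 1₍₁₎ ⊗ S⁻¹(y) 1₍₂₎` for `y ∈ H_s` -/
theorem sw_one_source_mul {y : A} (hy : IsSource k y) (F : A → A → M)
    (h₁ : ∀ b, Lin k fun a => F a b := by intros; fun_prop)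
    (h₂ : ∀ a, Lin k fun b => F a b := by intros; fun_prop) :
    (sw k (1 : A) fun a b => F (y * a) b) = sw k (1 : A) fun a b => F a (S.symm y * b) := by
  rw [hA.sw_one_target_mul (hA.isTarget_symm hy) F]
  simp

/-- `1₍₁₎ ⊗ 1₍₂₎ z = 1₍₁₎ S⁻¹(z) ⊗ 1₍₂₎` for `z ∈ H_t` -/
theorem sw_one_mul_target {z : A} (hz : IsTarget k z) (F : A → A → M)
    (h₁ : ∀ b, Lin k fun a => F a b := by intros; fun_prop)
    (h₂ : ∀ a, Lin k fun b => F a b := by intros; fun_prop) :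
    (sw k (1 : A) fun a b => F a (b * z)) = sw k (1 : A) fun a b => F (a * S.symm z) b := by
  rw [← hA.sw_sourceMapOp_left z F, hz.sw_right fun a b => F (sourceMapOp k A a) b,
    ← hA.sw_one_sourceMap_left fun a b => F (sourceMapOp k A (a * z)) b,
    ← hA.sw_one_sourceMap_left fun a b => F (a * S.symm z) b]
  simp only [hA.sourceMapOp_source_mul _ (hA.isSource_sourceMap _), hA.symm_target hz]

/-- `h₍₂₎ S⁻¹(h₍₁₎) = 1₍₁₎ ε(1₍₂₎ h)` -/
theorem sw_mul_symm (h : A) : (sw k h fun a b => b * S.symm a) = sourceMapOp k A h := by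
  apply S.injective
  rw [equiv_map_sw]
  simp only [hA.equiv_mul, LinearEquiv.apply_symm_apply]
  exact (hA.sw_antipode_right h).trans (hA.antipode_sourceMapOp h).symm

/-- `S⁻¹(h₍₂₎) h₍₁₎ = ε(h 1₍₁₎) 1₍₂₎` -/
theorem sw_symm_mul (h : A) : (sw k h fun a b => S.symm b * a) = targetMapOp k A h := by
  apply S.injective
  rw [equiv_map_sw]
  simp only [hA.equiv_mul, LinearEquiv.apply_symm_apply]
  exact (hA.sw_antipode_left h).trans (hA.antipode_targetMapOp h).symm

theorem sourceMapOp_one : sourceMapOp k A 1 = 1 := by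
  rw [sourceMapOp_apply]; simpa using sw_counit_right (k := k) (1 : A) (fun x => x)

theorem targetMapOp_one : targetMapOp k A 1 = 1 := by
  rw [targetMapOp_apply]; simpa using sw_counit_left (k := k) (1 : A) (fun x => x)

end IsWeakHopfAlgebra

end Antipode

/-! ### Opposites and transport of structure -/

section Constructors

variable {k A M : Type*} [CommRing k] [Ring A] [Algebra k A] [Coalgebra k A]
  [AddCommMonoid M] [Module k M]

local notation "ε" => counit (R := k)

/-- The weak bialgebra axioms in terms of Sweedler sums. -/
theorem IsWeakBialgebra.of_sw
    (h_mul : ∀ h l : A, comul (R := k) (h * l) =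
      sw k h fun a b => sw k l fun c d => (a * c) ⊗ₜ[k] (b * d))
    (h_one : (sw k (1 : A) fun a b => sw k b fun c d => a ⊗ₜ[k] (c ⊗ₜ[k] d)) =
      sw k (1 : A) fun a b => sw k (1 : A) fun c d => a ⊗ₜ[k] ((b * c) ⊗ₜ[k] d))
    (h_one' : (sw k (1 : A) fun a b => sw k b fun c d => a ⊗ₜ[k] (c ⊗ₜ[k] d)) =
      sw k (1 : A) fun a b => sw k (1 : A) fun c d => a ⊗ₜ[k] ((c * b) ⊗ₜ[k] d))
    (h_counit : ∀ h x l : A, ε (h * x * l) = sw k x fun a b => ε (h * a) * ε (b * l))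
    (h_counit' : ∀ h x l : A, ε (h * x * l) = sw k x fun a b => ε (h * b) * ε (a * l)) :
    IsWeakBialgebra k A where
  comul_mul h l := by
    rw [h_mul, comul_eq_sw h, comul_eq_sw l]
    simp only [sw_mul, mul_sw, Algebra.TensorProduct.tmul_mul_tmul]
    rw [sw_comm]
  comul_one := by
    simp only [comul₂, LinearMap.comp_apply, comul_eq_sw (k := k) (1 : A), map_sw,
      LinearMap.lTensor_tmul, tmul_sw, sw_tmul, equiv_map_sw, mul_sw, sw_mul,
      TensorProduct.assoc_tmul, Algebra.TensorProduct.tmul_mul_tmul, one_mul, mul_one]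
    simp only [comul_eq_sw (k := k) (_ : A), tmul_sw]
    rw [h_one, sw_comm]
  comul_one' := by
    simp only [comul₂, LinearMap.comp_apply, comul_eq_sw (k := k) (1 : A), map_sw,
      LinearMap.lTensor_tmul, tmul_sw, sw_tmul, equiv_map_sw, mul_sw, sw_mul,
      TensorProduct.assoc_tmul, Algebra.TensorProduct.tmul_mul_tmul, one_mul, mul_one]
    simp only [comul_eq_sw (k := k) (_ : A), tmul_sw]
    rw [h_one']
  counit_mul h x l := by
    rw [h_counit, comul_eq_sw x]
    simp [counit₂, mul_sw, sw_mul, map_sw]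
  counit_mul' h x l := by
    rw [h_counit', comul_eq_sw x]
    simp [counit₂, mul_sw, sw_mul, map_sw, mul_comm]

/-- The weak Hopf algebra axioms in terms of Sweedler sums. -/
theorem IsWeakHopfAlgebra.of_sw {S : A →ₗ[k] A} (hA : IsWeakBialgebra k A)
    (h_left : ∀ h : A, (sw k h fun a b => S a * b) = sourceMap k A h)
    (h_right : ∀ h : A, (sw k h fun a b => a * S b) = targetMap k A h)
    (h_conv : ∀ h : A, (sw k h fun a b => sourceMap k A a * S b) = S h) :
    IsWeakHopfAlgebra k A S where
  toIsWeakBialgebra := hA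
  antipode_conv_id := by ext h; rw [conv_apply, ← h_left]; rfl
  id_conv_antipode := by ext h; rw [conv_apply, ← h_right]; rfl
  antipode_conv_id_conv_antipode := by
    have : conv S LinearMap.id = sourceMap k A := by ext h; rw [conv_apply, ← h_left]; rfl
    ext h; rw [this, conv_apply, ← h_conv]

theorem IsWeakBialgebra.sw_targetMap_mul (hA : IsWeakBialgebra k A) (h : A) :
    (sw k h fun a b => targetMap k A a * b) = h := by
  simp only [targetMap_apply, sw_mul, smul_mul_assoc]
  rw [sw_comm, ← hA.sw_mul_arg 1 h fun a b => ε a • b, one_mul, sw_counit_left h fun x => x]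

open MulOpposite in
theorem sw_op (h : A) (F : Aᵐᵒᵖ → Aᵐᵒᵖ → M)
    (h₁ : ∀ b, Lin k fun a => F a b := by intros; fun_prop)
    (h₂ : ∀ a, Lin k fun b => F a b := by intros; fun_prop) :
    sw k (op h) F = sw k h fun a b => F (op a) (op b) := by
  have : comul (R := k) (op h) = sw k h fun a b => op a ⊗ₜ[k] op b := by
    rw [comul_def, LinearMap.comp_apply, LinearMap.comp_apply, LinearEquiv.coe_coe,
      coe_opLinearEquiv_symm, unop_op, comul_eq_sw h, map_sw]
    rfl
  rw [sw, this]
  simp (disch := first | (intro; fun_prop) | fun_prop) only [sw_tsw, tsw_tmul]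

theorem counit_op (h : A) : counit (R := k) (MulOpposite.op h) = counit (R := k) h := rfl

@[fun_prop]
theorem lin_op : Lin k (fun x : A => MulOpposite.op x) := ⟨fun _ _ => rfl, fun _ _ => rfl⟩

open MulOpposite in
/-- The opposite of a weak Hopf algebra with bijective antipode. -/
theorem IsWeakHopfAlgebra.op {S : A ≃ₗ[k] A} (hA : IsWeakHopfAlgebra k A S.toLinearMap) :
    IsWeakHopfAlgebra k Aᵐᵒᵖ (opAntipode S).toLinearMap := by
  have hs (h : A) : sourceMap k Aᵐᵒᵖ (MulOpposite.op h) = MulOpposite.op (sourceMapOp k A h) := by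
    rw [sourceMap_apply, ← op_one, sw_op 1 fun a b => counit (R := k) (_ * b) • a,
      sourceMapOp_apply, lin_map_sw lin_op]
    rfl
  have ht (h : A) : targetMap k Aᵐᵒᵖ (MulOpposite.op h) = MulOpposite.op (targetMapOp k A h) := by
    rw [targetMap_apply, ← op_one, sw_op 1 fun a b => counit (R := k) (a * _) • b,
      targetMapOp_apply, lin_map_sw lin_op]
    rfl
  have hS (h : A) : (opAntipode S).toLinearMap (MulOpposite.op h) = MulOpposite.op (S.symm h) := rfl
  refine .of_sw (.of_sw ?_ ?_ ?_ ?_ ?_) ?_ ?_ ?_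
  · intro h l
    induction h with | _ h
    induction l with | _ l
    rw [← op_mul, comul_eq_sw, sw_op _ fun a b => a ⊗ₜ[k] b,
      sw_op h fun a b => sw k (MulOpposite.op l) fun c d => (a * c) ⊗ₜ[k] (b * d),
      hA.sw_mul_arg l h fun a b => MulOpposite.op a ⊗ₜ[k] MulOpposite.op b, sw_comm]
    refine sw_congr _ fun a b => ?_
    rw [sw_op l fun c d => (MulOpposite.op a * c) ⊗ₜ[k] (MulOpposite.op b * d)]
    rfl
  · rw [← op_one]
    simp (disch := first | (intro; fun_prop) | fun_prop) only [sw_op, ← op_mul]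
    -- Reversing products interchanges the two expansions of `Δ²(1)`, and below the two counit
    -- axioms.
    exact hA.sw_one' fun a b c => MulOpposite.op a ⊗ₜ[k] (MulOpposite.op b ⊗ₜ[k] MulOpposite.op c)
  · rw [← op_one]
    simp (disch := first | (intro; fun_prop) | fun_prop) only [sw_op, ← op_mul]
    exact hA.sw_one fun a b c => MulOpposite.op a ⊗ₜ[k] (MulOpposite.op b ⊗ₜ[k] MulOpposite.op c)
  · intro h x l
    induction h with | _ h
    induction x with | _ x
    induction l with | _ l
    simp (disch := first | (intro; fun_prop) | fun_prop) only [sw_op, ← op_mul, counit_op]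
    rw [← mul_assoc, hA.counit_sw']
    simp only [mul_comm]
  · intro h x l
    induction h with | _ h
    induction x with | _ x
    induction l with | _ l
    simp (disch := first | (intro; fun_prop) | fun_prop) only [sw_op, ← op_mul, counit_op]
    rw [← mul_assoc, hA.counit_sw]
    simp only [mul_comm]
  · intro h
    induction h with | _ h
    rw [sw_op h fun a b => _, hs, ← hA.sw_mul_symm, lin_map_sw lin_op]
    rfl
  · intro h
    induction h with | _ h
    rw [sw_op h fun a b => _, ht, ← hA.sw_symm_mul, lin_map_sw lin_op]
    rfl
  · intro h
    induction h with | _ h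
    rw [sw_op h fun a b => _]
    simp only [hs, hS, ← op_mul]
    rw [← lin_map_sw lin_op]
    congr 1
    -- After applying `S` the claim reads `ε_t(h₍₁₎)h₍₂₎ = h`.
    apply S.injective
    simp only [equiv_map_sw, hA.equiv_mul, LinearEquiv.apply_symm_apply]
    have := hA.antipode_sourceMapOp
    simp only [LinearEquiv.coe_coe] at this
    simp only [this]
    exact hA.sw_targetMap_mul h

theorem sw_algEquiv {B : Type*} [Ring B] [Algebra k B] [Coalgebra k B] (f : A ≃ₐ[k] B)
    (h_comul : ∀ a, comul (R := k) (f a) = map f.toLinearMap f.toLinearMap (comul (R := k) a))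
    (a : A) (F : B → B → M)
    (h₁ : ∀ b, Lin k fun a => F a b := by intros; fun_prop)
    (h₂ : ∀ a, Lin k fun b => F a b := by intros; fun_prop) :
    sw k (f a) F = sw k a fun p q => F (f p) (f q) := by
  rw [sw, h_comul, comul_eq_sw a, map_sw]
  simp (disch := first | (intro; fun_prop) | fun_prop) only [TensorProduct.map_tmul, sw_tsw,
    tsw_tmul]
  rfl

/-- Transport of a weak Hopf algebra structure along an isomorphism of algebras and coalgebras. -/
theorem IsWeakHopfAlgebra.transport {B : Type*} [Ring B] [Algebra k B] [Coalgebra k B]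
    {S : A →ₗ[k] A} (hA : IsWeakHopfAlgebra k A S) (f : A ≃ₐ[k] B) (T : B →ₗ[k] B)
    (h_comul : ∀ a, comul (R := k) (f a) = map f.toLinearMap f.toLinearMap (comul (R := k) a))
    (h_counit : ∀ a, counit (R := k) (f a) = counit (R := k) a)
    (hT : ∀ a, T (f a) = f (S a)) : IsWeakHopfAlgebra k B T := by
  have hs (h : A) : sourceMap k B (f h) = f (sourceMap k A h) := by
    rw [sourceMap_apply, ← _root_.map_one f, sourceMap_apply, lin_map_sw (lin_algEquiv f)]
    simp (disch := first | assumption | (intro; fun_prop) | fun_prop) only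
      [sw_algEquiv, ← _root_.map_mul, h_counit,
      _root_.map_smul]
  have ht (h : A) : targetMap k B (f h) = f (targetMap k A h) := by
    rw [targetMap_apply, ← _root_.map_one f, targetMap_apply, lin_map_sw (lin_algEquiv f)]
    simp (disch := first | assumption | (intro; fun_prop) | fun_prop) only
      [sw_algEquiv, ← _root_.map_mul, h_counit,
      _root_.map_smul]
  refine .of_sw (.of_sw ?_ ?_ ?_ ?_ ?_) ?_ ?_ ?_
  · intro h l
    obtain ⟨h, rfl⟩ := f.surjective h
    obtain ⟨l, rfl⟩ := f.surjective l
    rw [comul_eq_sw, ← _root_.map_mul]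
    simp (disch := first | assumption | (intro; fun_prop) | fun_prop) only [sw_algEquiv]
    rw [hA.sw_mul_arg h l fun a b => f a ⊗ₜ[k] f b]
    simp only [_root_.map_mul]
  · rw [← _root_.map_one f]
    simp (disch := first | assumption | (intro; fun_prop) | fun_prop) only
      [sw_algEquiv, ← _root_.map_mul]
    exact hA.sw_one fun a b c => f a ⊗ₜ[k] (f b ⊗ₜ[k] f c)
  · rw [← _root_.map_one f]
    simp (disch := first | assumption | (intro; fun_prop) | fun_prop) only
      [sw_algEquiv, ← _root_.map_mul]
    exact hA.sw_one' fun a b c => f a ⊗ₜ[k] (f b ⊗ₜ[k] f c)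
  · intro h x l
    obtain ⟨h, rfl⟩ := f.surjective h
    obtain ⟨x, rfl⟩ := f.surjective x
    obtain ⟨l, rfl⟩ := f.surjective l
    simp (disch := first | assumption | (intro; fun_prop) | fun_prop) only
      [sw_algEquiv, ← _root_.map_mul, h_counit]
    exact hA.counit_sw _ _ _
  · intro h x l
    obtain ⟨h, rfl⟩ := f.surjective h
    obtain ⟨x, rfl⟩ := f.surjective x
    obtain ⟨l, rfl⟩ := f.surjective l
    simp (disch := first | assumption | (intro; fun_prop) | fun_prop) only
      [sw_algEquiv, ← _root_.map_mul, h_counit]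
    exact hA.counit_sw' _ _ _
  · intro h
    obtain ⟨h, rfl⟩ := f.surjective h
    simp (disch := first | assumption | (intro; fun_prop) | fun_prop) only
      [sw_algEquiv, hT, ← _root_.map_mul]
    rw [hs, ← hA.sw_antipode_left, lin_map_sw (lin_algEquiv f)]
  · intro h
    obtain ⟨h, rfl⟩ := f.surjective h
    simp (disch := first | assumption | (intro; fun_prop) | fun_prop) only
      [sw_algEquiv, hT, ← _root_.map_mul]
    rw [ht, ← hA.sw_antipode_right, lin_map_sw (lin_algEquiv f)]
  · intro h
    obtain ⟨h, rfl⟩ := f.surjective h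
    simp (disch := first | assumption | (intro; fun_prop) | fun_prop) only
      [sw_algEquiv, hT, hs, ← _root_.map_mul]
    rw [← hA.sw_sourceMap_antipode, lin_map_sw (lin_algEquiv f)]

end Constructors

/-! ### The dual coalgebra -/

section TensorSums

variable {k M N P Q : Type*} [CommRing k] [AddCommMonoid M] [Module k M] [AddCommMonoid N]
  [Module k N] [AddCommMonoid P] [Module k P] [AddCommMonoid Q] [Module k Q]

theorem map_tsw (g : P →ₗ[k] Q) (t : M ⊗[k] N) (F : M → N → P) :
    g (tsw t F) = tsw t fun a b => g (F a b) := lin_map_tsw (lin_linearMap g) _ _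

theorem equiv_map_tsw (g : P ≃ₗ[k] Q) (t : M ⊗[k] N) (F : M → N → P) :
    g (tsw t F) = tsw t fun a b => g (F a b) := lin_map_tsw (lin_linearEquiv g) _ _

theorem tsw_apply (t : M ⊗[k] N) (F : M → N → P →ₗ[k] Q) (x : P) :
    (tsw t F) x = tsw t fun a b => F a b x :=
  lin_map_tsw (g := fun f : P →ₗ[k] Q => f x) (by fun_prop) _ _

theorem tsw_tmul_right (t : M ⊗[k] N) (F : M → N → P) (x : Q) :
    tsw t F ⊗ₜ[k] x = tsw t fun a b => F a b ⊗ₜ[k] x :=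
  lin_map_tsw (g := fun y => y ⊗ₜ[k] x) (by fun_prop) _ _

theorem tmul_tsw (t : M ⊗[k] N) (F : M → N → P) (x : Q) :
    x ⊗ₜ[k] tsw t F = tsw t fun a b => x ⊗ₜ[k] F a b :=
  lin_map_tsw (g := fun y => x ⊗ₜ[k] y) (by fun_prop) _ _

end TensorSums

section DualCoalgebra

variable {k H M : Type*} [CommRing k] [Ring H] [Algebra k H] [Module.Finite k H]
  [Module.Projective k H] [AddCommMonoid M] [Module k M]

/-- For `H` finitely generated projective, `H* ⊗ M → Hom(H, M)` is bijective, so tensors are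
compared by evaluating the first leg. No dual basis is ever chosen. -/
theorem dual_tmul_ext {t t' : Dual k H ⊗[k] M}
    (h : ∀ x : H, (tsw t fun α m => α x • m) = tsw t' fun α m => α x • m) : t = t' := by
  apply (dualTensorHom_bijective (R := k) (M := H) (N := M)).1
  ext x
  have key : ∀ t : Dual k H ⊗[k] M, dualTensorHom k H M t x = tsw t fun α m => α x • m := by
    intro t
    conv_lhs => rw [← tsw_mk t, map_tsw, tsw_apply]
    simp
  rw [key, key, h]

theorem dual_tmul_dual_ext {t t' : Dual k H ⊗[k] Dual k H}
    (h : ∀ x y : H, (tsw t fun α β => α x * β y) = tsw t' fun α β => α x * β y) : t = t' := by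
  refine dual_tmul_ext fun x => LinearMap.ext fun y => ?_
  rw [tsw_apply, tsw_apply]
  simpa using h x y

theorem tsw_dualComul (φ : Dual k H) (x y : H) :
    (tsw (dualComul k H φ) fun α β => α x * β y) = φ (x * y) := by
  rw [← dualDistrib_dualComul]
  conv_rhs => rw [← tsw_mk (dualComul k H φ), map_tsw, tsw_apply]
  simp

theorem tsw_dualComul_smul (φ : Dual k H) (x : H) :
    (tsw (dualComul k H φ) fun α β => α x • β) = φ ∘ₗ LinearMap.mulLeft k x := by
  ext y
  rw [tsw_apply]
  simpa using tsw_dualComul φ x y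

variable (k H) in
/-- The coalgebra structure of the dual of a finitely generated projective algebra. -/
@[reducible] def dualCoalgebra : Coalgebra k (Dual k H) where
  comul := dualComul k H
  counit := LinearMap.applyₗ 1
  coassoc := by
    ext1 φ
    have h1 : (assoc k _ _ _) ((dualComul k H).rTensor _ (dualComul k H φ)) =
        tsw (dualComul k H φ) fun α β => tsw (dualComul k H α) fun γ δ => γ ⊗ₜ (δ ⊗ₜ[k] β) := by
      conv_lhs => rw [← tsw_mk (dualComul k H φ), map_tsw, equiv_map_tsw]
      refine tsw_congr _ fun α β => ?_
      conv_lhs => rw [LinearMap.rTensor_tmul, ← tsw_mk (dualComul k H α), tsw_tmul_right,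
        equiv_map_tsw]
      rfl
    have h2 : (dualComul k H).lTensor _ (dualComul k H φ) =
        tsw (dualComul k H φ) fun α β => α ⊗ₜ dualComul k H β := by
      conv_lhs => rw [← tsw_mk (dualComul k H φ), map_tsw]
      rfl
    refine h1.trans (Eq.trans ?_ h2.symm)
    -- Evaluating the first leg at `x` and then the second at `y` reduces coassociativity to
    -- associativity in the argument of `φ`.
    refine dual_tmul_ext fun x => ?_
    simp (disch := first | (intro; fun_prop) | fun_prop) only [tsw_tsw, tsw_tmul]
    have h3 : (tsw (dualComul k H φ) fun α β => α x • dualComul k H β) =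
        dualComul k H (φ ∘ₗ LinearMap.mulLeft k x) := by
      rw [← tsw_dualComul_smul, map_tsw]
      simp only [map_smul]
    have h4 (α β : Dual k H) : (tsw (dualComul k H α) fun γ δ => γ x • (δ ⊗ₜ[k] β)) =
        (α ∘ₗ LinearMap.mulLeft k x) ⊗ₜ[k] β := by
      rw [← tsw_dualComul_smul, tsw_tmul_right]
      rfl
    simp only [h3, h4]
    refine dual_tmul_ext fun y => ?_
    simp (disch := first | (intro; fun_prop) | fun_prop) only [tsw_tsw, tsw_tmul]
    rw [tsw_dualComul_smul]
    refine (tsw_dualComul_smul φ (x * y)).trans ?_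
    ext z
    simp
  rTensor_counit_comp_comul := by
    ext1 φ
    have h1 : (LinearMap.applyₗ (1 : H) : Dual k H →ₗ[k] k).rTensor _ (dualComul k H φ) =
        tsw (dualComul k H φ) fun α β => 1 ⊗ₜ (α 1 • β) := by
      conv_lhs => rw [← tsw_mk (dualComul k H φ), map_tsw]
      refine tsw_congr _ fun α β => ?_
      simp [TensorProduct.smul_tmul']
    refine h1.trans ?_
    rw [← tmul_tsw, tsw_dualComul_smul]
    simp
  lTensor_counit_comp_comul := by
    ext1 φ
    have h1 : (LinearMap.applyₗ (1 : H) : Dual k H →ₗ[k] k).lTensor _ (dualComul k H φ) =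
        tsw (dualComul k H φ) fun α β => (β 1 • α) ⊗ₜ 1 := by
      conv_lhs => rw [← tsw_mk (dualComul k H φ), map_tsw]
      refine tsw_congr _ fun α β => ?_
      simp [TensorProduct.smul_tmul]
    refine h1.trans ?_
    rw [← tsw_tmul_right]
    change _ = φ ⊗ₜ[k] (1 : k)
    congr 1
    ext x
    rw [tsw_apply]
    simpa [mul_comm] using tsw_dualComul φ x 1

end DualCoalgebra

/-! ### The bimodule action of `H` on `H*` and the product of `H*` -/

section DualAction

variable {k H : Type*} [CommRing k] [Ring H] [Algebra k H]

theorem dualAct_apply (x y l : H) (φ : Dual k H) : dualAct k H x y φ l = φ (y * l * x) := rfl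

theorem dualAct_dualAct (x y x' y' : H) (φ : Dual k H) :
    dualAct k H x y (dualAct k H x' y' φ) = dualAct k H (x * x') (y' * y) φ := by
  ext l; simp [dualAct_apply, mul_assoc]

theorem dualAct_one_one (φ : Dual k H) : dualAct k H 1 1 φ = φ := by
  ext l; simp [dualAct_apply]

variable [Coalgebra k H]

local notation "ε" => (counit : H →ₗ[k] k)

theorem dualMul_apply (φ ψ : Dual k H) (x : H) :
    dualMul k H (φ ⊗ₜ[k] ψ) x = sw k x fun a b => φ a * ψ b := by
  simp [dualMul, comul_eq_sw, map_sw]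

theorem dualMul_assoc (φ ψ χ : Dual k H) :
    dualMul k H (dualMul k H (φ ⊗ₜ[k] ψ) ⊗ₜ[k] χ) =
      dualMul k H (φ ⊗ₜ[k] dualMul k H (ψ ⊗ₜ[k] χ)) := by
  ext x
  simp only [dualMul_apply, sw_mul, mul_sw, mul_assoc]
  exact sw_assoc x fun a b c => φ a * (ψ b * χ c)

theorem dualMul_counit_left (φ : Dual k H) : dualMul k H (ε ⊗ₜ[k] φ) = φ := by
  ext x
  simpa [dualMul_apply] using sw_counit_left (k := k) x φ

theorem dualMul_counit_right (φ : Dual k H) : dualMul k H (φ ⊗ₜ[k] ε) = φ := by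
  ext x
  simpa [dualMul_apply, mul_comm] using sw_counit_right (k := k) x φ

namespace IsWeakBialgebra

variable (hH : IsWeakBialgebra k H)
include hH

/-- The value `ε(yu₍₁₎x)` splits as `ε(yu₍₁₎)ε(u₍₂₎x)`, and each factor is contracted separately.
Multiplication by the functionals occurring in the generators of `I` thus becomes an action of
`H_t`. -/
theorem dualMul_dualAct_counit (x y : H) (φ : Dual k H) :
    dualMul k H (dualAct k H x y ε ⊗ₜ[k] φ) =
      dualAct k H (targetMap k H x) (targetMapOp k H y) φ := by
  ext u
  simp only [dualMul_apply, dualAct_apply]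
  calc _ = sw k u fun a b => sw k a fun c d => ε (y * c) * ε (d * x) * φ b := by
        simp only [hH.counit_sw, sw_mul]
    _ = sw k u fun a b => ε (y * a) • sw k b fun c d => ε (c * x) • φ d := by
        rw [sw_assoc u fun c d b => ε (y * c) * ε (d * x) * φ b]
        simp only [smul_eq_mul, mul_sw, mul_assoc]
    _ = _ := by
        simp only [hH.sw_counit_left_mul _ x φ]
        rw [hH.sw_counit_mul_left u y fun b => φ (b * targetMap k H x)]

theorem dualMul_counit_dualAct_left (y : H) (φ : Dual k H) :
    dualMul k H (φ ⊗ₜ[k] dualAct k H 1 y ε) = dualAct k H 1 (sourceMap k H y) φ := by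
  ext u
  simp only [dualMul_apply, dualAct_apply, mul_one, mul_comm (φ _)]
  exact hH.sw_counit_mul_right u y φ

theorem dualMul_counit_dualAct_right (x : H) (φ : Dual k H) :
    dualMul k H (φ ⊗ₜ[k] dualAct k H x 1 ε) = dualAct k H (sourceMapOp k H x) 1 φ := by
  ext u
  simp only [dualMul_apply, dualAct_apply, one_mul, mul_comm (φ _)]
  exact hH.sw_counit_right_mul u x φ

end IsWeakBialgebra

end DualAction

/-! ### Sweedler sums in `H*` -/

section DualSweedler

variable {k H M : Type*} [CommRing k] [Ring H] [Algebra k H] [Module.Finite k H]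
  [Module.Projective k H] [AddCommMonoid M] [Module k M]

attribute [local instance] dualCoalgebra

theorem sw_dual_eval (φ : Dual k H) (x y : H) : (sw k φ fun α β => α x * β y) = φ (x * y) :=
  tsw_dualComul φ x y

theorem sw_dualAct (φ : Dual k H) (x y : H) (F : Dual k H → Dual k H → M)
    (h₁ : ∀ b, Lin k fun a => F a b := by intros; fun_prop)
    (h₂ : ∀ a, Lin k fun b => F a b := by intros; fun_prop) :
    sw k (dualAct k H x y φ) F =
      sw k φ fun α β => F (dualAct k H 1 y α) (dualAct k H x 1 β) := by
  have : comul (R := k) (dualAct k H x y φ) =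
      sw k φ fun α β => dualAct k H 1 y α ⊗ₜ[k] dualAct k H x 1 β := by
    refine dual_tmul_dual_ext fun u v => ?_
    simp (disch := first | (intro; fun_prop) | fun_prop) only [sw_tsw, tsw_tmul]
    refine (sw_dual_eval _ _ _).trans ?_
    simp only [dualAct_apply]
    rw [sw_dual_eval]
    simp [mul_assoc]
  rw [sw, this]
  simp (disch := first | (intro; fun_prop) | fun_prop) only [sw_tsw, tsw_tmul]

/-- Both sides evaluate at `u ⊗ v` to `φ(uxv)`; an inner factor can therefore cross the tensor sign.
-/
theorem sw_dualAct_mid (φ : Dual k H) (x : H) (F : Dual k H → Dual k H → M)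
    (h₁ : ∀ b, Lin k fun a => F a b := by intros; fun_prop)
    (h₂ : ∀ a, Lin k fun b => F a b := by intros; fun_prop) :
    (sw k φ fun α β => F (dualAct k H x 1 α) β) =
      sw k φ fun α β => F α (dualAct k H 1 x β) := by
  have : (sw k φ fun α β => dualAct k H x 1 α ⊗ₜ[k] β) =
      sw k φ fun α β => α ⊗ₜ[k] dualAct k H 1 x β := by
    refine dual_tmul_dual_ext fun u v => ?_
    simp (disch := first | (intro; fun_prop) | fun_prop) only [sw_tsw, tsw_tmul]
    simp only [dualAct_apply]
    simp only [one_mul, mul_one]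
    rw [sw_dual_eval φ (u * x) v, sw_dual_eval φ u (x * v), mul_assoc]
  have := congrArg (fun t => tsw t F) this
  simp (disch := first | (intro; fun_prop) | fun_prop) only [sw_tsw, tsw_tmul] at this
  exact this

variable [Coalgebra k H]

local notation "ε" => (counit : H →ₗ[k] k)

namespace IsWeakBialgebra

variable (hH : IsWeakBialgebra k H)
include hH

/-- Dual to `Δ(uv) = Δ(u)Δ(v)` in `H`. -/
theorem sw_dualMul (φ ψ : Dual k H) (F : Dual k H → Dual k H → M)
    (h₁ : ∀ b, Lin k fun a => F a b := by intros; fun_prop)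
    (h₂ : ∀ a, Lin k fun b => F a b := by intros; fun_prop) :
    sw k (dualMul k H (φ ⊗ₜ[k] ψ)) F = sw k φ fun α β => sw k ψ fun γ δ =>
      F (dualMul k H (α ⊗ₜ[k] γ)) (dualMul k H (β ⊗ₜ[k] δ)) := by
  have : comul (R := k) (dualMul k H (φ ⊗ₜ[k] ψ)) = sw k φ fun α β => sw k ψ fun γ δ =>
      dualMul k H (α ⊗ₜ[k] γ) ⊗ₜ[k] dualMul k H (β ⊗ₜ[k] δ) := by
    refine dual_tmul_dual_ext fun u v => ?_
    simp (disch := first | (intro; fun_prop) | fun_prop) only [sw_tsw, tsw_tmul]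
    refine (sw_dual_eval _ _ _).trans ?_
    rw [dualMul_apply, hH.sw_mul_arg u v fun a b => φ a * ψ b]
    simp only [dualMul_apply, sw_mul, mul_sw]
    calc _ = sw k u fun a b => sw k v fun c d => (sw k φ fun α β => α a * β c) *
          sw k ψ fun γ δ => γ b * δ d := by simp only [sw_dual_eval]
      _ = sw k u fun a b => sw k v fun c d => sw k φ fun α β => sw k ψ fun γ δ =>
          α a * γ b * (β c * δ d) := by
          simp only [sw_mul, mul_sw]
          refine sw_congr _ fun a b => sw_congr _ fun c d => ?_
          rw [sw_comm]
          refine sw_congr _ fun α β => sw_congr _ fun γ δ => by ring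
      _ = sw k u fun a b => sw k φ fun α β => sw k ψ fun γ δ => sw k v fun c d =>
          α a * γ b * (β c * δ d) := sw_congr _ fun a b => by
          rw [sw_comm]
          exact sw_congr _ fun α β => sw_comm _ _ _
      _ = _ := by
          rw [sw_comm]
          refine sw_congr _ fun α β => ?_
          rw [sw_comm]
          refine sw_congr _ fun γ δ => sw_comm _ _ _
  rw [sw, this]
  simp (disch := first | (intro; fun_prop) | fun_prop) only [sw_tsw, tsw_tmul]

/-- Dual to `ε(uv) = ε(u1₍₂₎)ε(1₍₁₎v)`, the second counit axiom with middle factor `1`. -/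
theorem sw_dual_counit (F : Dual k H → Dual k H → M)
    (h₁ : ∀ b, Lin k fun a => F a b := by intros; fun_prop)
    (h₂ : ∀ a, Lin k fun b => F a b := by intros; fun_prop) :
    sw k ε F = sw k (1 : H) fun a b => F (dualAct k H b 1 ε) (dualAct k H 1 a ε) := by
  have : comul (R := k) ε =
      sw k (1 : H) fun a b => dualAct k H b 1 ε ⊗ₜ[k] dualAct k H 1 a ε := by
    refine dual_tmul_dual_ext fun u v => ?_
    simp (disch := first | (intro; fun_prop) | fun_prop) only [sw_tsw, tsw_tmul]
    refine (sw_dual_eval _ _ _).trans ?_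
    rw [← mul_one u, hH.counit_sw' u 1 v]
    simp [dualAct_apply]
  rw [sw, this]
  simp (disch := first | (intro; fun_prop) | fun_prop) only [sw_tsw, tsw_tmul]

end IsWeakBialgebra

end DualSweedler

/-! ### The weak smash product `H ⋈ H*` -/

section Bowtie

/-- Two bracketings of the fivefold coproduct: the left one arises from `(xy)z` in `H ⋈ H*`, the
right one from `x(yz)`. -/
theorem sw_assoc_five {k C M : Type*} [CommRing k] [AddCommMonoid C] [Module k C] [Coalgebra k C]
    [AddCommMonoid M] [Module k M] (m : C) (G : C → C → C → C → C → M)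
    (h₁ : ∀ b c d e, Lin k fun a => G a b c d e := by intros; fun_prop)
    (h₂ : ∀ a c d e, Lin k fun b => G a b c d e := by intros; fun_prop)
    (h₃ : ∀ a b d e, Lin k fun c => G a b c d e := by intros; fun_prop)
    (h₄ : ∀ a b c e, Lin k fun d => G a b c d e := by intros; fun_prop)
    (h₅ : ∀ a b c d, Lin k fun e => G a b c d e := by intros; fun_prop) :
    (sw k m fun a b => sw k b fun c d => sw k a fun p q => sw k d fun r s => G p q c r s) =
      sw k m fun a b => sw k b fun c d => sw k c fun p q => sw k q fun r s => G a p r s d := by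
  calc _ = sw k m fun a b => sw k a fun p q => sw k b fun c d => sw k d fun r s => G p q c r s :=
        sw_congr _ fun a b => sw_comm _ _ _
    _ = sw k m fun a b => sw k b fun q b => sw k b fun c d => sw k d fun r s => G a q c r s :=
        sw_assoc m fun p q b => sw k b fun c d => sw k d fun r s => G p q c r s
    _ = _ := sw_congr _ fun a b => by
        rw [sw_assoc b fun p q d => sw k q fun r s => G a p r s d]
        exact sw_congr _ fun p q => (sw_assoc q fun r s d => G a p r s d).symm

theorem sw_comm_two {k C C' M : Type*} [CommRing k] [AddCommMonoid C] [Module k C] [Coalgebra k C]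
    [AddCommMonoid C'] [Module k C'] [Coalgebra k C'] [AddCommMonoid M] [Module k M]
    (h : C) (h' : C')
    (F : C → C → C → C' → C' → C' → M) :
    (sw k h fun a b => sw k b fun c d => sw k h' fun p q => sw k q fun r s => F a c d p r s) =
      sw k h' fun p q => sw k q fun r s => sw k h fun a b => sw k b fun c d => F a c d p r s := by
  calc _ = sw k h fun a b => sw k h' fun p q => sw k q fun r s => sw k b fun c d =>
        F a c d p r s := sw_congr _ fun a b => by
        rw [sw_comm]
        exact sw_congr _ fun p q => sw_comm _ _ _
    _ = _ := by
        rw [sw_comm]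
        exact sw_congr _ fun p q => sw_comm _ _ _

variable {k H : Type*} [CommRing k] [Ring H] [Algebra k H] [Coalgebra k H] {S : H ≃ₗ[k] H}

local notation "ε" => (counit : H →ₗ[k] k)

theorem comul₂_eq_sw (h : H) :
    comul₂ k H h = sw k h fun a b => sw k b fun c d => a ⊗ₜ[k] (c ⊗ₜ[k] d) := by
  simp only [comul₂, LinearMap.comp_apply, comul_eq_sw (k := k) (_ : H), map_sw,
    LinearMap.lTensor_tmul, tmul_sw]

theorem smashMap_tmul (φ : Dual k H) (h : H) : smashMap S (φ ⊗ₜ[k] h) =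
    sw k h fun a b => sw k b fun c d => c ⊗ₜ[k] dualAct k H (S.symm a) d φ := by
  simp only [smashMap, TensorProduct.lift.tmul, LinearMap.mk₂_apply, comul₂_eq_sw, map_sw,
    equiv_map_sw, TensorProduct.leftComm_tmul, LinearMap.lTensor_tmul]
  rfl

theorem bowtieMul_tmul (h l : H) (φ ψ : Dual k H) :
    bowtieMul S (h ⊗ₜ[k] φ) (l ⊗ₜ[k] ψ) = sw k l fun a b => sw k b fun c d =>
      (h * c) ⊗ₜ[k] dualMul k H (dualAct k H (S.symm a) d φ ⊗ₜ[k] ψ) := by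
  have : bowtieMul S (h ⊗ₜ[k] φ) (l ⊗ₜ[k] ψ) =
      map (LinearMap.mul' k H) (dualMul k H)
        ((TensorProduct.tensorTensorTensorAssoc k H H (Dual k H) (Dual k H)).symm
          ((h ⊗ₜ[k] smashMap S (φ ⊗ₜ[k] l)) ⊗ₜ[k] ψ)) := by
    simp [bowtieMul]
  rw [this, smashMap_tmul]
  simp only [tmul_sw, sw_tmul, map_sw, equiv_map_sw,
    TensorProduct.tensorTensorTensorAssoc_symm_tmul, TensorProduct.map_tmul, LinearMap.mul'_apply]

namespace IsWeakHopfAlgebra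

variable (hH : IsWeakHopfAlgebra k H S.toLinearMap)
include hH

/-- `Δ` is multiplicative and `S⁻¹` reverses coproducts, so the legs of `x` appear in the opposite
order in `Δ(yuS⁻¹(x))`. -/
theorem dualAct_dualMul (x y : H) (φ ψ : Dual k H) :
    dualAct k H (S.symm x) y (dualMul k H (φ ⊗ₜ[k] ψ)) =
      sw k x fun a b => sw k y fun c d =>
        dualMul k H (dualAct k H (S.symm b) c φ ⊗ₜ[k] dualAct k H (S.symm a) d ψ) := by
  ext u
  simp only [dualAct_apply, dualMul_apply, sw_apply]
  rw [hH.sw_mul_arg _ _ fun a b => φ a * ψ b, hH.sw_mul_arg y u fun a b =>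
    sw k (S.symm x) fun c d => φ (a * c) * ψ (b * d)]
  rw [sw_comm (k := k) x]
  refine sw_congr _ fun c d => ?_
  rw [sw_comm (k := k) x]
  exact sw_congr _ fun p q => hH.sw_symm x fun r s => φ (c * p * r) * ψ (d * q * s)

/-- On both sides `m₍₁₎` and `m₍₅₎` act on `ψ`, `m₍₂₎` and `m₍₄₎` act on `φ`, and `m₍₃₎` stays in
`H`. On the left these legs come from acting on a product in `H*`, on the right from the coproduct
of a product in `H`. -/
theorem bowtieMul_assoc (x y z : H ⊗[k] Dual k H) :
    bowtieMul S (bowtieMul S x y) z = bowtieMul S x (bowtieMul S y z) := by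
  induction x with
  | zero => simp
  | add x x' hx hx' => simp only [map_add, LinearMap.add_apply, hx, hx']
  | tmul h φ =>
  induction y with
  | zero => simp
  | add y y' hy hy' => simp only [map_add, LinearMap.add_apply, hy, hy']
  | tmul l ψ =>
  induction z with
  | zero => simp
  | add z z' hz hz' => simp only [map_add, hz, hz']
  | tmul m χ =>
  rw [bowtieMul_tmul, bowtieMul_tmul]
  simp only [map_sw, sw_apply, bowtieMul_tmul]
  have hact (a c : H) (b d : H) : dualAct k H (S.symm (a * c)) (b * d) φ =
      dualAct k H (S.symm c) d (dualAct k H (S.symm a) b φ) := by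
    rw [dualAct_dualAct, hH.symm_mul]
  calc _ = sw k l fun a' b' => sw k b' fun c' d' => sw k m fun a b => sw k b fun c d =>
        sw k a fun p q => sw k d fun r s => (h * c' * c) ⊗ₜ[k] dualMul k H
          (dualAct k H (S.symm q) r (dualAct k H (S.symm a') d' φ) ⊗ₜ[k]
            dualMul k H (dualAct k H (S.symm p) s ψ ⊗ₜ[k] χ)) := by
        simp only [hH.dualAct_dualMul, sw_tmul, tmul_sw, map_sw, dualMul_assoc]
    _ = sw k l fun a' b' => sw k b' fun c' d' => sw k m fun a b => sw k b fun c d =>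
        sw k c fun p q => sw k q fun r s => (h * c' * r) ⊗ₜ[k] dualMul k H
          (dualAct k H (S.symm p) s (dualAct k H (S.symm a') d' φ) ⊗ₜ[k]
            dualMul k H (dualAct k H (S.symm a) d ψ ⊗ₜ[k] χ)) :=
        sw_congr _ fun a' b' => sw_congr _ fun c' d' => sw_assoc_five m fun p q c r s =>
          (h * c' * c) ⊗ₜ[k] dualMul k H
          (dualAct k H (S.symm q) r (dualAct k H (S.symm a') d' φ) ⊗ₜ[k]
            dualMul k H (dualAct k H (S.symm p) s ψ ⊗ₜ[k] χ))
    _ = sw k m fun a b => sw k b fun c d => sw k l fun a' b' => sw k b' fun c' d' =>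
        sw k c fun p q => sw k q fun r s => (h * c' * r) ⊗ₜ[k] dualMul k H
          (dualAct k H (S.symm p) s (dualAct k H (S.symm a') d' φ) ⊗ₜ[k]
            dualMul k H (dualAct k H (S.symm a) d ψ ⊗ₜ[k] χ)) :=
        sw_comm_two l m _
    _ = _ := by
        refine sw_congr _ fun a b => sw_congr _ fun c d => ?_
        rw [hH.sw_mul_arg l c fun a' b' => sw k b' fun c' d' => (h * c') ⊗ₜ[k] dualMul k H
          (dualAct k H (S.symm a') d' φ ⊗ₜ[k] dualMul k H (dualAct k H (S.symm a) d ψ ⊗ₜ[k] χ))]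
        refine sw_congr _ fun a' b' => ?_
        rw [sw_comm]
        refine sw_congr _ fun p q => ?_
        rw [hH.sw_mul_arg b' q fun c' d' => (h * c') ⊗ₜ[k] dualMul k H
          (dualAct k H (S.symm (a' * p)) d' φ ⊗ₜ[k]
            dualMul k H (dualAct k H (S.symm a) d ψ ⊗ₜ[k] χ))]
        simp only [hact, mul_assoc]

theorem bowtieMul_one (h : H) (φ : Dual k H) :
    bowtieMul S (h ⊗ₜ[k] φ) (1 ⊗ₜ[k] ε) = sw k (1 : H) fun a b => sw k b fun c d =>
      (h * c) ⊗ₜ[k] dualAct k H (S.symm a) d φ := by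
  simp only [bowtieMul_tmul, dualMul_counit_right]

/-- The outer legs of `h` act on `ε`, and `(S⁻¹(h₍₁₎) ⇀ ε ↼ h₍₃₎) * φ` sees them only through `H_t`,
so they can be traded for legs of `Δ(1)`. The outcome agrees with `bowtieMul_one`, which is the
centrality of the preunit. -/
theorem bowtieProj_tmul (h : H) (φ : Dual k H) :
    bowtieProj S (h ⊗ₜ[k] φ) = sw k (1 : H) fun a b => sw k b fun c d =>
      (h * c) ⊗ₜ[k] dualAct k H (S.symm a) d φ := by
  simp only [bowtieProj, bowtieMul_tmul, hH.dualMul_dualAct_counit, one_mul, ← hH.targetMapOp_eq]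
  calc _ = sw k h fun a b => sw k (1 : H) fun c d =>
        (b * c) ⊗ₜ[k] dualAct k H (targetMapOp k H a) d φ := sw_congr _ fun a b =>
        hH.sw_targetMapOp_right b fun c d => c ⊗ₜ[k] dualAct k H (targetMapOp k H a) d φ
    _ = sw k (1 : H) fun c d => sw k (1 : H) fun p q =>
        (h * targetMap k H p * c) ⊗ₜ[k] dualAct k H q d φ := by
        rw [sw_comm]
        refine sw_congr _ fun c d => ?_
        simp only [targetMapOp_apply, map_sw, sw_apply, tmul_sw, map_smul, LinearMap.smul_apply,
          TensorProduct.tmul_smul]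
        rw [sw_comm]
        exact sw_congr _ fun p q => hH.sw_counit_left_mul h p fun b =>
          (b * c) ⊗ₜ[k] dualAct k H q d φ
    _ = sw k (1 : H) fun c d => sw k (1 : H) fun p q =>
        (h * q * c) ⊗ₜ[k] dualAct k H (S.symm p) d φ := sw_congr _ fun c d => by
        rw [← hH.sw_one_flip_symm fun p q => (h * targetMap k H p * c) ⊗ₜ[k] dualAct k H q d φ]
        simp only [← hH.targetMapOp_eq]
        exact hH.sw_one_targetMapOp_right fun p q =>
          (h * q * c) ⊗ₜ[k] dualAct k H (S.symm p) d φ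
    _ = _ := by
        rw [sw_comm, hH.sw_one fun a b c => (h * b) ⊗ₜ[k] dualAct k H (S.symm a) c φ]
        simp only [mul_assoc]

/-- The preunit `1 ⋈ ε` is central. -/
theorem bowtieMul_one_eq_bowtieProj (x : H ⊗[k] Dual k H) :
    bowtieMul S x (1 ⊗ₜ[k] ε) = bowtieProj S x := by
  induction x with
  | zero => simp
  | add x y hx hy => simp only [map_add, LinearMap.add_apply, hx, hy]
  | tmul h φ => rw [hH.bowtieMul_one, hH.bowtieProj_tmul]

theorem bowtieProj_bowtieProj (x : H ⊗[k] Dual k H) :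
    bowtieProj S (bowtieProj S x) = bowtieProj S x := by
  induction x with
  | zero => simp
  | add x y hx hy => simp only [map_add, hx, hy]
  | tmul h φ =>
    simp only [hH.bowtieProj_tmul, map_sw, dualAct_dualAct, ← hH.symm_mul]
    have := hH.sw_mul_arg 1 1 fun a b => sw k b fun c d =>
      (h * c) ⊗ₜ[k] dualAct k H (S.symm a) d φ
    rw [one_mul] at this
    rw [this]
    refine sw_congr _ fun a b => ?_
    rw [sw_comm]
    refine sw_congr _ fun c d => ?_
    rw [hH.sw_mul_arg b d fun p q => (h * p) ⊗ₜ[k] dualAct k H (S.symm (a * c)) q φ]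
    simp only [mul_assoc]

/-- With the next lemma, this makes `Ker p` a two-sided ideal; the other side needs centrality of
the preunit. -/
theorem bowtieProj_bowtieMul (x y : H ⊗[k] Dual k H) :
    bowtieProj S (bowtieMul S x y) = bowtieMul S (bowtieProj S x) y := by
  simp only [bowtieProj, hH.bowtieMul_assoc]

theorem bowtieProj_bowtieMul' (x y : H ⊗[k] Dual k H) :
    bowtieProj S (bowtieMul S x y) = bowtieMul S x (bowtieProj S y) := by
  simp only [← hH.bowtieMul_one_eq_bowtieProj, hH.bowtieMul_assoc]

end IsWeakHopfAlgebra

end Bowtie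

/-! ### The algebra structure of the Drinfeld double -/

section DoubleAlgebra

variable {k H : Type*} [CommRing k] [Ring H] [Algebra k H] [Coalgebra k H] (S : H ≃ₗ[k] H)

local notation "ε" => (counit : H →ₗ[k] k)

/-- The additive group of the Drinfeld double. -/
@[reducible] def doubleAddCommGroup : AddCommGroup (DrinfeldDouble S) :=
  inferInstanceAs (AddCommGroup ((H ⊗[k] Dual k H) ⧸ LinearMap.ker (bowtieProj S)))

attribute [local instance] doubleAddCommGroup

/-- The module structure of the Drinfeld double. -/
@[reducible] def doubleModule : Module k (DrinfeldDouble S) :=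
  inferInstanceAs (Module k ((H ⊗[k] Dual k H) ⧸ LinearMap.ker (bowtieProj S)))

attribute [local instance] doubleModule

/-- The quotient map `H ⋈ H* → D(H)`. -/
def doubleMk : H ⊗[k] Dual k H →ₗ[k] DrinfeldDouble S :=
  (LinearMap.ker (bowtieProj S)).mkQ

theorem doubleMk_surjective : Function.Surjective (doubleMk S) :=
  Submodule.mkQ_surjective _

variable {S}

theorem doubleMk_eq_iff {x y : H ⊗[k] Dual k H} :
    doubleMk S x = doubleMk S y ↔ bowtieProj S x = bowtieProj S y := by
  refine (Submodule.Quotient.eq _).trans ?_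
  rw [LinearMap.mem_ker, map_sub, sub_eq_zero]

/-- Multiplication by an element of `H` on the left of `H ⋈ H*`. -/
def bowtieLeft (h : H) : H ⊗[k] Dual k H →ₗ[k] H ⊗[k] Dual k H :=
  (LinearMap.mulLeft k h).rTensor (Dual k H)

/-- Multiplication by an element of `H*` on the right of `H ⋈ H*`. -/
def bowtieRight (ψ : Dual k H) : H ⊗[k] Dual k H →ₗ[k] H ⊗[k] Dual k H :=
  (dualMul k H ∘ₗ (TensorProduct.mk k (Dual k H) (Dual k H)).flip ψ).lTensor H

theorem bowtieLeft_tmul (h l : H) (φ : Dual k H) :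
    bowtieLeft h (l ⊗ₜ[k] φ) = (h * l) ⊗ₜ[k] φ := rfl

theorem bowtieRight_tmul (h : H) (φ ψ : Dual k H) :
    bowtieRight ψ (h ⊗ₜ[k] φ) = h ⊗ₜ[k] dualMul k H (φ ⊗ₜ[k] ψ) := rfl

theorem bowtieMul_bowtieLeft (h : H) (x y : H ⊗[k] Dual k H) :
    bowtieMul S (bowtieLeft h x) y = bowtieLeft h (bowtieMul S x y) := by
  induction x with
  | zero => simp
  | add x x' hx hx' => simp only [map_add, LinearMap.add_apply, hx, hx']
  | tmul l φ =>
  induction y with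
  | zero => simp
  | add y y' hy hy' => simp only [map_add, hy, hy']
  | tmul m ψ =>
    simp only [bowtieLeft_tmul, bowtieMul_tmul, map_sw, mul_assoc]

theorem bowtieMul_bowtieRight (χ : Dual k H) (x y : H ⊗[k] Dual k H) :
    bowtieMul S x (bowtieRight χ y) = bowtieRight χ (bowtieMul S x y) := by
  induction x with
  | zero => simp
  | add x x' hx hx' => simp only [map_add, LinearMap.add_apply, hx, hx']
  | tmul l φ =>
  induction y with
  | zero => simp
  | add y y' hy hy' => simp only [map_add, hy, hy']
  | tmul m ψ =>
    simp only [bowtieRight_tmul, bowtieMul_tmul, map_sw, dualMul_assoc]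

namespace IsWeakHopfAlgebra

variable (hH : IsWeakHopfAlgebra k H S.toLinearMap)
include hH

theorem bowtieProj_bowtieLeft (h : H) (x : H ⊗[k] Dual k H) :
    bowtieProj S (bowtieLeft h x) = bowtieLeft h (bowtieProj S x) := by
  rw [← hH.bowtieMul_one_eq_bowtieProj, bowtieMul_bowtieLeft, hH.bowtieMul_one_eq_bowtieProj]

theorem bowtieProj_bowtieRight (χ : Dual k H) (x : H ⊗[k] Dual k H) :
    bowtieProj S (bowtieRight χ x) = bowtieRight χ (bowtieProj S x) :=
  bowtieMul_bowtieRight _ _ _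

theorem doubleMk_bowtieProj (x : H ⊗[k] Dual k H) :
    doubleMk S (bowtieProj S x) = doubleMk S x := by
  rw [doubleMk_eq_iff, hH.bowtieProj_bowtieProj]

theorem bowtieMul_mem_ker_left {x : H ⊗[k] Dual k H} (hx : x ∈ LinearMap.ker (bowtieProj S))
    (y : H ⊗[k] Dual k H) : bowtieMul S x y ∈ LinearMap.ker (bowtieProj S) := by
  rw [LinearMap.mem_ker] at hx ⊢
  rw [hH.bowtieProj_bowtieMul, hx, map_zero, LinearMap.zero_apply]

theorem bowtieMul_mem_ker_right (x : H ⊗[k] Dual k H) {y : H ⊗[k] Dual k H}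
    (hy : y ∈ LinearMap.ker (bowtieProj S)) : bowtieMul S x y ∈ LinearMap.ker (bowtieProj S) := by
  rw [LinearMap.mem_ker] at hy ⊢
  rw [hH.bowtieProj_bowtieMul', hy, map_zero]

/-- The multiplication of the Drinfeld double. -/
def doubleMul : DrinfeldDouble S →ₗ[k] DrinfeldDouble S →ₗ[k] DrinfeldDouble S :=
  ((LinearMap.ker (bowtieProj S)).liftQ
    ((LinearMap.ker (bowtieProj S)).liftQ ((bowtieMul S).compr₂ (doubleMk S))
      fun _ hx => LinearMap.ext fun y =>
        (Submodule.Quotient.mk_eq_zero _).2 (hH.bowtieMul_mem_ker_left hx y)).flip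
    fun _ hy => LinearMap.ext fun x => by
      obtain ⟨x, rfl⟩ := doubleMk_surjective S x
      exact (Submodule.Quotient.mk_eq_zero _).2 (hH.bowtieMul_mem_ker_right x hy)).flip

theorem doubleMul_doubleMk (x y : H ⊗[k] Dual k H) :
    hH.doubleMul (doubleMk S x) (doubleMk S y) = doubleMk S (bowtieMul S x y) := rfl

/-- The ring structure of the Drinfeld double. -/
@[reducible] def doubleRing : Ring (DrinfeldDouble S) :=
  { doubleAddCommGroup S with
    mul := fun x y => hH.doubleMul x y
    one := doubleMk S (1 ⊗ₜ[k] ε)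
    left_distrib := fun x y z => map_add _ y z
    right_distrib := fun x y z => by
      change hH.doubleMul (x + y) z = _
      rw [map_add]; rfl
    zero_mul := fun x => by
      change hH.doubleMul 0 x = _
      rw [map_zero]; rfl
    mul_zero := fun x => map_zero _
    mul_assoc := by
      intro x y z
      obtain ⟨x, rfl⟩ := doubleMk_surjective S x
      obtain ⟨y, rfl⟩ := doubleMk_surjective S y
      obtain ⟨z, rfl⟩ := doubleMk_surjective S z
      exact congrArg (doubleMk S) (hH.bowtieMul_assoc x y z)
    one_mul := by
      intro x
      obtain ⟨x, rfl⟩ := doubleMk_surjective S x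
      exact hH.doubleMk_bowtieProj x
    mul_one := by
      intro x
      obtain ⟨x, rfl⟩ := doubleMk_surjective S x
      exact (congrArg (doubleMk S) (hH.bowtieMul_one_eq_bowtieProj x)).trans
        (hH.doubleMk_bowtieProj x) }

/-- The algebra structure of the Drinfeld double. -/
@[reducible] def doubleAlgebra : @Algebra k (DrinfeldDouble S) _ hH.doubleRing.toSemiring :=
  letI := hH.doubleRing
  Algebra.ofModule (fun c x y => by
    change hH.doubleMul (c • x) y = _
    rw [map_smul]; rfl) (fun c x y => map_smul (hH.doubleMul x) c y)

/-- The expansion of `Δ²(1)` is chosen so that `y` stands next to a first leg of `Δ(1)` whose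
partner acts on `φ` from the right; there `y` reappears as `S⁻¹(y)`. For elements of `H_t` the other
expansion plays this role. -/
theorem doubleMk_mul_source (h : H) {y : H} (hy : IsSource k y) (φ : Dual k H) :
    doubleMk S ((h * y) ⊗ₜ[k] φ) = doubleMk S (h ⊗ₜ[k] dualAct k H 1 (S.symm y) φ) := by
  rw [doubleMk_eq_iff, hH.bowtieProj_tmul, hH.bowtieProj_tmul,
    hH.sw_one' fun a b c => (h * y * b) ⊗ₜ[k] dualAct k H (S.symm a) c φ,
    hH.sw_one' fun a b c => (h * b) ⊗ₜ[k]
      dualAct k H (S.symm a) c (dualAct k H 1 (S.symm y) φ)]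
  refine sw_congr _ fun a b => ?_
  have := hH.sw_one_source_mul hy fun c d => (h * (c * b)) ⊗ₜ[k] dualAct k H (S.symm a) d φ
  simpa only [dualAct_dualAct, mul_one, mul_assoc] using this

theorem doubleMk_mul_target (h : H) {z : H} (hz : IsTarget k z) (φ : Dual k H) :
    doubleMk S ((h * z) ⊗ₜ[k] φ) = doubleMk S (h ⊗ₜ[k] dualAct k H z 1 φ) := by
  rw [doubleMk_eq_iff, hH.bowtieProj_tmul, hH.bowtieProj_tmul,
    hH.sw_one fun a b c => (h * z * b) ⊗ₜ[k] dualAct k H (S.symm a) c φ,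
    hH.sw_one fun a b c => (h * b) ⊗ₜ[k]
      dualAct k H (S.symm a) c (dualAct k H z 1 φ)]
  refine (sw_comm _ _ _).trans (Eq.trans (sw_congr _ fun c d => ?_) (sw_comm _ _ _))
  have := hH.sw_one_target_mul hz fun a b => (h * (b * c)) ⊗ₜ[k] dualAct k H (S.symm a) d φ
  simpa only [dualAct_dualAct, one_mul, mul_assoc, hH.symm_mul, LinearEquiv.symm_apply_apply,
    LinearEquiv.coe_coe] using this

end IsWeakHopfAlgebra

/-- An algebra `D` containing images of `H` and `H*` which satisfy the relations of the Drinfeld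
double. -/
structure IsDoubleAlgebra (S : H ≃ₗ[k] H) {D : Type*} [Ring D] [Algebra k D] (i : H →ₗ[k] D)
    (j : Dual k H →ₗ[k] D) : Prop where
  i_one : i 1 = 1
  i_mul : ∀ h l, i (h * l) = i h * i l
  j_counit : j ε = 1
  j_mul : ∀ φ ψ, j (dualMul k H (φ ⊗ₜ[k] ψ)) = j φ * j ψ
  j_mul_i : ∀ φ l, j φ * i l =
    sw k l fun a b => sw k b fun c d => i c * j (dualAct k H (S.symm a) d φ)
  i_source : ∀ y, IsSource k y → i y = j (dualAct k H 1 (S.symm y) ε)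
  i_target : ∀ z, IsTarget k z → i z = j (dualAct k H z 1 ε)

end DoubleAlgebra

/-! ### Linear maps out of the Drinfeld double -/

section Lift

variable {k H M : Type*} [CommRing k] [Ring H] [Algebra k H] [Coalgebra k H] {S : H ≃ₗ[k] H}
  [AddCommMonoid M] [Module k M]

local notation "ε" => (counit : H →ₗ[k] k)

attribute [local instance] doubleAddCommGroup doubleModule

/-- Linear maps on `H ⋈ H*` which are balanced over `H_s` and `H_t`. -/
structure Balanced (S : H ≃ₗ[k] H) (f : H ⊗[k] Dual k H →ₗ[k] M) : Prop where
  source : ∀ h y φ, IsSource k y → f ((h * y) ⊗ₜ[k] φ) = f (h ⊗ₜ[k] dualAct k H 1 (S.symm y) φ)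
  target : ∀ h z φ, IsTarget k z → f ((h * z) ⊗ₜ[k] φ) = f (h ⊗ₜ[k] dualAct k H z 1 φ)

namespace IsWeakHopfAlgebra

variable (hH : IsWeakHopfAlgebra k H S.toLinearMap)
include hH

theorem sw_one_mul_symm : (sw k (1 : H) fun a b => b * S.symm a) = 1 := by
  rw [hH.sw_mul_symm, hH.sourceMapOp_one]

theorem sw_targetMapOp_left (h : H) (F : H → H → M)
    (h₁ : ∀ b, Lin k fun a => F a b := by intros; fun_prop)
    (h₂ : ∀ a, Lin k fun b => F a b := by intros; fun_prop) :
    (sw k h fun a b => F (targetMapOp k H a) b) =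
      sw k (1 : H) fun a b => F (S.symm a) (h * b) := by
  simp only [targetMapOp_apply, lin_map_sw (h₁ _), (h₁ _).map_smul]
  rw [sw_comm]
  simp only [hH.sw_counit_left_mul h _ (fun x => F _ x) (h₂ _)]
  rw [← hH.sw_one_flip_symm fun a b => F b (h * targetMap k H a)]
  simp only [← hH.targetMapOp_eq]
  exact hH.sw_one_targetMapOp_right fun a b => F (S.symm a) (h * b)

/-- When `Δ²(1)` is written with two copies of `Δ(1)`, the factors in the middle leg lie in `H_s`
and `H_t`. Balancing carries them over to `H*`, where they meet their partners in the form
`1₍₂₎S⁻¹(1₍₁₎) = 1`. Thus `f(x)` depends only on `p(x)`. -/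
theorem balanced_bowtieProj {f : H ⊗[k] Dual k H →ₗ[k] M} (hf : Balanced S f)
    (x : H ⊗[k] Dual k H) : f (bowtieProj S x) = f x := by
  induction x with
  | zero => simp
  | add x y hx hy => simp only [map_add, hx, hy]
  | tmul h φ =>
    simp only [hH.bowtieProj_tmul, map_sw]
    rw [hH.sw_one fun a b c => f ((h * b) ⊗ₜ[k] dualAct k H (S.symm a) c φ)]
    calc _ = sw k (1 : H) fun a b => sw k (1 : H) fun c d =>
          f ((h * b) ⊗ₜ[k] dualAct k H (S.symm a) (d * S.symm c) φ) := by
          refine sw_congr _ fun a b => ?_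
          rw [← hH.sw_one_sourceMap_left fun c d =>
              f ((h * (b * c)) ⊗ₜ[k] dualAct k H (S.symm a) d φ),
            ← hH.sw_one_sourceMap_left fun c d =>
              f ((h * b) ⊗ₜ[k] dualAct k H (S.symm a) (d * S.symm c) φ)]
          simp only [← mul_assoc, hf.source _ _ _ (hH.isSource_sourceMap _), dualAct_dualAct,
            one_mul]
      _ = sw k (1 : H) fun a b => f ((h * b) ⊗ₜ[k] dualAct k H (S.symm a) 1 φ) := by
          simp only [← map_sw, ← sw_apply, ← tmul_sw, hH.sw_one_mul_symm]
      _ = sw k (1 : H) fun a b => f (h ⊗ₜ[k] dualAct k H (b * S.symm a) 1 φ) := by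
          rw [← hH.sw_one_targetMap_right fun a b =>
              f ((h * b) ⊗ₜ[k] dualAct k H (S.symm a) 1 φ),
            ← hH.sw_one_targetMap_right fun a b =>
              f (h ⊗ₜ[k] dualAct k H (b * S.symm a) 1 φ)]
          simp only [hf.target _ _ _ (hH.isTarget_targetMap _), dualAct_dualAct, one_mul]
      _ = _ := by
          simp only [← map_sw, ← sw_apply, ← tmul_sw, hH.sw_one_mul_symm, dualAct_one_one]

end IsWeakHopfAlgebra

end Lift

section LiftGroup

variable {k H M : Type*} [CommRing k] [Ring H] [Algebra k H] [Coalgebra k H] {S : H ≃ₗ[k] H}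
  [AddCommGroup M] [Module k M]

attribute [local instance] doubleAddCommGroup doubleModule

namespace IsWeakHopfAlgebra

variable (hH : IsWeakHopfAlgebra k H S.toLinearMap)

/-- The universal property of the Drinfeld double as a module. -/
def doubleLift (f : H ⊗[k] Dual k H →ₗ[k] M) (hf : Balanced S f) : DrinfeldDouble S →ₗ[k] M :=
  Submodule.liftQ _ f fun x hx => by
    rw [LinearMap.mem_ker] at hx ⊢
    rw [← hH.balanced_bowtieProj hf, hx, map_zero]

end IsWeakHopfAlgebra

end LiftGroup

/-! ### Consequences of the relations between the images of `H` and `H*` -/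

section DoubleAlgebra

variable {k H M : Type*} [CommRing k] [Ring H] [Algebra k H] [Coalgebra k H] {S : H ≃ₗ[k] H}
  [AddCommMonoid M] [Module k M]

local notation "ε" => (counit : H →ₗ[k] k)

namespace IsDoubleAlgebra

variable {D : Type*} [Ring D] [Algebra k D] {i : H →ₗ[k] D} {j : Dual k H →ₗ[k] D}
  (hD : IsDoubleAlgebra S i j) (hH : IsWeakHopfAlgebra k H S.toLinearMap)
include hD hH

theorem source_mul_j {y : H} (hy : IsSource k y) (φ : Dual k H) :
    i y * j φ = j (dualAct k H 1 (S.symm y) φ) := by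
  rw [hD.i_source y hy, ← hD.j_mul, hH.dualMul_dualAct_counit, targetMap_one,
    (hH.isTarget_symm hy).targetMapOp_eq]

theorem target_mul_j {z : H} (hz : IsTarget k z) (φ : Dual k H) :
    i z * j φ = j (dualAct k H z 1 φ) := by
  rw [hD.i_target z hz, ← hD.j_mul, hH.dualMul_dualAct_counit, hH.targetMapOp_one,
    hz.targetMap_eq]

theorem j_mul_source (φ : Dual k H) {y : H} (hy : IsSource k y) :
    j φ * i y = j (dualAct k H 1 y φ) := by
  rw [hD.i_source y hy, ← hD.j_mul, hH.dualMul_counit_dualAct_left,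
    hH.sourceMap_target (hH.isTarget_symm hy)]
  simp

theorem j_mul_target (φ : Dual k H) {z : H} (hz : IsTarget k z) :
    j φ * i z = j (dualAct k H (S.symm z) 1 φ) := by
  rw [hD.i_target z hz, ← hD.j_mul, hH.dualMul_counit_dualAct_right, hH.symm_target hz]

/-- Because `j(ε) = 1`, the element `i(y)` can also be multiplied by `j(ε)` on its left. So `ε ↼ y`
and `ε ↼ S⁻¹(y)` have the same image under `j`. -/
theorem i_source' {y : H} (hy : IsSource k y) : i y = j (dualAct k H 1 y ε) := by
  rw [← hD.j_mul_source hH _ hy, hD.j_counit, one_mul]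

/-- `i(1₍₂₎) ⊗ i(1₍₁₎) = j(ε₍₁₎) ⊗ j(ε₍₂₎)` -/
theorem sw_one_i (F : D → D → M)
    (h₁ : ∀ b, Lin k fun a => F a b := by intros; fun_prop)
    (h₂ : ∀ a, Lin k fun b => F a b := by intros; fun_prop) :
    (sw k (1 : H) fun a b => F (i b) (i a)) =
      sw k (1 : H) fun a b => F (j (dualAct k H b 1 ε)) (j (dualAct k H 1 a ε)) := by
  rw [← hH.sw_one_sourceMap_left fun a b => F (i b) (i a),
    ← hH.sw_one_targetMap_right fun a b => F (i b) (i (sourceMap k H a)),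
    ← hH.sw_one_sourceMap_left fun a b => F (j (dualAct k H b 1 ε)) (j (dualAct k H 1 a ε)),
    ← hH.sw_one_targetMap_right fun a b =>
      F (j (dualAct k H b 1 ε)) (j (dualAct k H 1 (sourceMap k H a) ε))]
  simp only [hD.i_target _ (hH.isTarget_targetMap _), hD.i_source' hH (hH.isSource_sourceMap _)]

/-- `i(h₍₁₎) j(φ ↼ ε(h₍₂₎ 1₍₁₎) 1₍₂₎) = i(h) j(φ)` -/
theorem sw_i_mul_j_targetMapOp_right (h : H) (φ : Dual k H) :
    (sw k h fun a b => i a * j (dualAct k H 1 (targetMapOp k H b) φ)) = i h * j φ := by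
  rw [hH.sw_targetMapOp_right h fun a b => i a * j (dualAct k H 1 b φ),
    ← hH.sw_one_sourceMap_left fun a b => i (h * a) * j (dualAct k H 1 b φ)]
  simp only [hD.i_mul, mul_assoc, hD.source_mul_j hH (hH.isSource_sourceMap _), dualAct_dualAct,
    one_mul]
  rw [hH.sw_one_sourceMap_left fun a b => i h * j (dualAct k H 1 (b * S.symm a) φ)]
  simp only [← mul_sw, ← map_sw, ← sw_apply, hH.sw_one_mul_symm, dualAct_one_one]

/-- `i(h₍₂₎) j(ε(h₍₁₎ 1₍₁₎) 1₍₂₎ ⇀ φ) = i(h) j(φ)` -/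
theorem sw_i_mul_j_targetMapOp_left (h : H) (φ : Dual k H) :
    (sw k h fun a b => i b * j (dualAct k H (targetMapOp k H a) 1 φ)) = i h * j φ := by
  rw [hH.sw_targetMapOp_left h fun a b => i b * j (dualAct k H a 1 φ),
    ← hH.sw_one_targetMap_right fun a b => i (h * b) * j (dualAct k H (S.symm a) 1 φ)]
  simp only [hD.i_mul, mul_assoc, hD.target_mul_j hH (hH.isTarget_targetMap _), dualAct_dualAct,
    mul_one]
  rw [hH.sw_one_targetMap_right fun a b => i h * j (dualAct k H (b * S.symm a) 1 φ)]
  simp only [← mul_sw, ← map_sw, ← sw_apply, hH.sw_one_mul_symm, dualAct_one_one]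

end IsDoubleAlgebra

end DoubleAlgebra

/-! ### The relations in the Drinfeld double -/

section Relations

variable {k H : Type*} [CommRing k] [Ring H] [Algebra k H] [Coalgebra k H] (S : H ≃ₗ[k] H)

local notation "ε" => (counit : H →ₗ[k] k)

attribute [local instance] doubleAddCommGroup doubleModule

/-- The map `H → D(H)`, `h ↦ [h ⋈ ε]`. -/
def doubleInl : H →ₗ[k] DrinfeldDouble S :=
  doubleMk S ∘ₗ (TensorProduct.mk k H (Dual k H)).flip ε

/-- The map `H* → D(H)`, `φ ↦ [1 ⋈ φ]`. -/
def doubleInr : Dual k H →ₗ[k] DrinfeldDouble S :=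
  doubleMk S ∘ₗ TensorProduct.mk k H (Dual k H) 1

variable {S}

theorem doubleInl_apply (h : H) : doubleInl S h = doubleMk S (h ⊗ₜ[k] ε) := rfl

theorem doubleInr_apply (φ : Dual k H) : doubleInr S φ = doubleMk S (1 ⊗ₜ[k] φ) := rfl

namespace IsWeakHopfAlgebra

variable (hH : IsWeakHopfAlgebra k H S.toLinearMap)
include hH

/-- The left factor is `h` times the preunit, so the product is `h` times `p(l ⋈ ψ)`, and `p` is
invisible in the quotient. -/
theorem bowtieMul_inl (h l : H) (ψ : Dual k H) :
    doubleMk S (bowtieMul S (h ⊗ₜ[k] ε) (l ⊗ₜ[k] ψ)) = doubleMk S ((h * l) ⊗ₜ[k] ψ) := by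
  have : (h ⊗ₜ[k] ε : H ⊗[k] Dual k H) = bowtieLeft h (1 ⊗ₜ[k] ε) := by
    rw [bowtieLeft_tmul, mul_one]
  rw [this, bowtieMul_bowtieLeft]
  change doubleMk S (bowtieLeft h (bowtieProj S _)) = _
  rw [← hH.bowtieProj_bowtieLeft, hH.doubleMk_bowtieProj, bowtieLeft_tmul]

theorem bowtieMul_inr (h : H) (φ ψ : Dual k H) :
    doubleMk S (bowtieMul S (h ⊗ₜ[k] φ) (1 ⊗ₜ[k] ψ)) =
      doubleMk S (h ⊗ₜ[k] dualMul k H (φ ⊗ₜ[k] ψ)) := by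
  have : ((1 : H) ⊗ₜ[k] ψ : H ⊗[k] Dual k H) = bowtieRight ψ (1 ⊗ₜ[k] ε) := by
    rw [bowtieRight_tmul, dualMul_counit_left]
  rw [this, bowtieMul_bowtieRight, hH.bowtieMul_one_eq_bowtieProj,
    ← hH.bowtieProj_bowtieRight, hH.doubleMk_bowtieProj, bowtieRight_tmul]

theorem doubleMul_inl_inr (h : H) (φ : Dual k H) :
    hH.doubleMul (doubleInl S h) (doubleInr S φ) = doubleMk S (h ⊗ₜ[k] φ) := by
  rw [doubleInl_apply, doubleInr_apply, hH.doubleMul_doubleMk, hH.bowtieMul_inl, mul_one]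

theorem doubleMul_inr_inl (φ : Dual k H) (l : H) :
    hH.doubleMul (doubleInr S φ) (doubleInl S l) =
      sw k l fun a b => sw k b fun c d => doubleMk S (c ⊗ₜ[k] dualAct k H (S.symm a) d φ) := by
  rw [doubleInl_apply, doubleInr_apply, hH.doubleMul_doubleMk, bowtieMul_tmul]
  simp only [map_sw, dualMul_counit_right, one_mul]

theorem isDoubleAlgebra :
    letI := hH.doubleRing
    letI := hH.doubleAlgebra
    IsDoubleAlgebra S (doubleInl S) (doubleInr S) := by
  let _ := hH.doubleRing
  let _ := hH.doubleAlgebra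
  exact
  { i_one := rfl
    i_mul := fun h l => (hH.bowtieMul_inl h l ε).symm
    j_counit := rfl
    j_mul := fun φ ψ => (hH.bowtieMul_inr 1 φ ψ).symm
    j_mul_i := fun φ l => (hH.doubleMul_inr_inl φ l).trans <|
      sw_congr _ fun a b => sw_congr _ fun c d => (hH.doubleMul_inl_inr _ _).symm
    i_source := fun y hy => by
      have := hH.doubleMk_mul_source 1 hy ε
      rwa [one_mul] at this
    i_target := fun z hz => by
      have := hH.doubleMk_mul_target 1 hz ε
      rwa [one_mul] at this }

end IsWeakHopfAlgebra

end Relations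

/-! ### The comultiplication of the Drinfeld double -/

/-- Two bracketings of the sixfold coproduct; the second isolates the third and fourth legs, which
are contracted in `deltaInr_mul_deltaInl`. -/
theorem sw_assoc_six {k C M : Type*} [CommRing k] [AddCommMonoid C] [Module k C] [Coalgebra k C]
    [AddCommMonoid M] [Module k M] (l : C) (G : C → C → C → C → C → C → M)
    (h₁ : ∀ b c d e f, Lin k fun a => G a b c d e f := by intros; fun_prop)
    (h₂ : ∀ a c d e f, Lin k fun b => G a b c d e f := by intros; fun_prop)
    (h₃ : ∀ a b d e f, Lin k fun c => G a b c d e f := by intros; fun_prop)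
    (h₄ : ∀ a b c e f, Lin k fun d => G a b c d e f := by intros; fun_prop)
    (h₅ : ∀ a b c d f, Lin k fun e => G a b c d e f := by intros; fun_prop)
    (h₆ : ∀ a b c d e, Lin k fun f => G a b c d e f := by intros; fun_prop) :
    (sw k l fun a b => sw k a fun p y => sw k y fun c d => sw k b fun q z => sw k z fun e f =>
      G p c d q e f) =
    sw k l fun p m => sw k m fun x w => sw k w fun e f => sw k x fun c u => sw k u fun d q =>
      G p c d q e f := by
  refine (sw_assoc l fun p y b => sw k y fun c d => sw k b fun q z => sw k z fun e f =>
      G p c d q e f).trans (sw_congr _ fun p m => ?_)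
  refine (sw_assoc_four m fun c d q z => sw k z fun e f => G p c d q e f).trans ?_
  refine (sw_assoc m fun c u w => sw k u fun d q => sw k w fun e f => G p c d q e f).symm.trans
    (sw_congr _ fun x w => ?_)
  rw [sw_comm (k := k) w]
  refine sw_congr _ fun c u => sw_comm _ _ _

section Delta

variable {k H : Type*} [CommRing k] [Ring H] [Algebra k H] [Coalgebra k H]
  [Module.Finite k H] [Module.Projective k H] {S : H ≃ₗ[k] H}
  {D : Type*} [Ring D] [Algebra k D] (i : H →ₗ[k] D) (j : Dual k H →ₗ[k] D)

local notation "ε" => (counit : H →ₗ[k] k)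

attribute [local instance] dualCoalgebra

/-- `h ↦ i(h₍₂₎) ⊗ i(h₍₁₎)` -/
def deltaInl : H →ₗ[k] D ⊗[k] D := map i i ∘ₗ (comm k H H).toLinearMap ∘ₗ comul

/-- `φ ↦ j(φ₍₁₎) ⊗ j(φ₍₂₎)` -/
def deltaInr : Dual k H →ₗ[k] D ⊗[k] D := map j j ∘ₗ comul

theorem deltaInl_apply (h : H) : deltaInl i h = sw k h fun a b => i b ⊗ₜ[k] i a := by
  simp [deltaInl, comul_eq_sw h, map_sw, equiv_map_sw]

theorem deltaInr_apply (φ : Dual k H) : deltaInr j φ = sw k φ fun α β => j α ⊗ₜ[k] j β := by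
  rw [deltaInr, LinearMap.comp_apply, comul_eq_sw φ, map_sw]
  rfl

variable {i j}

namespace IsDoubleAlgebra

variable (hD : IsDoubleAlgebra S i j) (hH : IsWeakHopfAlgebra k H S.toLinearMap)
include hD hH

theorem deltaInl_mul (h l : H) : deltaInl i (h * l) = deltaInl i h * deltaInl i l := by
  simp only [deltaInl_apply, sw_mul, mul_sw, Algebra.TensorProduct.tmul_mul_tmul, ← hD.i_mul]
  rw [hH.sw_mul_arg h l fun a b => i b ⊗ₜ[k] i a, sw_comm]

theorem deltaInr_mul (φ ψ : Dual k H) :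
    deltaInr j (dualMul k H (φ ⊗ₜ[k] ψ)) = deltaInr j φ * deltaInr j ψ := by
  simp only [deltaInr_apply, sw_mul, mul_sw, Algebra.TensorProduct.tmul_mul_tmul, ← hD.j_mul]
  rw [hH.sw_dualMul φ ψ fun a b => j a ⊗ₜ[k] j b, sw_comm]

theorem deltaInr_counit : deltaInr j ε = deltaInl i 1 := by
  rw [deltaInr_apply, deltaInl_apply, hH.sw_dual_counit fun α β => j α ⊗ₜ[k] j β,
    hD.sw_one_i hH fun p q => p ⊗ₜ[k] q]

theorem deltaInl_source {y : H} (hy : IsSource k y) :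
    deltaInl i y = deltaInr j (dualAct k H 1 (S.symm y) ε) := by
  rw [deltaInr_apply, deltaInl_apply, hy.sw_left fun a b => i b ⊗ₜ[k] i a,
    sw_dualAct ε 1 (S.symm y) fun α β => j α ⊗ₜ[k] j β,
    hH.sw_dual_counit fun α β => j (dualAct k H 1 (S.symm y) α) ⊗ₜ[k] j (dualAct k H 1 1 β)]
  simp only [hD.i_mul]
  rw [hD.sw_one_i hH fun p q => (i y * p) ⊗ₜ[k] q]
  simp only [hD.source_mul_j hH hy, dualAct_one_one]

theorem deltaInl_target {z : H} (hz : IsTarget k z) :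
    deltaInl i z = deltaInr j (dualAct k H z 1 ε) := by
  rw [deltaInr_apply, deltaInl_apply, hz.sw_left fun a b => i b ⊗ₜ[k] i a,
    sw_dualAct ε z 1 fun α β => j α ⊗ₜ[k] j β,
    hH.sw_dual_counit fun α β => j (dualAct k H 1 1 α) ⊗ₜ[k] j (dualAct k H z 1 β)]
  simp only [hD.i_mul]
  rw [hD.sw_one_i hH fun p q => p ⊗ₜ[k] (i z * q)]
  simp only [hD.target_mul_j hH hz, dualAct_one_one]

theorem deltaInl_source_mul {y : H} (hy : IsSource k y) (φ : Dual k H) :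
    deltaInl i y * deltaInr j φ = deltaInr j (dualAct k H 1 (S.symm y) φ) := by
  rw [hD.deltaInl_source hH hy, ← hD.deltaInr_mul hH, hH.dualMul_dualAct_counit, targetMap_one,
    (hH.isTarget_symm hy).targetMapOp_eq]

theorem deltaInl_target_mul {z : H} (hz : IsTarget k z) (φ : Dual k H) :
    deltaInl i z * deltaInr j φ = deltaInr j (dualAct k H z 1 φ) := by
  rw [hD.deltaInl_target hH hz, ← hD.deltaInr_mul hH, hH.dualMul_dualAct_counit,
    hH.targetMapOp_one, hz.targetMap_eq]

/-- This compatibility with the exchange relation is the core of the multiplicativity of `Δ`. Six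
legs of `l` occur on the left; after an inner factor crosses between the legs of `φ`, the third and
fourth meet as `S⁻¹(l₍₄₎)l₍₃₎`. This lies in `H_t`, and the neighbouring leg of `l` absorbs it. -/
theorem deltaInr_mul_deltaInl (φ : Dual k H) (l : H) :
    deltaInr j φ * deltaInl i l = sw k l fun a b => sw k b fun c d =>
      deltaInl i c * deltaInr j (dualAct k H (S.symm a) d φ) := by
  have mid (p' d' p d c c' : H) : (sw k φ fun α β =>
      (i c * j (dualAct k H (S.symm p) d α)) ⊗ₜ[k] (i c' * j (dualAct k H (S.symm p') d' β))) =
      sw k φ fun α β => (i c * j (dualAct k H 1 d α)) ⊗ₜ[k]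
        (i c' * j (dualAct k H (S.symm p') (S.symm p * d') β)) := by
    have := sw_dualAct_mid φ (S.symm p) fun α β =>
      (i c * j (dualAct k H 1 d α)) ⊗ₜ[k] (i c' * j (dualAct k H (S.symm p') d' β))
    simpa only [dualAct_dualAct, one_mul, mul_one] using this
  have lhs : deltaInr j φ * deltaInl i l = sw k φ fun α β => sw k l fun a b =>
      sw k a fun p' y' => sw k y' fun c' d' => sw k b fun p y => sw k y fun c d =>
        (i c * j (dualAct k H (S.symm p) d α)) ⊗ₜ[k] (i c' * j (dualAct k H (S.symm p') d' β)) := by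
    simp only [deltaInr_apply, deltaInl_apply, sw_mul, mul_sw, Algebra.TensorProduct.tmul_mul_tmul,
      hD.j_mul_i, sw_tmul, tmul_sw]
    exact sw_comm _ _ _
  have rhs : (sw k l fun a b => sw k b fun c d =>
      deltaInl i c * deltaInr j (dualAct k H (S.symm a) d φ)) =
      sw k φ fun α β => sw k l fun p m => sw k m fun x w => sw k w fun c d =>
        (i c * j (dualAct k H 1 d α)) ⊗ₜ[k] (i x * j (dualAct k H (S.symm p) 1 β)) := by
    have (a d : H) : deltaInr j (dualAct k H (S.symm a) d φ) = sw k φ fun α β =>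
        j (dualAct k H 1 d α) ⊗ₜ[k] j (dualAct k H (S.symm a) 1 β) := by
      rw [deltaInr_apply, sw_dualAct φ (S.symm a) d fun α β => j α ⊗ₜ[k] j β]
    simp only [this, deltaInl_apply, sw_mul, mul_sw, Algebra.TensorProduct.tmul_mul_tmul,
      sw_comm (h' := φ)]
    refine sw_congr _ fun α β => sw_congr _ fun p m => ?_
    exact sw_assoc m fun e f d =>
      (i f * j (dualAct k H 1 d α)) ⊗ₜ[k] (i e * j (dualAct k H (S.symm p) 1 β))
  rw [lhs, rhs]
  simp only [sw_comm (h := φ), mid]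
  rw [sw_assoc_six l fun p' c' d' p c d => sw k φ fun α β => (i c * j (dualAct k H 1 d α)) ⊗ₜ[k]
        (i c' * j (dualAct k H (S.symm p') (S.symm p * d') β))]
  simp only [sw_comm (h' := φ)]
  refine sw_congr _ fun α β => sw_congr _ fun p m => sw_congr _ fun x w => sw_congr _ fun c d => ?_
  rw [← hD.sw_i_mul_j_targetMapOp_right hH x]
  simp only [← hH.sw_symm_mul, dualAct_dualAct, one_mul, map_sw, sw_apply, mul_sw, tmul_sw]

end IsDoubleAlgebra

end Delta

/-! ### Contraction of one leg of a coproduct in `H*` -/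

section DualContraction

variable {k H M : Type*} [CommRing k] [Ring H] [Algebra k H] [Module.Finite k H]
  [Module.Projective k H] [AddCommMonoid M] [Module k M]

attribute [local instance] dualCoalgebra

theorem sw_dual_left_smul (φ : Dual k H) (u : H) (F : Dual k H → M)
    (hF : Lin k F := by intros; fun_prop) :
    (sw k φ fun α β => α u • F β) = F (dualAct k H 1 u φ) := by
  have : dualAct k H 1 u φ = sw k φ fun α β => α u • β := by
    ext v
    simp only [dualAct_apply, mul_one, sw_apply, LinearMap.smul_apply, smul_eq_mul, sw_dual_eval]
  rw [this, lin_map_sw hF]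
  exact sw_congr _ fun α β => (hF.map_smul _ _).symm

theorem sw_dual_right_smul (φ : Dual k H) (u : H) (F : Dual k H → M)
    (hF : Lin k F := by intros; fun_prop) :
    (sw k φ fun α β => β u • F α) = F (dualAct k H u 1 φ) := by
  have : dualAct k H u 1 φ = sw k φ fun α β => β u • α := by
    ext v
    simp only [dualAct_apply, one_mul, sw_apply, LinearMap.smul_apply, smul_eq_mul, mul_comm,
      sw_dual_eval]
  rw [this, lin_map_sw hF]
  exact sw_congr _ fun α β => (hF.map_smul _ _).symm

end DualContraction

/-! ### The coalgebra structure of the Drinfeld double -/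

section DoubleCoalgebra

variable {k H : Type*} [CommRing k] [Ring H] [Algebra k H] [Coalgebra k H] {S : H ≃ₗ[k] H}

local notation "ε" => (counit : H →ₗ[k] k)

attribute [local instance] doubleAddCommGroup doubleModule

variable (k H) in
/-- `h ⋈ φ ↦ ⟨φ, ε(h 1₍₁₎) 1₍₂₎⟩` -/
def bowtieCounit : H ⊗[k] Dual k H →ₗ[k] k :=
  contractRight k H ∘ₗ (targetMapOp k H).rTensor (Dual k H)

theorem bowtieCounit_tmul (h : H) (φ : Dual k H) :
    bowtieCounit k H (h ⊗ₜ[k] φ) = φ (targetMapOp k H h) := rfl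

namespace IsWeakHopfAlgebra

variable (hH : IsWeakHopfAlgebra k H S.toLinearMap)

-- `y1₍₁₎ ⊗ 1₍₂₎ = 1₍₁₎ ⊗ S⁻¹(y)1₍₂₎` moves `y` out of the counit. This and the next lemma are what
-- balances `bowtieCounit`.
include hH in
theorem targetMapOp_mul_source (h : H) {y : H} (hy : IsSource k y) :
    targetMapOp k H (h * y) = S.symm y * targetMapOp k H h := by
  simp only [targetMapOp_apply, mul_sw, mul_assoc]
  rw [hH.sw_one_source_mul hy fun a b => ε (h * a) • b]
  simp only [mul_smul_comm]

include hH in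
theorem targetMapOp_mul_target (h : H) {z : H} (hz : IsTarget k z) :
    targetMapOp k H (h * z) = targetMapOp k H h * z := by
  simp only [targetMapOp_apply, sw_mul, mul_assoc]
  -- The two forms of `Δ(z)` carry `z` from the left to the right of `1₍₁₎`. Under `ε` it may then
  -- become `S⁻¹(z)`, which crosses to the right of `1₍₂₎` as `z`.
  rw [← hz.sw_left fun a b => ε (h * a) • b, hz.sw_right fun a b => ε (h * a) • b]
  simp only [← mul_assoc]
  simp only [← hH.counit_mul_sourceMapOp _ z, ← hH.symm_target hz]
  simp only [mul_assoc]
  rw [← hH.sw_one_mul_target hz fun a b => ε (h * a) • b]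
  simp only [smul_mul_assoc]

include hH in
theorem balanced_bowtieCounit : Balanced S (bowtieCounit k H) where
  source h y φ hy := by
    simp only [bowtieCounit_tmul, hH.targetMapOp_mul_source h hy, dualAct_apply, mul_one]
  target h z φ hz := by
    simp only [bowtieCounit_tmul, hH.targetMapOp_mul_target h hz, dualAct_apply, one_mul]

/-- The counit of the Drinfeld double. -/
def doubleCounit : DrinfeldDouble S →ₗ[k] k :=
  hH.doubleLift (bowtieCounit k H) hH.balanced_bowtieCounit

theorem doubleCounit_tmul (h : H) (φ : Dual k H) :
    hH.doubleCounit (doubleMk S (h ⊗ₜ[k] φ)) = φ (targetMapOp k H h) := rfl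

variable [Module.Finite k H] [Module.Projective k H]

attribute [local instance] dualCoalgebra

omit hH in
theorem _root_.WeakHopf.doubleComul_tmul (h : H) (φ : Dual k H) : doubleComul k H (h ⊗ₜ[k] φ) =
    sw k h fun a b => sw k φ fun α β => (b ⊗ₜ[k] α) ⊗ₜ[k] (a ⊗ₜ[k] β) := by
  have : dualComul k H φ = sw k φ fun α β => α ⊗ₜ[k] β := comul_eq_sw φ
  simp only [doubleComul, LinearMap.comp_apply, TensorProduct.map_tmul, this, comul_eq_sw h,
    map_sw, sw_tmul, tmul_sw]
  rw [sw_comm]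
  rfl

-- In `D(H) ⊗ D(H)` the map is a product of a factor depending on `h` and a factor depending on `φ`.
-- Multiplicativity of the first reduces balancing to the relations with `h = 1`.
include hH in
theorem balanced_doubleComul :
    Balanced S (map (doubleMk S) (doubleMk S) ∘ₗ doubleComul k H) := by
  let _ := hH.doubleRing
  let _ := hH.doubleAlgebra
  have key (h : H) (φ : Dual k H) :
      (map (doubleMk S) (doubleMk S) ∘ₗ doubleComul k H) (h ⊗ₜ[k] φ) =
      deltaInl (doubleInl S) h * deltaInr (doubleInr S) φ := by
    simp only [LinearMap.comp_apply, doubleComul_tmul, map_sw, TensorProduct.map_tmul,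
      ← hH.doubleMul_inl_inr, deltaInl_apply, deltaInr_apply, mul_sw, sw_mul]
    rw [sw_comm]
    refine sw_congr _ fun α β => sw_congr _ fun a b => ?_
    exact (Algebra.TensorProduct.tmul_mul_tmul (doubleInl S b) (doubleInr S α) (doubleInl S a)
      (doubleInr S β)).symm
  have hD : IsDoubleAlgebra S (doubleInl S) (doubleInr S) := hH.isDoubleAlgebra
  constructor
  · intro h y φ hy
    rw [key, key, hD.deltaInl_mul hH, mul_assoc, hD.deltaInl_source_mul hH hy]
  · intro h z φ hz
    rw [key, key, hD.deltaInl_mul hH, mul_assoc, hD.deltaInl_target_mul hH hz]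

/-- The comultiplication of the Drinfeld double. -/
def doubleComulHom : DrinfeldDouble S →ₗ[k] DrinfeldDouble S ⊗[k] DrinfeldDouble S :=
  hH.doubleLift (map (doubleMk S) (doubleMk S) ∘ₗ doubleComul k H) hH.balanced_doubleComul

theorem doubleComulHom_doubleMk (x : H ⊗[k] Dual k H) :
    hH.doubleComulHom (doubleMk S x) = map (doubleMk S) (doubleMk S) (doubleComul k H x) := rfl

theorem doubleComulHom_tmul (h : H) (φ : Dual k H) :
    hH.doubleComulHom (doubleMk S (h ⊗ₜ[k] φ)) = sw k h fun a b => sw k φ fun α β =>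
      doubleMk S (b ⊗ₜ[k] α) ⊗ₜ[k] doubleMk S (a ⊗ₜ[k] β) := by
  simp only [doubleComulHom_doubleMk, doubleComul_tmul, map_sw, TensorProduct.map_tmul]

omit hH in
theorem _root_.WeakHopf.double_ext {M : Type*} [AddCommMonoid M] [Module k M]
    {f g : DrinfeldDouble S →ₗ[k] M}
    (h : ∀ h φ, f (doubleMk S (h ⊗ₜ[k] φ)) = g (doubleMk S (h ⊗ₜ[k] φ))) : f = g := by
  refine LinearMap.ext fun x => ?_
  obtain ⟨x, rfl⟩ := doubleMk_surjective S x
  induction x with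
  | zero => simp
  | add x y hx hy => simp only [map_add, hx, hy]
  | tmul a b => exact h a b

include hH in
theorem sw_mk_targetMapOp_right (h : H) (φ : Dual k H) :
    (sw k h fun a b => doubleMk S (a ⊗ₜ[k] dualAct k H 1 (targetMapOp k H b) φ)) =
      doubleMk S (h ⊗ₜ[k] φ) := by
  let _ := hH.doubleRing
  let _ := hH.doubleAlgebra
  have hD : IsDoubleAlgebra S (doubleInl S) (doubleInr S) := hH.isDoubleAlgebra
  simp only [← hH.doubleMul_inl_inr]
  exact hD.sw_i_mul_j_targetMapOp_right hH h φ

include hH in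
theorem sw_mk_targetMapOp_left (h : H) (φ : Dual k H) :
    (sw k h fun a b => doubleMk S (b ⊗ₜ[k] dualAct k H (targetMapOp k H a) 1 φ)) =
      doubleMk S (h ⊗ₜ[k] φ) := by
  let _ := hH.doubleRing
  let _ := hH.doubleAlgebra
  have hD : IsDoubleAlgebra S (doubleInl S) (doubleInr S) := hH.isDoubleAlgebra
  simp only [← hH.doubleMul_inl_inr]
  exact hD.sw_i_mul_j_targetMapOp_left hH h φ

/-- The coalgebra structure of the Drinfeld double. -/
@[reducible] def doubleCoalgebra : Coalgebra k (DrinfeldDouble S) where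
  comul := hH.doubleComulHom
  counit := hH.doubleCounit
  coassoc := by
    refine double_ext fun h φ => ?_
    simp only [LinearMap.comp_apply, doubleComulHom_tmul, map_sw, LinearMap.rTensor_tmul,
      LinearMap.lTensor_tmul, sw_tmul, tmul_sw, LinearEquiv.coe_coe,
      TensorProduct.assoc_tmul]
    calc _ = sw k h fun a b => sw k b fun c d => sw k φ fun α β => sw k β fun γ δ =>
          doubleMk S (d ⊗ₜ[k] α) ⊗ₜ[k] (doubleMk S (c ⊗ₜ[k] γ) ⊗ₜ[k] doubleMk S (a ⊗ₜ[k] δ)) :=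
          sw_congr _ fun a b => (sw_comm _ _ _).trans <| sw_congr _ fun c d =>
            sw_assoc φ fun α β γ => doubleMk S (d ⊗ₜ[k] α) ⊗ₜ[k]
              (doubleMk S (c ⊗ₜ[k] β) ⊗ₜ[k] doubleMk S (a ⊗ₜ[k] γ))
      _ = sw k h fun a b => sw k a fun c d => sw k φ fun α β => sw k β fun γ δ =>
          doubleMk S (b ⊗ₜ[k] α) ⊗ₜ[k] (doubleMk S (d ⊗ₜ[k] γ) ⊗ₜ[k] doubleMk S (c ⊗ₜ[k] δ)) :=
          (sw_assoc h fun a c d => sw k φ fun α β => sw k β fun γ δ =>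
            doubleMk S (d ⊗ₜ[k] α) ⊗ₜ[k]
              (doubleMk S (c ⊗ₜ[k] γ) ⊗ₜ[k] doubleMk S (a ⊗ₜ[k] δ))).symm
      _ = _ := sw_congr _ fun a b => sw_comm _ _ _
  rTensor_counit_comp_comul := by
    refine double_ext fun h φ => ?_
    simp only [LinearMap.comp_apply, doubleComulHom_tmul, map_sw, LinearMap.rTensor_tmul,
      doubleCounit_tmul]
    refine Eq.trans (sw_congr _ fun a b => ?_) (Eq.trans (tmul_sw h (fun a b =>
      doubleMk S (a ⊗ₜ[k] dualAct k H 1 (targetMapOp k H b) φ)) (1 : k)).symm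
      (congrArg (1 ⊗ₜ[k] ·) (hH.sw_mk_targetMapOp_right h φ)))
    rw [← sw_dual_left_smul φ (targetMapOp k H b) fun β => doubleMk S (a ⊗ₜ[k] β), tmul_sw]
    exact sw_congr _ fun α β => by rw [← TensorProduct.smul_tmul, smul_eq_mul, mul_one]
  lTensor_counit_comp_comul := by
    refine double_ext fun h φ => ?_
    simp only [LinearMap.comp_apply, doubleComulHom_tmul, map_sw, LinearMap.lTensor_tmul,
      doubleCounit_tmul]
    refine Eq.trans (sw_congr _ fun a b => ?_) (Eq.trans (sw_tmul h (fun a b =>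
      doubleMk S (b ⊗ₜ[k] dualAct k H (targetMapOp k H a) 1 φ)) (1 : k)).symm
      (congrArg (· ⊗ₜ[k] 1) (hH.sw_mk_targetMapOp_left h φ)))
    rw [← sw_dual_right_smul φ (targetMapOp k H a) fun β => doubleMk S (b ⊗ₜ[k] β), sw_tmul]
    exact sw_congr _ fun α β => by rw [TensorProduct.smul_tmul, smul_eq_mul, mul_one]

end IsWeakHopfAlgebra

end DoubleCoalgebra

/-! ### The weak bialgebra structure of the Drinfeld double -/

section DoubleBialgebra

variable {k H : Type*} [CommRing k] [Ring H] [Algebra k H] [Coalgebra k H]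
  [Module.Finite k H] [Module.Projective k H] {S : H ≃ₗ[k] H}
  {D : Type*} [Ring D] [Algebra k D] [Coalgebra k D] {i : H →ₗ[k] D} {j : Dual k H →ₗ[k] D}

local notation "ε" => (counit : H →ₗ[k] k)
local notation "εD" => (counit : D →ₗ[k] k)

attribute [local instance] dualCoalgebra

/-- An algebra and coalgebra `D` which is the product of images of `H` and `H*` satisfying the
relations of the Drinfeld double. -/
structure IsDouble (S : H ≃ₗ[k] H) (i : H →ₗ[k] D) (j : Dual k H →ₗ[k] D) : Prop
    extends IsDoubleAlgebra S i j where
  span_eq_top : Submodule.span k (Set.range fun p : H × Dual k H => i p.1 * j p.2) = ⊤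
  comul_i_mul_j : ∀ h φ, comul (R := k) (i h * j φ) = deltaInl i h * deltaInr j φ
  counit_i_mul_j : ∀ h φ, εD (i h * j φ) = φ (targetMapOp k H h)

namespace IsDouble

variable (hD : IsDouble S i j) (hH : IsWeakHopfAlgebra k H S.toLinearMap)
include hD

/-- A scalar in front of `i(h)j(φ)` can be absorbed into `h`, so closure under sums is enough. -/
theorem induction {P : D → Prop} (h_add : ∀ x y, P x → P y → P (x + y))
    (h_mul : ∀ h φ, P (i h * j φ)) (x : D) : P x := by
  have hx : x ∈ Submodule.span k (Set.range fun p : H × Dual k H => i p.1 * j p.2) := by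
    rw [hD.span_eq_top]; trivial
  suffices h : ∀ c : k, P (c • x) by simpa using h 1
  refine Submodule.span_induction (p := fun x _ => ∀ c : k, P (c • x)) ?_ ?_ ?_ ?_ hx
  · rintro _ ⟨p, rfl⟩ c
    simpa using h_mul (c • p.1) p.2
  · intro c
    simpa using h_mul 0 0
  · intro x y _ _ hx hy c
    rw [smul_add]
    exact h_add _ _ (hx c) (hy c)
  · intro a x _ hx c
    rw [smul_smul]
    exact hx _

theorem linearMap_ext {M : Type*} [AddCommMonoid M] [Module k M] {f g : D →ₗ[k] M}
    (h : ∀ h φ, f (i h * j φ) = g (i h * j φ)) : f = g :=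
  LinearMap.ext fun x => hD.induction (P := fun x => f x = g x)
    (fun x y hx hy => by rw [map_add, map_add, hx, hy]) h x

include hH

theorem comul_i (h : H) : comul (R := k) (i h) = deltaInl i h := by
  have := hD.comul_i_mul_j h ε
  rwa [hD.j_counit, mul_one, hD.deltaInr_counit hH, ← hD.deltaInl_mul hH, mul_one] at this

theorem comul_j (φ : Dual k H) : comul (R := k) (j φ) = deltaInr j φ := by
  have := hD.comul_i_mul_j 1 φ
  rwa [hD.i_one, one_mul, ← hD.deltaInr_counit hH, ← hD.deltaInr_mul hH, dualMul_counit_left]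
    at this

/-- In `i(h)j(φ)i(l)j(ψ)` only the middle pair is out of order; it is exchanged in `D`, and
correspondingly in `D ⊗ D`. -/
theorem comul_mul (x y : D) : comul (R := k) (x * y) = comul x * comul y := by
  revert x
  refine hD.induction (fun x x' hx hx' => by simp only [add_mul, map_add, hx, hx']) fun h φ => ?_
  revert y
  refine hD.induction (fun x x' hx hx' => by simp only [mul_add, map_add, hx, hx']) fun l ψ => ?_
  have e : i h * j φ * (i l * j ψ) = sw k l fun a b => sw k b fun c d =>
      i (h * c) * j (dualMul k H (dualAct k H (S.symm a) d φ ⊗ₜ[k] ψ)) := by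
    rw [mul_assoc, ← mul_assoc (j φ), hD.j_mul_i]
    simp only [sw_mul, mul_sw, hD.i_mul, hD.j_mul, mul_assoc]
  rw [e]
  simp only [map_sw, hD.comul_i_mul_j, hD.deltaInl_mul hH, hD.deltaInr_mul hH]
  rw [mul_assoc, ← mul_assoc (deltaInr j φ), hD.deltaInr_mul_deltaInl hH]
  simp only [sw_mul, mul_sw, mul_assoc]

section Sweedler

variable {M : Type*} [AddCommMonoid M] [Module k M]

theorem sw_i (h : H) (F : D → D → M)
    (h₁ : ∀ b, Lin k fun a => F a b := by intros; fun_prop)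
    (h₂ : ∀ a, Lin k fun b => F a b := by intros; fun_prop) :
    sw k (i h) F = sw k h fun a b => F (i b) (i a) := by
  rw [sw, hD.comul_i hH, deltaInl_apply]
  simp (disch := first | assumption | (intro; fun_prop) | fun_prop) only [sw_tsw, tsw_tmul]

theorem sw_j (φ : Dual k H) (F : D → D → M)
    (h₁ : ∀ b, Lin k fun a => F a b := by intros; fun_prop)
    (h₂ : ∀ a, Lin k fun b => F a b := by intros; fun_prop) :
    sw k (j φ) F = sw k φ fun α β => F (j α) (j β) := by
  rw [sw, hD.comul_j hH, deltaInr_apply]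
  simp (disch := first | assumption | (intro; fun_prop) | fun_prop) only [sw_tsw, tsw_tmul]

theorem sw_mul_arg (x y : D) (F : D → D → M)
    (h₁ : ∀ b, Lin k fun a => F a b := by intros; fun_prop)
    (h₂ : ∀ a, Lin k fun b => F a b := by intros; fun_prop) :
    sw k (x * y) F = sw k x fun a b => sw k y fun c d => F (a * c) (b * d) := by
  rw [sw, hD.comul_mul hH, comul_eq_sw x, comul_eq_sw y]
  simp only [sw_mul, mul_sw, Algebra.TensorProduct.tmul_mul_tmul]
  simp (disch := first | assumption | (intro; fun_prop) | fun_prop) only [sw_tsw, tsw_tmul]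
  rw [sw_comm]

theorem sw_i_mul_j (h : H) (φ : Dual k H) (F : D → D → M)
    (h₁ : ∀ b, Lin k fun a => F a b := by intros; fun_prop)
    (h₂ : ∀ a, Lin k fun b => F a b := by intros; fun_prop) :
    sw k (i h * j φ) F =
    sw k h fun a b => sw k φ fun α β => F (i b * j α) (i a * j β) := by
  rw [hD.sw_mul_arg hH _ _ F h₁ h₂, hD.sw_i hH h fun a b => sw k (j φ) fun c d => F (a * c) (b * d)]
  exact sw_congr _ fun a b => hD.sw_j hH φ fun c d => F (i b * c) (i a * d)

theorem sw_one (F : D → D → M)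
    (h₁ : ∀ b, Lin k fun a => F a b := by intros; fun_prop)
    (h₂ : ∀ a, Lin k fun b => F a b := by intros; fun_prop) :
    sw k 1 F = sw k (1 : H) fun a b => F (i b) (i a) := by
  rw [← hD.i_one, hD.sw_i hH 1 F h₁ h₂]

/-- The coproduct is reversed on `i(H)`, so elements of `H_t` enter the second leg, contrary to what
happens in `H`. -/
theorem sw_mul_target (x : D) {z : H} (hz : IsTarget k z) (F : D → D → M)
    (h₁ : ∀ b, Lin k fun a => F a b := by intros; fun_prop)
    (h₂ : ∀ a, Lin k fun b => F a b := by intros; fun_prop) :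
    sw k (x * i z) F = sw k x fun a b => F a (b * i z) := by
  conv_rhs => rw [← mul_one x, hD.sw_mul_arg hH x 1 fun a b => F a (b * i z)]
  rw [hD.sw_mul_arg hH x (i z) F h₁ h₂]
  refine sw_congr _ fun a b => ?_
  rw [hD.sw_one hH fun c d => F (a * c) (b * d * i z), hD.sw_i hH z fun c d => F (a * c) (b * d),
    hz.sw_right fun c d => F (a * i d) (b * i c)]
  simp only [hD.i_mul, mul_assoc]

theorem sw_mul_source (x : D) {y : H} (hy : IsSource k y) (F : D → D → M)
    (h₁ : ∀ b, Lin k fun a => F a b := by intros; fun_prop)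
    (h₂ : ∀ a, Lin k fun b => F a b := by intros; fun_prop) :
    sw k (x * i y) F = sw k x fun a b => F (a * i y) b := by
  conv_rhs => rw [← mul_one x, hD.sw_mul_arg hH x 1 fun a b => F (a * i y) b]
  rw [hD.sw_mul_arg hH x (i y) F h₁ h₂]
  refine sw_congr _ fun a b => ?_
  rw [hD.sw_one hH fun c d => F (a * c * i y) (b * d), hD.sw_i hH y fun c d => F (a * c) (b * d),
    hy.sw_right fun c d => F (a * i d) (b * i c)]
  simp only [hD.i_mul, mul_assoc]

end Sweedler

/-- After the exchange of `ψ` and `g`, a factor in `H_s` built from the last leg of `g` stands to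
the left of `targetMapOp h`. Commuting it past lets it recombine with the middle leg, and
`g₍₂₎S⁻¹(g₍₁₎)` remains. Hence `g` matters only through `sourceMapOp g`. -/
theorem counit_i_mul_j_mul_i (h : H) (ψ : Dual k H) (g : H) :
    εD (i h * j ψ * i g) = ψ (targetMapOp k H h * sourceMapOp k H g) := by
  have hW (c : H) : targetMapOp k H (h * c) =
      sw k c fun a b => S.symm b * targetMapOp k H h * a := by
    rw [← hH.sw_symm_mul, hH.sw_mul_arg h c fun a b => S.symm b * a, sw_comm]
    simp only [← hH.sw_symm_mul h, sw_mul, mul_sw, hH.symm_mul, mul_assoc]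
  have hV (g : H) : (sw k g fun a b => sourceMapOp k H b * a) = g := by
    apply S.injective
    rw [equiv_map_sw]
    simp only [hH.equiv_mul]
    have := hH.antipode_sourceMapOp
    simp only [LinearEquiv.coe_coe] at this
    simp only [this]
    exact hH.sw_antipode_targetMap g
  rw [mul_assoc, hD.j_mul_i]
  simp only [mul_sw, map_sw, ← mul_assoc, ← hD.i_mul, hD.counit_i_mul_j, dualAct_apply, hW]
  calc _ = sw k g fun a m => sw k m fun c n =>
        ψ (sourceMapOp k H n * targetMapOp k H h * c * S.symm a) :=
        sw_congr _ fun a m => (sw_assoc m fun c d b =>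
          ψ (b * S.symm d * targetMapOp k H h * c * S.symm a)).trans <| sw_congr _ fun c n => by
          rw [← hH.sw_mul_symm n]
          simp only [sw_mul, map_sw]
    _ = sw k g fun a m => ψ (targetMapOp k H h * (m * S.symm a)) := sw_congr _ fun a m => by
        simp only [hH.commute (hH.isSource_sourceMapOp _) (hH.isTarget_targetMapOp h), mul_assoc]
        simp only [← map_sw, ← mul_sw]
        congr 2
        conv_rhs => rw [← hV m, sw_mul]
        simp only [mul_assoc]
    _ = _ := by rw [← map_sw, ← mul_sw, hH.sw_mul_symm]

/-- On `x = i(h)j(ψ)` the left side is `ψ * φ` at `z = targetMapOp h`, and `Δ(z) = z1₍₁₎ ⊗ 1₍₂₎`. It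
follows that under `ε` a right factor from `H*` can be replaced by one from `H`. -/
theorem counit_mul_j (x : D) (φ : Dual k H) :
    εD (x * j φ) = sw k (1 : H) fun a b => φ b * εD (x * i a) := by
  revert x
  refine hD.induction (fun x x' hx hx' => ?_) fun h ψ => ?_
  · have := sw_comm (k := k) (1 : H) (1 : H) fun a b _ _ => φ b * εD (x * i a)
    have e : (fun a b : H => φ b * εD ((x + x') * i a)) =
      fun a b => φ b * εD (x * i a) + φ b * εD (x' * i a) := by ext; simp [add_mul, mul_add]
    rw [add_mul, map_add, hx, hx', e]
    simp only [sw, tsw, Finset.sum_add_distrib]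
  · simp only [hD.counit_i_mul_j_mul_i hH]
    rw [mul_assoc, ← hD.j_mul, hD.counit_i_mul_j, dualMul_apply,
      hH.sw_one_sourceMapOp_left fun a b => φ b * ψ (targetMapOp k H h * a),
      (hH.isTarget_targetMapOp h).sw_left fun a b => ψ a * φ b]
    simp only [mul_comm]

theorem counit_mul_i (x : D) {g g' : H} (hg : sourceMapOp k H g = sourceMapOp k H g') :
    εD (x * i g) = εD (x * i g') := by
  revert x
  refine hD.induction (fun x x' hx hx' => by simp only [add_mul, map_add, hx, hx']) fun h ψ => ?_
  rw [hD.counit_i_mul_j_mul_i hH, hD.counit_i_mul_j_mul_i hH, hg]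

theorem exists_counit_mul (l : D) : ∃ g : H, ∀ x, εD (x * l) = εD (x * i g) := by
  revert l
  refine hD.induction ?_ fun g φ => ⟨sw k (1 : H) fun a b => φ b • (g * a), fun x => ?_⟩
  · rintro l l' ⟨g, hg⟩ ⟨g', hg'⟩
    exact ⟨g + g', fun x => by simp only [mul_add, map_add, hg, hg']⟩
  · rw [← mul_assoc, hD.counit_mul_j hH]
    simp only [map_sw, mul_sw, map_smul, mul_smul_comm, smul_eq_mul, mul_assoc, hD.i_mul]

/-- Under `ε` any right factor `l` may be replaced by `i(y)` with `y ∈ H_s` or by `i(z)` with `z ∈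
H_t`. Such a factor slides into the first or the second leg of a coproduct, and weak
multiplicativity of the counit becomes ordinary counitality. -/
theorem isWeakBialgebra : IsWeakBialgebra k D := by
  have key (l : D) : ∃ y z : H, IsSource k y ∧ IsTarget k z ∧
      ∀ x, εD (x * l) = εD (x * i y) ∧ εD (x * l) = εD (x * i z) := by
    obtain ⟨g, hg⟩ := hD.exists_counit_mul hH l
    refine ⟨sourceMapOp k H g, targetMap k H g, hH.isSource_sourceMapOp g,
      hH.isTarget_targetMap g, fun x => ⟨?_, ?_⟩⟩
    · rw [hg]
      exact hD.counit_mul_i hH x (hH.isSource_sourceMapOp g).sourceMapOp_eq.symm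
    · rw [hg]
      -- `S` turns `sourceMapOp` into `ε_t`, which fixes `ε_t(g)`.
      refine hD.counit_mul_i hH x (S.injective ?_)
      have := hH.antipode_sourceMapOp
      simp only [LinearEquiv.coe_coe] at this
      rw [this, this, (hH.isTarget_targetMap g).targetMap_eq]
  have e : (sw k (1 : D) fun a b => sw k b fun c d => a ⊗ₜ[k] (c ⊗ₜ[k] d)) =
      sw k (1 : H) fun a b => sw k a fun c d => i b ⊗ₜ[k] (i d ⊗ₜ[k] i c) := by
    rw [hD.sw_one hH fun a b => sw k b fun c d => a ⊗ₜ[k] (c ⊗ₜ[k] d)]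
    exact sw_congr _ fun a b => hD.sw_i hH a fun c d => i b ⊗ₜ[k] (c ⊗ₜ[k] d)
  refine .of_sw (fun x y => ?_) ?_ ?_ (fun h x l => ?_) fun h x l => ?_
  · rw [comul_eq_sw, hD.sw_mul_arg hH x y fun a b => a ⊗ₜ[k] b]
  · rw [e]
    -- As `Δ` is reversed on `i(H)`, each expansion of `Δ²(1)` in `D` comes from the other one in
    -- `H`.
    rw [sw_assoc 1 fun a b c => i c ⊗ₜ[k] (i b ⊗ₜ[k] i a),
      hH.sw_one' fun a b c => i c ⊗ₜ[k] (i b ⊗ₜ[k] i a), sw_comm,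
      hD.sw_one hH fun a b => sw k (1 : D) fun c d => a ⊗ₜ[k] ((b * c) ⊗ₜ[k] d)]
    simp only [hD.i_mul]
    exact sw_congr _ fun a b => (hD.sw_one hH fun c d => i b ⊗ₜ[k] ((i a * c) ⊗ₜ[k] d)).symm
  · rw [e]
    rw [sw_assoc 1 fun a b c => i c ⊗ₜ[k] (i b ⊗ₜ[k] i a),
      hH.sw_one fun a b c => i c ⊗ₜ[k] (i b ⊗ₜ[k] i a), sw_comm,
      hD.sw_one hH fun a b => sw k (1 : D) fun c d => a ⊗ₜ[k] ((c * b) ⊗ₜ[k] d)]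
    simp only [hD.i_mul]
    exact sw_congr _ fun a b => (hD.sw_one hH fun c d => i b ⊗ₜ[k] ((c * i a) ⊗ₜ[k] d)).symm
  · obtain ⟨y, z, hy, hz, hl⟩ := key l
    simp only [(hl _).2]
    rw [← hD.sw_mul_target hH x hz fun a b => εD (h * a) * εD b]
    rw [mul_assoc]
    refine (sw_counit_right (k := k) (x * i z) fun a => εD (h * a)).symm.trans ?_
    exact sw_congr _ fun a b => mul_comm _ _
  · obtain ⟨y, z, hy, hz, hl⟩ := key l
    simp only [(hl _).1]
    rw [← hD.sw_mul_source hH x hy fun a b => εD (h * b) * εD a]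
    rw [mul_assoc]
    refine (sw_counit_left (k := k) (x * i y) fun a => εD (h * a)).symm.trans ?_
    exact sw_congr _ fun a b => mul_comm _ _

end IsDouble

end DoubleBialgebra

/-! ### The antipode of the Drinfeld double -/

section DoubleAntipode

variable {k H : Type*} [CommRing k] [Ring H] [Algebra k H] [Coalgebra k H] {S : H ≃ₗ[k] H}

local notation "ε" => (counit : H →ₗ[k] k)

namespace IsWeakHopfAlgebra

variable (hH : IsWeakHopfAlgebra k H S.toLinearMap)
include hH

theorem dualMap_dualAct (x y : H) (φ : Dual k H) :
    S.toLinearMap.dualMap (dualAct k H x y φ) =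
      dualAct k H (S.symm y) (S.symm x) (S.toLinearMap.dualMap φ) := by
  ext l
  simp only [LinearMap.dualMap_apply, dualAct_apply, LinearEquiv.coe_coe, hH.equiv_mul,
    LinearEquiv.apply_symm_apply, mul_assoc]

theorem symm_dualMap_dualAct (x y : H) (φ : Dual k H) :
    S.symm.toLinearMap.dualMap (dualAct k H x y φ) =
      dualAct k H (S y) (S x) (S.symm.toLinearMap.dualMap φ) := by
  ext l
  simp only [LinearMap.dualMap_apply, dualAct_apply, LinearEquiv.coe_coe, hH.symm_mul,
    LinearEquiv.symm_apply_apply, mul_assoc]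

theorem dualMap_counit : S.toLinearMap.dualMap ε = ε := by
  ext l
  exact hH.counit_antipode l

end IsWeakHopfAlgebra

variable [Module.Finite k H] [Module.Projective k H]
  {D : Type*} [Ring D] [Algebra k D] [Coalgebra k D] {i : H →ₗ[k] D} {j : Dual k H →ₗ[k] D}

local notation "εD" => (counit : D →ₗ[k] k)

attribute [local instance] dualCoalgebra

namespace IsDouble

variable (hD : IsDouble S i j) (hH : IsWeakHopfAlgebra k H S.toLinearMap)
include hD hH

theorem targetMap_i_mul_j (h : H) (φ : Dual k H) : targetMap k D (i h * j φ) =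
    sw k (1 : H) fun p q => φ q • i (sourceMapOp k H (h * p)) := by
  rw [targetMap_apply, hD.sw_one hH fun a b => εD (a * (i h * j φ)) • b]
  have e (b : H) : εD (i b * (i h * j φ)) =
      sw k (1 : H) fun p q => counit (R := k) (b * (h * p)) * φ q := by
    rw [← mul_assoc, ← hD.i_mul, hD.counit_i_mul_j, targetMapOp_apply, map_sw]
    simp only [map_smul, smul_eq_mul, mul_assoc]
  simp only [e, sourceMapOp_apply, map_sw, sw_smul, smul_sw, map_smul, smul_smul]
  rw [sw_comm]
  simp only [mul_comm (φ _)]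

theorem sourceMap_i_mul_j (h : H) (φ : Dual k H) : sourceMap k D (i h * j φ) =
    sw k (1 : H) fun p q => φ (targetMapOp k H h * p) • i q := by
  rw [sourceMap_apply, hD.sw_one hH fun a b => εD (i h * j φ * b) • a]
  simp only [hD.counit_i_mul_j_mul_i hH]
  exact hH.sw_one_sourceMapOp_left fun p q => φ (targetMapOp k H h * p) • i q

variable {T : D →ₗ[k] D}
  (hT : ∀ h φ, T (i h * j φ) = j (S.toLinearMap.dualMap φ) * i (S.symm h))
include hT

/-- The factor `S⁻¹(h₍₂₎)h₍₁₎` in the middle lies in `H_t`, so it acts on `φ₍₂₎`. The convolution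
that remains in `H*` is evaluated by `S(u₍₁₎)u₍₂₎ = ε_s(u)`. -/
theorem sw_antipode_mul (h : H) (φ : Dual k H) :
    (sw k (i h * j φ) fun a b => T a * b) = sourceMap k D (i h * j φ) := by
  rw [hD.sw_i_mul_j hH h φ fun a b => T a * b, hD.sourceMap_i_mul_j hH]
  have e1 (α β : Dual k H) : (sw k h fun a b => T (i b * j α) * (i a * j β)) =
      j (dualMul k H (S.toLinearMap.dualMap α ⊗ₜ[k] dualAct k H (targetMapOp k H h) 1 β)) := by
    rw [hD.j_mul, ← hD.target_mul_j hH (hH.isTarget_targetMapOp h), ← hH.sw_symm_mul]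
    simp only [hT, hD.i_mul, map_sw, sw_mul, mul_sw, mul_assoc]
  have e2 : (sw k φ fun α β => dualMul k H (S.toLinearMap.dualMap α ⊗ₜ[k]
      dualAct k H (targetMapOp k H h) 1 β)) =
      sw k (1 : H) fun p q => φ (p * targetMapOp k H h) • dualAct k H q 1 ε := by
    ext u
    simp only [sw_apply, dualMul_apply, dualAct_apply, LinearMap.dualMap_apply, one_mul,
      LinearMap.smul_apply]
    rw [sw_comm]
    simp only [sw_dual_eval]
    have := hH.sw_antipode_left u
    rw [sourceMap_apply] at this
    have := congrArg (fun x => φ (x * targetMapOp k H h)) this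
    simp only [sw_mul, map_sw, smul_mul_assoc, map_smul, mul_assoc] at this
    simpa only [smul_eq_mul, mul_comm] using this
  rw [sw_comm]
  simp only [e1]
  rw [← map_sw j, e2]
  simp only [map_sw, map_smul]
  rw [← hH.sw_one_targetMap_right fun p q => φ (p * targetMapOp k H h) • j (dualAct k H q 1 ε),
    ← hH.sw_one_sourceMap_left fun p q =>
      φ (p * targetMapOp k H h) • j (dualAct k H (targetMap k H q) 1 ε)]
  simp only [hH.commute (hH.isSource_sourceMap _) (hH.isTarget_targetMapOp h),
    ← hD.i_target _ (hH.isTarget_targetMap _)]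
  rw [hH.sw_one_sourceMap_left fun p q => φ (targetMapOp k H h * p) • i (targetMap k H q),
    hH.sw_one_targetMap_right fun p q => φ (targetMapOp k H h * p) • i q]

/-- Here the inner pair `j(φ₍₁₎)j(φ₍₂₎ ∘ S)` collapses first, to `φ(1₍₂₎)i(1₍₁₎)`, and the outer
factors then combine through `h₍₂₎S⁻¹(h₍₁₎)`. -/
theorem sw_mul_antipode (h : H) (φ : Dual k H) :
    (sw k (i h * j φ) fun a b => a * T b) = targetMap k D (i h * j φ) := by
  rw [hD.sw_i_mul_j hH h φ fun a b => a * T b, hD.targetMap_i_mul_j hH]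
  have e : (sw k φ fun α β => dualMul k H (α ⊗ₜ[k] S.toLinearMap.dualMap β)) =
      sw k (1 : H) fun p q => φ q • dualAct k H 1 p ε := by
    ext u
    simp only [sw_apply, dualMul_apply, dualAct_apply, LinearMap.dualMap_apply, mul_one,
      LinearMap.smul_apply]
    rw [sw_comm]
    simp only [sw_dual_eval]
    rw [← map_sw, hH.sw_antipode_right, targetMap_apply, map_sw]
    simp only [map_smul, smul_eq_mul, mul_comm]
  have e' : (sw k φ fun α β => j α * j (S.toLinearMap.dualMap β)) =
      sw k (1 : H) fun p q => φ q • i p := by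
    simp only [← hD.j_mul]
    rw [← map_sw j, e]
    simp only [map_sw, map_smul]
    rw [← hH.sw_one_sourceMap_left fun p q => φ q • j (dualAct k H 1 p ε),
      ← hH.sw_one_sourceMap_left fun p q => φ q • i p]
    simp only [hD.i_source' hH (hH.isSource_sourceMap _)]
  have e'' (a b : H) : (sw k φ fun α β => i b * j α * T (i a * j β)) =
      sw k (1 : H) fun p q => φ q • i (b * p * S.symm a) := by
    have := congrArg (fun x => i b * x * i (S.symm a)) e'
    simpa only [sw_mul, mul_sw, hT, hD.i_mul, mul_assoc, smul_mul_assoc, mul_smul_comm] using this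
  simp only [e'']
  rw [sw_comm]
  simp only [← hH.sw_mul_symm]
  rw [← hH.sw_one_sourceMap_left fun p q => sw k h fun a b => φ q • i (b * p * S.symm a),
    ← hH.sw_one_sourceMap_left fun p q => φ q • i (sw k (h * p) fun a b => b * S.symm a)]
  refine sw_congr _ fun p q => ?_
  rw [hH.sw_mul_source h (hH.isSource_sourceMap p) fun a b => b * S.symm a]
  simp only [map_sw, smul_sw]

/-- The formula for the source map contributes legs of `Δ(1)` acting on `φ`, which cancel by
`1₍₁₎S(1₍₂₎) = 1`. The remaining action of an element of `H_t` is again traded for legs of `Δ(1)`,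
which cancel by `1₍₂₎S⁻¹(1₍₁₎) = 1`. -/
theorem sw_sourceMap_mul_antipode (h : H) (φ : Dual k H) :
    (sw k (i h * j φ) fun a b => sourceMap k D a * T b) = T (i h * j φ) := by
  rw [hD.sw_i_mul_j hH h φ fun a b => sourceMap k D a * T b, hT]
  simp only [hD.sourceMap_i_mul_j hH, hT, sw_mul, smul_mul_assoc]
  have e (a b : H) : (sw k φ fun α β => sw k (1 : H) fun p q => α (targetMapOp k H b * p) •
      (i q * (j (S.toLinearMap.dualMap β) * i (S.symm a)))) =
      j (S.toLinearMap.dualMap (dualAct k H 1 (targetMapOp k H b) φ)) * i (S.symm a) := by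
    rw [sw_comm]
    calc _ = sw k (1 : H) fun p q => i q *
          j (S.toLinearMap.dualMap (dualAct k H 1 (targetMapOp k H b * p) φ)) * i (S.symm a) :=
          sw_congr _ fun p q => by
          rw [sw_dual_left_smul φ (targetMapOp k H b * p) fun β =>
            i q * (j (S.toLinearMap.dualMap β) * i (S.symm a)), mul_assoc]
      _ = sw k (1 : H) fun p q => j (S.toLinearMap.dualMap
            (dualAct k H 1 (targetMapOp k H b * (p * S q)) φ)) * i (S.symm a) := by
          rw [← hH.sw_one_targetMap_right fun p q => i q *
              j (S.toLinearMap.dualMap (dualAct k H 1 (targetMapOp k H b * p) φ)) * i (S.symm a),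
            ← hH.sw_one_targetMap_right fun p q => j (S.toLinearMap.dualMap
              (dualAct k H 1 (targetMapOp k H b * (p * S q)) φ)) * i (S.symm a)]
          simp only [hD.target_mul_j hH (hH.isTarget_targetMap _), hH.dualMap_dualAct,
            dualAct_dualAct, hH.symm_mul, LinearEquiv.symm_apply_apply, mul_one, mul_assoc]
      _ = _ := by
          have := hH.sw_antipode_right 1
          rw [targetMap_one] at this
          simp only [LinearEquiv.coe_coe] at this
          simp only [← sw_mul, ← map_sw, ← sw_apply, ← mul_sw, this, mul_one]
  simp only [e]
  rw [hH.sw_targetMapOp_right h fun a b =>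
    j (S.toLinearMap.dualMap (dualAct k H 1 b φ)) * i (S.symm a),
    ← hH.sw_one_sourceMap_left fun a b =>
    j (S.toLinearMap.dualMap (dualAct k H 1 b φ)) * i (S.symm (h * a))]
  simp only [hH.symm_mul, hD.i_mul, ← mul_assoc,
    hD.j_mul_target hH _ (hH.isTarget_symm (hH.isSource_sourceMap _)), hH.dualMap_dualAct,
    dualAct_dualAct, one_mul, hH.symm_one]
  simp only [← hH.symm_mul]
  rw [hH.sw_one_sourceMap_left fun a b =>
    j (dualAct k H (S.symm (b * S.symm a)) 1 (S.toLinearMap.dualMap φ)) * i (S.symm h)]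
  rw [← lin_map_sw (g := fun x =>
    j (dualAct k H (S.symm x) 1 (S.toLinearMap.dualMap φ)) * i (S.symm h)) (by fun_prop) (1 : H)
    fun a b => b * S.symm a, hH.sw_one_mul_symm, hH.symm_one, dualAct_one_one]

theorem isWeakHopfAlgebra : IsWeakHopfAlgebra k D T := by
  refine .of_sw (hD.isWeakBialgebra hH) (fun x => ?_) (fun x => ?_) fun x => ?_
  · exact LinearMap.congr_fun (hD.linearMap_ext (f := conv T LinearMap.id)
      (g := sourceMap k D) fun h φ => (conv_apply _ _ _).trans (hD.sw_antipode_mul hH hT h φ)) x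
      |> (conv_apply _ _ _).symm.trans
  · exact LinearMap.congr_fun (hD.linearMap_ext (f := conv LinearMap.id T)
      (g := targetMap k D) fun h φ => (conv_apply _ _ _).trans (hD.sw_mul_antipode hH hT h φ)) x
      |> (conv_apply _ _ _).symm.trans
  · exact LinearMap.congr_fun (hD.linearMap_ext (f := conv (sourceMap k D) T)
      (g := T) fun h φ => (conv_apply _ _ _).trans (hD.sw_sourceMap_mul_antipode hH hT h φ)) x
      |> (conv_apply _ _ _).symm.trans

theorem antipode_i (h : H) : T (i h) = i (S.symm h) := by
  have := hT h ε
  rwa [hD.j_counit, mul_one, hH.dualMap_counit, hD.j_counit, one_mul] at this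

theorem antipode_j (φ : Dual k H) : T (j φ) = j (S.toLinearMap.dualMap φ) := by
  have := hT 1 φ
  rwa [hH.symm_one, hD.i_one, mul_one, one_mul] at this

theorem antipode_comp_inverse {T' : D →ₗ[k] D}
    (hT' : ∀ h φ, T' (i h * j φ) = j (S.symm.toLinearMap.dualMap φ) * i (S h)) :
    T ∘ₗ T' = LinearMap.id := by
  refine hD.linearMap_ext fun h φ => ?_
  rw [LinearMap.comp_apply, hT', (hD.isWeakHopfAlgebra hH hT).map_mul, hD.antipode_i hH hT,
    hD.antipode_j hH hT, LinearEquiv.symm_apply_apply]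
  congr 2
  ext l
  simp

end IsDouble

end DoubleAntipode

/-! ### The weak Hopf algebra structure of the Drinfeld double -/

section DoubleHopf

variable {k H : Type*} [CommRing k] [Ring H] [Algebra k H] [Coalgebra k H]
  [Module.Finite k H] [Module.Projective k H] {S : H ≃ₗ[k] H}

local notation "ε" => (counit : H →ₗ[k] k)

attribute [local instance] doubleAddCommGroup doubleModule dualCoalgebra

theorem rev₃_tmul (a b c : H) : rev₃ k H (a ⊗ₜ[k] (b ⊗ₜ[k] c)) = c ⊗ₜ[k] (b ⊗ₜ[k] a) := rfl

theorem pairOuter_tmul (a b c : H) (α β γ : Dual k H) :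
    pairOuter k H ((a ⊗ₜ[k] (b ⊗ₜ[k] c)) ⊗ₜ[k] (α ⊗ₜ[k] (β ⊗ₜ[k] γ))) =
      α a • γ c • (b ⊗ₜ[k] β) := rfl

theorem dualComul₂_eq_sw (φ : Dual k H) :
    dualComul₂ k H φ = sw k φ fun α β => sw k β fun γ δ => α ⊗ₜ[k] (γ ⊗ₜ[k] δ) := by
  have h (φ : Dual k H) : dualComul k H φ = sw k φ fun α β => α ⊗ₜ[k] β := comul_eq_sw φ
  simp only [dualComul₂, LinearMap.comp_apply, h, map_sw, LinearMap.lTensor_tmul, tmul_sw]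

/-- Pairing with the outer legs of `φ` is the bimodule action, which brings the antipode formulas
into the form of the exchange relation. -/
theorem pairOuter_dualComul₂ (a b c : H) (φ : Dual k H) :
    pairOuter k H ((a ⊗ₜ[k] (b ⊗ₜ[k] c)) ⊗ₜ[k] dualComul₂ k H φ) =
      b ⊗ₜ[k] dualAct k H c a φ := by
  simp only [dualComul₂_eq_sw, tmul_sw, map_sw, pairOuter_tmul, ← smul_sw]
  calc _ = sw k φ fun α β => α a • (b ⊗ₜ[k] dualAct k H c 1 β) :=
        sw_congr _ fun α β => by rw [sw_dual_right_smul β c fun γ => b ⊗ₜ[k] γ]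
    _ = _ := by
        rw [sw_dual_left_smul φ a fun β => b ⊗ₜ[k] dualAct k H c 1 β, dualAct_dualAct, mul_one,
          mul_one]

theorem doubleAntipode_tmul (h : H) (φ : Dual k H) : doubleAntipode S (h ⊗ₜ[k] φ) =
    sw k h fun a b => sw k b fun c d =>
      S.symm c ⊗ₜ[k] S.toLinearMap.dualMap (dualAct k H a (S.symm d) φ) := by
  simp only [doubleAntipode, LinearMap.comp_apply, TensorProduct.map_tmul, comul₂_eq_sw, map_sw,
    rev₃_tmul, LinearMap.rTensor_tmul, sw_tmul, pairOuter_dualComul₂, LinearEquiv.coe_coe]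

theorem doubleAntipodeInv_tmul (h : H) (φ : Dual k H) : doubleAntipodeInv S (h ⊗ₜ[k] φ) =
    sw k h fun a b => sw k b fun c d =>
      S c ⊗ₜ[k] S.symm.toLinearMap.dualMap (dualAct k H a (S.symm d) φ) := by
  simp only [doubleAntipodeInv, LinearMap.comp_apply, TensorProduct.map_tmul, comul₂_eq_sw, map_sw,
    rev₃_tmul, LinearMap.rTensor_tmul, sw_tmul, pairOuter_dualComul₂, LinearEquiv.coe_coe]

namespace IsWeakHopfAlgebra

variable (hH : IsWeakHopfAlgebra k H S.toLinearMap)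
include hH

/-- The explicit formula is the exchange relation for `j(φ ∘ S)` and `i(S⁻¹(h))`, with the reversed
legs of `S⁻¹(h)` written through those of `h`. -/
theorem doubleMk_doubleAntipode (h : H) (φ : Dual k H) :
    doubleMk S (doubleAntipode S (h ⊗ₜ[k] φ)) =
      hH.doubleMul (doubleInr S (S.toLinearMap.dualMap φ)) (doubleInl S (S.symm h)) := by
  simp only [hH.doubleMul_inr_inl, doubleAntipode_tmul, map_sw]
  rw [hH.sw_symm h fun a b => sw k b fun c d =>
    doubleMk S (c ⊗ₜ[k] dualAct k H (S.symm a) d (S.toLinearMap.dualMap φ))]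
  rw [← sw_assoc h fun a c d => doubleMk S
    (S.symm c ⊗ₜ[k] S.toLinearMap.dualMap (dualAct k H a (S.symm d) φ))]
  refine sw_congr _ fun a b => ?_
  rw [hH.sw_symm a fun c d => doubleMk S
    (c ⊗ₜ[k] dualAct k H (S.symm (S.symm b)) d (S.toLinearMap.dualMap φ))]
  simp only [hH.dualMap_dualAct]

theorem doubleMk_doubleAntipodeInv (h : H) (φ : Dual k H) :
    doubleMk S (doubleAntipodeInv S (h ⊗ₜ[k] φ)) =
      hH.doubleMul (doubleInr S (S.symm.toLinearMap.dualMap φ)) (doubleInl S (S h)) := by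
  simp only [hH.doubleMul_inr_inl, doubleAntipodeInv_tmul, map_sw]
  rw [hH.sw_equiv h fun a b => sw k b fun c d =>
    doubleMk S (c ⊗ₜ[k] dualAct k H (S.symm a) d (S.symm.toLinearMap.dualMap φ))]
  rw [← sw_assoc h fun a c d => doubleMk S
    (S c ⊗ₜ[k] S.symm.toLinearMap.dualMap (dualAct k H a (S.symm d) φ))]
  refine sw_congr _ fun a b => ?_
  rw [hH.sw_equiv a fun c d => doubleMk S
    (c ⊗ₜ[k] dualAct k H (S.symm (S b)) d (S.symm.toLinearMap.dualMap φ))]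
  simp only [hH.symm_dualMap_dualAct, LinearEquiv.symm_apply_apply, LinearEquiv.apply_symm_apply]

theorem balanced_doubleAntipode : Balanced S (doubleMk S ∘ₗ doubleAntipode S) := by
  let _ := hH.doubleRing
  let _ := hH.doubleAlgebra
  have hD : IsDoubleAlgebra S (doubleInl S) (doubleInr S) := hH.isDoubleAlgebra
  have key (h : H) (φ : Dual k H) : (doubleMk S ∘ₗ doubleAntipode S) (h ⊗ₜ[k] φ) =
      doubleInr S (S.toLinearMap.dualMap φ) * doubleInl S (S.symm h) :=
    hH.doubleMk_doubleAntipode h φ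
  constructor
  · intro h y φ hy
    rw [key, key, hH.symm_mul, hD.i_mul, ← mul_assoc,
      hD.j_mul_target hH _ (hH.isTarget_symm hy), hH.dualMap_dualAct, hH.symm_one]
  · intro h z φ hz
    rw [key, key, hH.symm_mul, hD.i_mul, ← mul_assoc,
      hD.j_mul_source hH _ (hH.isSource_symm hz), hH.dualMap_dualAct, hH.symm_one]

theorem balanced_doubleAntipodeInv : Balanced S (doubleMk S ∘ₗ doubleAntipodeInv S) := by
  let _ := hH.doubleRing
  let _ := hH.doubleAlgebra
  have hD : IsDoubleAlgebra S (doubleInl S) (doubleInr S) := hH.isDoubleAlgebra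
  have h1 : S 1 = 1 := hH.map_one
  have key (h : H) (φ : Dual k H) : (doubleMk S ∘ₗ doubleAntipodeInv S) (h ⊗ₜ[k] φ) =
      doubleInr S (S.symm.toLinearMap.dualMap φ) * doubleInl S (S h) :=
    hH.doubleMk_doubleAntipodeInv h φ
  constructor
  · intro h y φ hy
    rw [key, key, hH.equiv_mul, hD.i_mul, ← mul_assoc,
      hD.j_mul_target hH _ (hH.isTarget_equiv hy), hH.symm_dualMap_dualAct, h1,
      LinearEquiv.symm_apply_apply, LinearEquiv.apply_symm_apply]
  · intro h z φ hz
    rw [key, key, hH.equiv_mul, hD.i_mul, ← mul_assoc,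
      hD.j_mul_source hH _ (hH.isSource_equiv hz), hH.symm_dualMap_dualAct, h1]

/-- The Drinfeld double is a double. -/
theorem isDouble :
    letI := hH.doubleRing
    letI := hH.doubleAlgebra
    letI := hH.doubleCoalgebra
    IsDouble S (doubleInl S) (doubleInr S) := by
  let _ := hH.doubleRing
  let _ := hH.doubleAlgebra
  let _ := hH.doubleCoalgebra
  have hm (h : H) (φ : Dual k H) : doubleInl S h * doubleInr S φ = doubleMk S (h ⊗ₜ[k] φ) :=
    hH.doubleMul_inl_inr h φ
  refine { hH.isDoubleAlgebra with
    span_eq_top := ?_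
    comul_i_mul_j := fun h φ => ?_
    counit_i_mul_j := fun h φ => by rw [hm]; rfl }
  · rw [eq_top_iff]
    rintro x -
    obtain ⟨x, rfl⟩ := doubleMk_surjective S x
    induction x with
    | zero => simp
    | add x y hx hy => rw [map_add]; exact add_mem hx hy
    | tmul h φ => exact Submodule.subset_span ⟨(h, φ), hm h φ⟩
  · rw [hm]
    refine (hH.doubleComulHom_tmul h φ).trans ?_
    simp only [← hm, deltaInl_apply, deltaInr_apply, mul_sw, sw_mul,
      Algebra.TensorProduct.tmul_mul_tmul]
    rw [sw_comm]

omit hH in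
theorem _root_.WeakHopf.finite_double : Module.Finite k (DrinfeldDouble S) :=
  Module.Finite.of_surjective (doubleMk S) (doubleMk_surjective S)

theorem doubleLift_antipode_inl_inr (h : H) (φ : Dual k H) :
    hH.doubleLift _ hH.balanced_doubleAntipode (hH.doubleMul (doubleInl S h) (doubleInr S φ)) =
      hH.doubleMul (doubleInr S (S.toLinearMap.dualMap φ)) (doubleInl S (S.symm h)) := by
  rw [hH.doubleMul_inl_inr]
  exact hH.doubleMk_doubleAntipode h φ

theorem doubleLift_antipodeInv_inl_inr (h : H) (φ : Dual k H) :
    hH.doubleLift _ hH.balanced_doubleAntipodeInv (hH.doubleMul (doubleInl S h) (doubleInr S φ)) =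
      hH.doubleMul (doubleInr S (S.symm.toLinearMap.dualMap φ)) (doubleInl S (S h)) := by
  rw [hH.doubleMul_inl_inr]
  exact hH.doubleMk_doubleAntipodeInv h φ

theorem doubleLift_antipode_comp : hH.doubleLift _ hH.balanced_doubleAntipode ∘ₗ
    hH.doubleLift _ hH.balanced_doubleAntipodeInv = LinearMap.id := by
  let _ := hH.doubleRing
  let _ := hH.doubleAlgebra
  let _ := hH.doubleCoalgebra
  have hD : IsDouble S (doubleInl S) (doubleInr S) := hH.isDouble
  exact hD.antipode_comp_inverse hH hH.doubleLift_antipode_inl_inr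
    hH.doubleLift_antipodeInv_inl_inr

/-- The antipode of the Drinfeld double. -/
def doubleAntipodeEquiv : DrinfeldDouble S ≃ₗ[k] DrinfeldDouble S :=
  have h := hH.doubleLift_antipode_comp
  have := finite_double (S := S)
  -- Only one composite has been computed. It makes the antipode surjective, and a surjective
  -- endomorphism of a finitely generated module is injective, so the other composite is the
  -- identity as well.
  have hi : Function.Injective (hH.doubleLift _ hH.balanced_doubleAntipode) :=
    OrzechProperty.injective_of_surjective_endomorphism _ fun _ => ⟨_, LinearMap.congr_fun h _⟩
  LinearEquiv.ofLinearMap (hH.doubleLift _ hH.balanced_doubleAntipode)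
    (hH.doubleLift _ hH.balanced_doubleAntipodeInv) h <| LinearMap.ext fun _ => hi <|
      LinearMap.congr_fun h _

theorem isWeakHopfAlgebra_double :
    letI := hH.doubleRing
    letI := hH.doubleAlgebra
    letI := hH.doubleCoalgebra
    IsWeakHopfAlgebra k (DrinfeldDouble S) hH.doubleAntipodeEquiv.toLinearMap := by
  let _ := hH.doubleRing
  let _ := hH.doubleAlgebra
  let _ := hH.doubleCoalgebra
  have hD : IsDouble S (doubleInl S) (doubleInr S) := hH.isDouble
  exact hD.isWeakHopfAlgebra hH hH.doubleLift_antipode_inl_inr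

end IsWeakHopfAlgebra

end DoubleHopf

/-! ### Transport of structure to the opposite algebra -/

section OpTransport

variable {k A B : Type*} [CommRing k] [Ring A] [Algebra k A] [AddCommGroup B] [Module k B]

/-- The ring structure on `B` for which `E : A ≃ B` is an anti-isomorphism. -/
@[reducible] def antiRing (E : A ≃ₗ[k] B) : Ring B :=
  { (inferInstance : AddCommGroup B) with
    mul := fun x y => E (E.symm y * E.symm x)
    one := E 1
    left_distrib := fun x y z => by
      change E (E.symm (y + z) * E.symm x) = E _ + E _
      rw [map_add, add_mul, map_add]
    right_distrib := fun x y z => by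
      change E (E.symm z * E.symm (x + y)) = E _ + E _
      rw [map_add, mul_add, map_add]
    zero_mul := fun x => by
      change E (E.symm x * E.symm 0) = 0
      rw [map_zero, mul_zero, map_zero]
    mul_zero := fun x => by
      change E (E.symm 0 * E.symm x) = 0
      rw [map_zero, zero_mul, map_zero]
    mul_assoc := fun x y z => by
      change E (E.symm z * E.symm (E _)) = E (E.symm (E _) * E.symm x)
      rw [LinearEquiv.symm_apply_apply, LinearEquiv.symm_apply_apply, mul_assoc]
    one_mul := fun x => by
      change E (E.symm x * E.symm (E 1)) = x
      rw [LinearEquiv.symm_apply_apply, mul_one, LinearEquiv.apply_symm_apply]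
    mul_one := fun x => by
      change E (E.symm (E 1) * E.symm x) = x
      rw [LinearEquiv.symm_apply_apply, one_mul, LinearEquiv.apply_symm_apply] }

/-- The algebra structure on `B` for which `E : A ≃ B` is an anti-isomorphism. -/
@[reducible] def antiAlgebra (E : A ≃ₗ[k] B) : @Algebra k B _ (antiRing E).toSemiring :=
  letI := antiRing E
  Algebra.ofModule (fun c x y => by
    change E (E.symm y * E.symm (c • x)) = c • E _
    rw [map_smul, mul_smul_comm, map_smul]) (fun c x y => by
    change E (E.symm (c • y) * E.symm x) = c • E _
    rw [map_smul, smul_mul_assoc, map_smul])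

/-- The coalgebra structure on `B` for which `E : A ≃ B` is an isomorphism. -/
@[reducible] def transportCoalgebra [Coalgebra k A] (E : A ≃ₗ[k] B) : Coalgebra k B where
  comul := map E.toLinearMap E.toLinearMap ∘ₗ comul ∘ₗ E.symm.toLinearMap
  counit := counit ∘ₗ E.symm.toLinearMap
  coassoc := by
    refine LinearMap.ext fun x => ?_
    simp only [LinearMap.comp_apply, LinearEquiv.coe_coe, comul_eq_sw (k := k) (_ : A), map_sw,
      TensorProduct.map_tmul, LinearMap.rTensor_tmul, LinearMap.lTensor_tmul,
      LinearEquiv.symm_apply_apply, sw_tmul, tmul_sw, TensorProduct.assoc_tmul]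
    exact sw_assoc _ fun a b c => E a ⊗ₜ[k] (E b ⊗ₜ[k] E c)
  rTensor_counit_comp_comul := by
    refine LinearMap.ext fun x => ?_
    simp only [LinearMap.comp_apply, LinearEquiv.coe_coe, comul_eq_sw (k := k) (_ : A), map_sw,
      TensorProduct.map_tmul, LinearMap.rTensor_tmul, LinearEquiv.symm_apply_apply]
    have := sw_counit_left (k := k) (E.symm x) fun a => (1 : k) ⊗ₜ[k] E a
    rw [LinearEquiv.apply_symm_apply] at this
    refine Eq.trans (sw_congr _ fun a b => ?_) this
    rw [TensorProduct.smul_tmul', smul_eq_mul, mul_one]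
  lTensor_counit_comp_comul := by
    refine LinearMap.ext fun x => ?_
    simp only [LinearMap.comp_apply, LinearEquiv.coe_coe, comul_eq_sw (k := k) (_ : A), map_sw,
      TensorProduct.map_tmul, LinearMap.lTensor_tmul, LinearEquiv.symm_apply_apply]
    have := sw_counit_right (k := k) (E.symm x) fun a => E a ⊗ₜ[k] (1 : k)
    rw [LinearEquiv.apply_symm_apply] at this
    refine Eq.trans (sw_congr _ fun a b => ?_) this
    rw [← TensorProduct.tmul_smul, smul_eq_mul, mul_one]

/-- An anti-isomorphism, as an isomorphism with the opposite algebra. -/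
def antiAlgEquiv (E : A ≃ₗ[k] B) :
    letI := antiRing E
    letI := antiAlgebra E
    A ≃ₐ[k] Bᵐᵒᵖ :=
  letI := antiRing E
  letI := antiAlgebra E
  AlgEquiv.ofLinearEquiv (E ≪≫ₗ MulOpposite.opLinearEquiv k) rfl fun x y => by
    refine congrArg MulOpposite.op (congrArg E ?_)
    change x * y = E.symm (E x) * E.symm (E y)
    rw [LinearEquiv.symm_apply_apply, LinearEquiv.symm_apply_apply]

/-- An anti-isomorphism, as an isomorphism from the opposite algebra. -/
def opAlgEquiv (E : A ≃ₗ[k] B) :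
    letI := antiRing E
    letI := antiAlgebra E
    Aᵐᵒᵖ ≃ₐ[k] B :=
  letI := antiRing E
  letI := antiAlgebra E
  AlgEquiv.ofLinearEquiv ((MulOpposite.opLinearEquiv k).symm ≪≫ₗ E) rfl fun x y => by
    refine congrArg E ?_
    change y.unop * x.unop = E.symm (E y.unop) * E.symm (E x.unop)
    rw [LinearEquiv.symm_apply_apply, LinearEquiv.symm_apply_apply]

theorem IsWeakHopfAlgebra.anti [Coalgebra k A] {T : A ≃ₗ[k] A}
    (hA : IsWeakHopfAlgebra k A T.toLinearMap) (E : A ≃ₗ[k] B) :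
    letI := antiRing E
    letI := antiAlgebra E
    letI := transportCoalgebra E
    IsWeakHopfAlgebra k B (E.symm ≪≫ₗ T.symm ≪≫ₗ E).toLinearMap := by
  let _ := antiRing E
  let _ := antiAlgebra E
  let _ := transportCoalgebra E
  refine hA.op.transport (opAlgEquiv E) _ (fun a => ?_) (fun a => ?_) fun a => ?_
  · induction a with | _ a
    rw [comul_eq_sw (MulOpposite.op a), map_sw, sw_op a fun p q => _]
    change map E.toLinearMap E.toLinearMap (comul (R := k) (E.symm (E a))) = _
    rw [LinearEquiv.symm_apply_apply, comul_eq_sw a, map_sw]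
    rfl
  · induction a with | _ a
    change counit (R := k) (E.symm (E a)) = counit (R := k) a
    rw [LinearEquiv.symm_apply_apply]
  · induction a with | _ a
    change E (T.symm (E.symm (E a))) = E (T.symm a)
    rw [LinearEquiv.symm_apply_apply]

theorem comul_antiAlgEquiv [Coalgebra k A] (E : A ≃ₗ[k] B) (a : A) :
    letI := antiRing E
    letI := antiAlgebra E
    letI := transportCoalgebra E
    comul (R := k) (antiAlgEquiv E a) =
      map (antiAlgEquiv E).toLinearMap (antiAlgEquiv E).toLinearMap (comul (R := k) a) := by
  let _ := antiRing E
  let _ := antiAlgebra E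
  let _ := transportCoalgebra E
  change comul (R := k) (MulOpposite.op (E a)) = _
  have h : comul (R := k) (E a) = sw k a fun p q => E p ⊗ₜ[k] E q := by
    change map E.toLinearMap E.toLinearMap (comul (R := k) (E.symm (E a))) = _
    rw [LinearEquiv.symm_apply_apply, comul_eq_sw a, map_sw]
    rfl
  rw [comul_eq_sw (MulOpposite.op (E a)), sw_op (E a) fun p q => p ⊗ₜ[k] q, sw, h, comul_eq_sw a,
    map_sw]
  simp (disch := first | (intro; fun_prop) | fun_prop) only [sw_tsw, tsw_tmul]
  rfl

theorem opAntipode_antiAlgEquiv (E : A ≃ₗ[k] B) (T : A ≃ₗ[k] A) (a : A) :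
    letI := antiRing E
    letI := antiAlgebra E
    antiAlgEquiv E (T a) = opAntipode (E.symm ≪≫ₗ T.symm ≪≫ₗ E) (antiAlgEquiv E a) :=
  congrArg (fun x => MulOpposite.op (E (T x))) (E.symm_apply_apply a).symm

end OpTransport

/-! ### The double of Nikshych, Turaev and Vainerman -/

section NTV

variable {k H : Type*} [CommRing k] [Ring H] [Algebra k H] [Coalgebra k H]

local notation "ε" => (counit : H →ₗ[k] k)

variable (k H) in
/-- The additive group of `D'(H)`. -/
@[reducible] def ntvAddCommGroup : AddCommGroup (NTVDouble k H) :=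
  inferInstanceAs (AddCommGroup ((Dual k H ⊗[k] H) ⧸ ntvIdeal k H))

attribute [local instance] ntvAddCommGroup

variable (k H) in
/-- The module structure of `D'(H)`. -/
@[reducible] def ntvModule : Module k (NTVDouble k H) :=
  inferInstanceAs (Module k ((Dual k H ⊗[k] H) ⧸ ntvIdeal k H))

attribute [local instance] ntvModule doubleAddCommGroup doubleModule

variable (k H) in
/-- The quotient map `H* ⊗ H → D'(H)`. -/
def ntvMk : Dual k H ⊗[k] H →ₗ[k] NTVDouble k H := (ntvIdeal k H).mkQ

theorem ntvMk_surjective : Function.Surjective (ntvMk k H) := Submodule.mkQ_surjective _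

variable {S : H ≃ₗ[k] H}

theorem isTarget_of_mem (hH : IsWeakBialgebra k H) {z : H} (hz : z ∈ targetSpace k H) :
    IsTarget k z := by
  obtain ⟨x, rfl⟩ := hz
  exact hH.isTarget_targetMap x

theorem isSource_of_mem (hH : IsWeakBialgebra k H) {y : H} (hy : y ∈ sourceSpace k H) :
    IsSource k y := by
  obtain ⟨x, rfl⟩ := hy
  exact hH.isSource_sourceMap x

variable (S) in
/-- The isomorphism `h ⊗ φ ↦ φ ⊗ S⁻¹(h)`. -/
def swapEquiv : H ⊗[k] Dual k H ≃ₗ[k] Dual k H ⊗[k] H :=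
  comm k H (Dual k H) ≪≫ₗ TensorProduct.congr (.refl k _) S.symm

theorem swapEquiv_tmul (h : H) (φ : Dual k H) : swapEquiv S (h ⊗ₜ[k] φ) = φ ⊗ₜ[k] S.symm h := rfl

theorem swapEquiv_symm_tmul (φ : Dual k H) (h : H) :
    (swapEquiv S).symm (φ ⊗ₜ[k] h) = S h ⊗ₜ[k] φ := rfl

namespace IsWeakHopfAlgebra

variable (hH : IsWeakHopfAlgebra k H S.toLinearMap)
include hH

/-- By `dualMul_dualAct_counit` the generators of `I` are balancing relations: `z ∈ H_t` acts from
the right, and in the next lemma `y ∈ H_s` acts from the left through `ε_t(y) = S(y)`. -/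
theorem ntvMk_target_mul {z : H} (hz : IsTarget k z) (φ : Dual k H) (h : H) :
    ntvMk k H (φ ⊗ₜ[k] (z * h)) = ntvMk k H (dualAct k H 1 z φ ⊗ₜ[k] h) := by
  have : dualAct k H 1 z φ = dualMul k H (dualAct k H 1 z ε ⊗ₜ[k] φ) := by
    rw [hH.dualMul_dualAct_counit, targetMap_one, hz.targetMapOp_eq]
  rw [this]
  exact (Submodule.Quotient.eq _).2 <| Submodule.subset_span <|
    .inl ⟨z, ⟨z, hz.targetMap_eq⟩, φ, h, rfl⟩

theorem ntvMk_source_mul {y : H} (hy : IsSource k y) (φ : Dual k H) (h : H) :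
    ntvMk k H (φ ⊗ₜ[k] (y * h)) = ntvMk k H (dualAct k H (S y) 1 φ ⊗ₜ[k] h) := by
  have : dualAct k H (S y) 1 φ = dualMul k H (dualAct k H y 1 ε ⊗ₜ[k] φ) := by
    rw [hH.dualMul_dualAct_counit, hH.targetMapOp_one, hH.targetMap_source hy]
    rfl
  rw [this]
  exact (Submodule.Quotient.eq _).2 <| Submodule.subset_span <|
    .inr ⟨y, ⟨y, hy.sourceMap_eq⟩, φ, h, rfl⟩

theorem balanced_ntvMk : Balanced S (ntvMk k H ∘ₗ (swapEquiv S).toLinearMap) where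
  source h y φ hy := by
    simp only [LinearMap.comp_apply, LinearEquiv.coe_coe, swapEquiv_tmul, hH.symm_mul,
      hH.ntvMk_target_mul (hH.isTarget_symm hy)]
  target h z φ hz := by
    simp only [LinearMap.comp_apply, LinearEquiv.coe_coe, swapEquiv_tmul, hH.symm_mul,
      hH.ntvMk_source_mul (hH.isSource_symm hz), LinearEquiv.apply_symm_apply]

/-- Since `S` reverses products and maps `H_t` to `H_s` and `H_s` to `H_t`, the generators of `I`
become the two balancing relations of `D(H)`. With `balanced_ntvMk` this gives mutually inverse maps
of the quotients. -/
theorem ntvIdeal_le_ker :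
    ntvIdeal k H ≤ LinearMap.ker (doubleMk S ∘ₗ (swapEquiv S).symm.toLinearMap) := by
  refine Submodule.span_le.2 ?_
  rintro _ (⟨z, hz, φ, h, rfl⟩ | ⟨y, hy, φ, h, rfl⟩)
  · replace hz := isTarget_of_mem hH.toIsWeakBialgebra hz
    simp only [SetLike.mem_coe, LinearMap.mem_ker, map_sub, LinearMap.comp_apply,
      LinearEquiv.coe_coe, swapEquiv_symm_tmul, hH.equiv_mul,
      hH.doubleMk_mul_source _ (hH.isSource_equiv hz), LinearEquiv.symm_apply_apply,
      hH.dualMul_dualAct_counit, targetMap_one, hz.targetMapOp_eq, sub_self]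
  · replace hy := isSource_of_mem hH.toIsWeakBialgebra hy
    have := hH.targetMap_source hy
    simp only [LinearEquiv.coe_coe] at this
    simp only [SetLike.mem_coe, LinearMap.mem_ker, map_sub, LinearMap.comp_apply,
      LinearEquiv.coe_coe, swapEquiv_symm_tmul, hH.equiv_mul,
      hH.doubleMk_mul_target _ (hH.isTarget_equiv hy), hH.dualMul_dualAct_counit,
      hH.targetMapOp_one, this, sub_self]

/-- The isomorphism `[h ⋈ φ] ↦ [φ ⊗ S⁻¹(h)]` of modules. -/
def doubleEquiv : DrinfeldDouble S ≃ₗ[k] NTVDouble k H :=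
  LinearEquiv.ofLinearMap (hH.doubleLift _ hH.balanced_ntvMk)
    ((ntvIdeal k H).liftQ _ hH.ntvIdeal_le_ker)
    (LinearMap.ext fun x => by
      obtain ⟨x, rfl⟩ := ntvMk_surjective x
      exact congrArg (ntvMk k H) ((swapEquiv S).apply_symm_apply x))
    (LinearMap.ext fun x => by
      obtain ⟨x, rfl⟩ := doubleMk_surjective S x
      exact congrArg (doubleMk S) ((swapEquiv S).symm_apply_apply x))

omit hH in
theorem _root_.WeakHopf.ntvSmashMap_tmul (h : H) (ψ : Dual k H) : ntvSmashMap S (h ⊗ₜ[k] ψ) =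
    sw k h fun a b => sw k b fun c d => dualAct k H d (S a) ψ ⊗ₜ[k] c := by
  simp only [ntvSmashMap, TensorProduct.lift.tmul, LinearMap.mk₂_apply, comul₂_eq_sw, map_sw,
    equiv_map_sw, TensorProduct.leftComm_tmul, TensorProduct.comm_tmul, LinearMap.rTensor_tmul]
  rfl

omit hH in
theorem _root_.WeakHopf.ntvMul_tmul (φ ψ : Dual k H) (h l : H) :
    ntvMul S (φ ⊗ₜ[k] h) (ψ ⊗ₜ[k] l) = sw k h fun a b => sw k b fun c d =>
      dualMul k H (dualAct k H d (S a) ψ ⊗ₜ[k] φ) ⊗ₜ[k] (c * l) := by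
  have : ntvMul S (φ ⊗ₜ[k] h) (ψ ⊗ₜ[k] l) =
      map (dualMul k H ∘ₗ (comm k (Dual k H) (Dual k H)).toLinearMap) (LinearMap.mul' k H)
        ((TensorProduct.tensorTensorTensorAssoc k (Dual k H) (Dual k H) H H).symm
          ((φ ⊗ₜ[k] ntvSmashMap S (h ⊗ₜ[k] ψ)) ⊗ₜ[k] l)) := by
    simp [ntvMul]
  rw [this, ntvSmashMap_tmul]
  simp only [tmul_sw, sw_tmul, map_sw, equiv_map_sw,
    TensorProduct.tensorTensorTensorAssoc_symm_tmul, TensorProduct.map_tmul, LinearMap.mul'_apply]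
  rfl

theorem sw_sw_equiv {M : Type*} [AddCommMonoid M] [Module k M] (h : H) (F : H → H → H → M)
    (h₁ : ∀ b c, Lin k fun a => F a b c := by intros; fun_prop)
    (h₂ : ∀ a c, Lin k fun b => F a b c := by intros; fun_prop)
    (h₃ : ∀ a b, Lin k fun c => F a b c := by intros; fun_prop) :
    (sw k (S h) fun a b => sw k b fun c d => F a c d) =
      sw k h fun a b => sw k b fun c d => F (S d) (S c) (S a) := by
  rw [hH.sw_equiv h fun a b => sw k b fun c d => F a c d,
    ← sw_assoc h fun a c d => F (S d) (S c) (S a)]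
  exact sw_congr _ fun a b => hH.sw_equiv a fun c d => F (S b) c d

/-- Products are reversed already before passing to the quotients, because `S` reverses products and
coproducts. Neither associativity of `ntvMul` nor its compatibility with `I` needs a separate
argument. -/
theorem swapEquiv_bowtieMul (x y : Dual k H ⊗[k] H) :
    swapEquiv S (bowtieMul S ((swapEquiv S).symm y) ((swapEquiv S).symm x)) = ntvMul S x y := by
  induction x with
  | zero => simp
  | add x x' hx hx' => simp only [map_add, LinearMap.add_apply, hx, hx']
  | tmul φ h =>
  induction y with
  | zero => simp
  | add y y' hy hy' => simp only [map_add, LinearMap.add_apply, hy, hy']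
  | tmul ψ l =>
    rw [swapEquiv_symm_tmul, swapEquiv_symm_tmul, bowtieMul_tmul, ntvMul_tmul]
    simp only [equiv_map_sw, swapEquiv_tmul]
    rw [hH.sw_sw_equiv h fun a c d =>
      dualMul k H (dualAct k H (S.symm a) d ψ ⊗ₜ[k] φ) ⊗ₜ[k] S.symm (S l * c)]
    simp only [← hH.equiv_mul, LinearEquiv.symm_apply_apply]

variable [Module.Finite k H] [Module.Projective k H]

attribute [local instance] dualCoalgebra

omit hH in
theorem _root_.WeakHopf.ntvComul_tmul (φ : Dual k H) (h : H) : ntvComul k H (φ ⊗ₜ[k] h) =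
    sw k h fun a b => sw k φ fun α β => (α ⊗ₜ[k] a) ⊗ₜ[k] (β ⊗ₜ[k] b) := by
  have : dualComul k H φ = sw k φ fun α β => α ⊗ₜ[k] β := comul_eq_sw φ
  simp only [ntvComul, LinearMap.comp_apply, TensorProduct.map_tmul, this, comul_eq_sw h,
    map_sw, sw_tmul, tmul_sw]
  rfl

/-- The reversal of the legs of `h` in `doubleComul` is undone by `S`, which also reverses them. -/
theorem map_swapEquiv_doubleComul (x : Dual k H ⊗[k] H) :
    map (swapEquiv S).toLinearMap (swapEquiv S).toLinearMap
      (doubleComul k H ((swapEquiv S).symm x)) = ntvComul k H x := by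
  induction x with
  | zero => simp
  | add x x' hx hx' => simp only [map_add, hx, hx']
  | tmul φ h =>
    simp only [swapEquiv_symm_tmul, doubleComul_tmul, ntvComul_tmul, map_sw,
      TensorProduct.map_tmul, LinearEquiv.coe_coe, swapEquiv_tmul]
    rw [hH.sw_equiv h fun a b => sw k φ fun α β =>
      (α ⊗ₜ[k] S.symm b) ⊗ₜ[k] (β ⊗ₜ[k] S.symm a)]
    simp only [LinearEquiv.symm_apply_apply]

theorem map_doubleEquiv_doubleMk (t : (H ⊗[k] Dual k H) ⊗[k] (H ⊗[k] Dual k H)) :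
    map hH.doubleEquiv.toLinearMap hH.doubleEquiv.toLinearMap
      (map (doubleMk S) (doubleMk S) t) =
    map (ntvMk k H) (ntvMk k H) (map (swapEquiv S).toLinearMap (swapEquiv S).toLinearMap t) := by
  rw [← LinearMap.comp_apply, ← TensorProduct.map_comp, ← LinearMap.comp_apply (map (ntvMk k H) _),
    ← TensorProduct.map_comp]
  rfl

omit hH in
theorem _root_.WeakHopf.ntvAntipode_tmul (φ : Dual k H) (h : H) : ntvAntipode S (φ ⊗ₜ[k] h) =
    sw k h fun a b => sw k b fun c d =>
      S.symm.toLinearMap.dualMap (dualAct k H (S d) a φ) ⊗ₜ[k] S c := by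
  simp only [ntvAntipode, LinearMap.comp_apply, TensorProduct.map_tmul, comul₂_eq_sw, map_sw,
    LinearEquiv.coe_coe, TensorProduct.comm_tmul, LinearMap.lTensor_tmul, sw_tmul,
    pairOuter_dualComul₂]

/-- Reversing the product inverts the antipode, so the antipode of `D'(H)` corresponds to the
inverse antipode of `D(H)`. -/
theorem swapEquiv_doubleAntipodeInv (x : Dual k H ⊗[k] H) :
    swapEquiv S (doubleAntipodeInv S ((swapEquiv S).symm x)) = ntvAntipode S x := by
  induction x with
  | zero => simp
  | add x x' hx hx' => simp only [map_add, hx, hx']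
  | tmul φ h =>
    simp only [swapEquiv_symm_tmul, doubleAntipodeInv_tmul, ntvAntipode_tmul, equiv_map_sw,
      swapEquiv_tmul]
    rw [hH.sw_sw_equiv h fun a c d =>
      S.symm.toLinearMap.dualMap (dualAct k H a (S.symm d) φ) ⊗ₜ[k] S.symm (S c)]
    simp only [LinearEquiv.symm_apply_apply]

end IsWeakHopfAlgebra

end NTV

end WeakHopf

end

/-! ### The two doubles and their comparison -/

open WeakHopf in
theorem proposition4p4 {k H : Type*} [CommRing k] [Ring H] [Algebra k H] [Coalgebra k H]
    [Module.Finite k H] [Module.Projective k H]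
    (S : H ≃ₗ[k] H) (hH : IsWeakHopfAlgebra k H S.toLinearMap) :
    ∃ (_ : Ring (DrinfeldDouble S)) (_ : Algebra k (DrinfeldDouble S))
      (_ : Coalgebra k (DrinfeldDouble S)) (SD : DrinfeldDouble S ≃ₗ[k] DrinfeldDouble S)
      (π : H ⊗[k] Module.Dual k H →ₗ[k] DrinfeldDouble S)
      (_ : Ring (NTVDouble k H)) (_ : Algebra k (NTVDouble k H))
      (_ : Coalgebra k (NTVDouble k H)) (SD' : NTVDouble k H ≃ₗ[k] NTVDouble k H)
      (π' : Module.Dual k H ⊗[k] H →ₗ[k] NTVDouble k H)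
      (F : DrinfeldDouble S ≃ₐ[k] (NTVDouble k H)ᵐᵒᵖ),
      -- the structure on `D(H)`: quotient module, multiplication, unit,
      -- comultiplication, counit, antipode and its inverse
      (∀ x, π x = DrinfeldDouble.mk S x) ∧
      (∀ x y, π x * π y = π (bowtieMul S x y)) ∧
      (1 = π ((1 : H) ⊗ₜ[k] Coalgebra.counit)) ∧
      (∀ x, Coalgebra.comul (R := k) (π x) = TensorProduct.map π π (doubleComul k H x)) ∧
      (∀ (h : H) (φ : Module.Dual k H),
        Coalgebra.counit (R := k) (π (h ⊗ₜ[k] φ)) = φ (targetMap k H (S.symm h)) ∧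
        Coalgebra.counit (R := k) (π (h ⊗ₜ[k] φ)) = φ (targetMapOp k H h)) ∧
      (∀ x, SD (π x) = π (doubleAntipode S x)) ∧
      (∀ x, SD.symm (π x) = π (doubleAntipodeInv S x)) ∧
      IsWeakHopfAlgebra k (DrinfeldDouble S) SD.toLinearMap ∧
      -- the structure on `D'(H)`
      (∀ x, π' x = NTVDouble.mk k H x) ∧
      (∀ x y, π' x * π' y = π' (ntvMul S x y)) ∧
      (1 = π' (Coalgebra.counit ⊗ₜ[k] (1 : H))) ∧
      (∀ x, Coalgebra.comul (R := k) (π' x) = TensorProduct.map π' π' (ntvComul k H x)) ∧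
      (∀ (φ : Module.Dual k H) (h : H),
        Coalgebra.counit (R := k) (π' (φ ⊗ₜ[k] h)) = φ (targetMap k H h)) ∧
      (∀ x, SD' (π' x) = π' (ntvAntipode S x)) ∧
      IsWeakHopfAlgebra k (NTVDouble k H) SD'.toLinearMap ∧
      -- `D'(H)ᵒᵖ` is a weak Hopf algebra, and `F : D(H) → D'(H)ᵒᵖ` is an isomorphism of such
      IsWeakHopfAlgebra k (NTVDouble k H)ᵐᵒᵖ (opAntipode SD').toLinearMap ∧
      (∀ (h : H) (φ : Module.Dual k H),
        F (π (h ⊗ₜ[k] φ)) = MulOpposite.op (π' (φ ⊗ₜ[k] S.symm h))) ∧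
      (∀ a, Coalgebra.comul (R := k) (F a) =
        TensorProduct.map F.toLinearMap F.toLinearMap (Coalgebra.comul (R := k) a)) ∧
      (∀ a, Coalgebra.counit (R := k) (F a) = Coalgebra.counit (R := k) a) ∧
      (∀ a, F (SD a) = opAntipode SD' (F a)) := by
  let _ := doubleAddCommGroup S
  let _ := doubleModule S
  let _ := ntvAddCommGroup k H
  let _ := ntvModule k H
  let rD := hH.doubleRing
  let aD := hH.doubleAlgebra
  let cD := hH.doubleCoalgebra
  have hD : IsWeakHopfAlgebra k (DrinfeldDouble S) hH.doubleAntipodeEquiv.toLinearMap :=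
    hH.isWeakHopfAlgebra_double
  -- All structure on `D'(H)` is transported from `D(H)` along `E`, with the product reversed and
  -- the antipode inverted. It remains to match it with the explicit formulas.
  let E : DrinfeldDouble S ≃ₗ[k] NTVDouble k H := hH.doubleEquiv
  let rN := antiRing E
  let aN := antiAlgebra E
  let cN := transportCoalgebra E
  let T : NTVDouble k H ≃ₗ[k] NTVDouble k H := E.symm ≪≫ₗ hH.doubleAntipodeEquiv.symm ≪≫ₗ E
  have hN : IsWeakHopfAlgebra k (NTVDouble k H) T.toLinearMap := hD.anti E
  -- The formulas for `D(H)` hold by `rfl`, apart from the counit in terms of `ε_t ∘ S⁻¹`, because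
  -- its structure maps are induced by the explicit ones.
  refine ⟨rD, aD, cD, hH.doubleAntipodeEquiv, doubleMk S, rN, aN, cN, T, ntvMk k H,
    antiAlgEquiv E, fun _ => rfl, fun _ _ => rfl, rfl, fun _ => rfl, fun h φ => ⟨?_, rfl⟩,
    fun _ => rfl, fun _ => rfl, hD, fun _ => rfl, fun x y => ?_, ?_, fun x => ?_, fun φ h => ?_,
    fun x => ?_, hN, hN.op, fun _ _ => rfl, fun a => ?_, fun a => ?_, fun a => ?_⟩
  · rw [← hH.targetMapOp_eq]
    rfl
  · exact congrArg (ntvMk k H) (hH.swapEquiv_bowtieMul x y)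
  · exact congrArg (fun h => ntvMk k H (Coalgebra.counit ⊗ₜ[k] h)) hH.symm_one
  · exact (hH.map_doubleEquiv_doubleMk _).trans
      (congrArg (TensorProduct.map _ _) (hH.map_swapEquiv_doubleComul x))
  · exact congrArg φ (hH.targetMapOp_antipode h)
  · exact congrArg (ntvMk k H) (hH.swapEquiv_doubleAntipodeInv x)
  · exact comul_antiAlgEquiv E a
  · exact congrArg (Coalgebra.counit (R := k)) (E.symm_apply_apply a)
  · exact opAntipode_antiAlgEquiv E hH.doubleAntipodeEquiv a
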